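/- **Setting.** Let $d\ge 9$, let $f:[-1,1]\to\mathbb R$ be non-decreasing with $f(0)=0$ and $f(1)=1$, let $\theta^\star\in\mathbb R^d$ be an unknown unit vector, and let $\delta\in(0,1/2)$. Querying an action $a$ in the unit ball returns a reward $f(\langle\theta^\star,a\rangle)+z$, where the noises $z$ are independent standard normal variables. Put $m=\lceil d/16\rceil$, $h=1/\sqrt{2d}$, and for $y\in[20h,\infty)$ put $$G(y)=\inf_{z\in[5y/6,\,5y/3]}|f(z+0.2h)-f(z)|.$$ For $1\le i\le m$ define $$\varepsilon_i=\begin{cases}\dfrac12\displaystyle\inf_{z\in[2/\sqrt d,\,2.8/\sqrt d]}\Big|f\Big(z+\frac{0.2}{\sqrt d}\Big)-f(z)\Big| & \text{if } i\le 100,\\[2mm] \dfrac12\displaystyle\sup_{20h\le y\le\sqrt{2(i-1)/d}}G(y) & \text{if } i>100,\end{cases}$$ and assume that $\varepsilon_i>0$ for all $1\le i\le m$. For each $101\le i\le m$ let $y_i\in[20h,\sqrt{2(i-1)/d}]$ be a maximizer of $G$ on this interval or, more generally, any point of it at which $G$ is at least half of its supremum there. **Algorithm (iterative direction search).** Let $c>0$,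 $L=2m\log(2m/\delta)/c$ and $\delta'=\delta/L$. In epoch $i=1,\dots,m$, with orthonormal $v_1,\dots,v_{i-1}$ found before, repeat the following until a direction is accepted: sample $v$ uniformly from the unit sphere of $\mathrm{span}(v_1,\dots,v_{i-1})^\perp$, independently of everything else, and apply a test to $v$; if the test accepts, set $v_i=v$ and go on to the next epoch. The tests are as follows. * If $i\le100$: query $v$ for $\lceil 2\log(2/\delta')/\varepsilon_i^2\rceil$ times and let $\bar r$ be the average reward; accept if $|\bar r-f(x)|\le\varepsilon_i$ for some $x\in[2.2/\sqrt d,2.8/\sqrt d]$. * If $i>100$: let $v_{\rm pre}=(i-1)^{-1/2}\sum_{j<i}v_j$, $x_{\rm pre}=2\sqrt{(i-1)/d}$, $\lambda=\sqrt2\,y_i/x_{\rm pre}$ and $\varepsilon=\tfrac12G(y_i)$ (which is $\varepsilon_i$ if $y_i$ is a maximizer). Query each of $a_\pm=(\lambda v_{\rm pre}\pm v)/\sqrt2$ for $\lceil 2\log(4/\delta')/\varepsilon^2\rceil$ times and let $\bar r_\pm$ be the average rewards; accept if $|\bar r_--f(z-x)|\le\varepsilon$ and $|\bar r_+-f(z+x)|\le\varepsilon$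 for some $z\in[y_i,3y_i/2]$ and $x\in[2.2h,2.8h]$. After epoch $m$, output $a_0=m^{-1/2}\sum_{i=1}^m v_i$. **Theorem.** There are absolute constants $c_0>0$ and $0<\kappa_1<\kappa_2$ such that for every $c\in(0,c_0]$ there is a constant $C>0$, depending only on $c$, for which the following holds for all $d,f,\theta^\star,\delta$ (and $y_i$) as above. With probability at least $1-\delta$, the algorithm terminates and outputs an action $a_0$ with $\|a_0\|\le1$ and $\langle\theta^\star,a_0\rangle\ge\frac12$, and the total number $T$ of queries it makes satisfies $$T\le C\log^2\Big(\frac d\delta\Big)\sum_{i=1}^{m}\frac1{\varepsilon_i^2}.$$ If in addition $f$ is differentiable on $(0,1)$, then $T$ also satisfies, on the same event, $$T\le C\log^2\Big(\frac d\delta\Big)\,d^2\int_{\sqrt{1/d}}^{1/2}\frac{\mathrm d(x^2)}{\displaystyle\sup_{1/(2\sqrt d)\le y\le x}\ \inf_{z\in[\kappa_1y,\kappa_2y]\cap(0,1)}f'(z)^2},$$ where the right-hand side may be $+\infty$. -/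

import Mathlib

open MeasureTheory ProbabilityTheory Set

namespace RidgeBandit

noncomputable section

/-- The ambient space `ℝ^d` with its Euclidean norm. -/
abbrev Vec (d : ℕ) := EuclideanSpace ℝ (Fin d)

/-! ### The finite-difference quantities -/

/-- Half the smallest increment of `f` over a step `0.2/√d`, started in `[2/√d, 2.8/√d]`. -/
def initGap (f : ℝ → ℝ) (d : ℕ) : ℝ :=
  (1 / 2) * sInf ((fun z : ℝ => |f (z + 0.2 / √(d : ℝ)) - f z|) ''
    Icc (2 / √(d : ℝ)) (2.8 / √(d : ℝ)))

/-- The smallest increment of `f` over a step `0.2/√(2d)`, started in `[5y/6, 5y/3]`. -/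
def windowMin (f : ℝ → ℝ) (d : ℕ) (y : ℝ) : ℝ :=
  sInf ((fun z : ℝ => |f (z + 0.2 / √(2 * d : ℝ)) - f z|) '' Icc (5 * y / 6) (5 * y / 3))

/-- The number of epochs. -/
def numEpochs (d : ℕ) : ℕ := ⌈(d : ℝ) / 16⌉₊

/-- The quantities `ε_i`, `1 ≤ i ≤ ⌈d/16⌉`. Minima and maxima are read as infima and suprema,
since `f` need not be continuous. -/
def eps (f : ℝ → ℝ) (d i : ℕ) : ℝ :=
  if i ≤ 100 then initGap f d
  else (1 / 2) * sSup (windowMin f d '' Icc (20 / √(2 * d : ℝ)) (√(2 * ((i : ℝ) - 1) / d)))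

/-! ### The oracle and the sampling of directions -/

/-- The noisy oracle: the reward of action `a` when the noise takes the value `z`. -/
def oracle {d : ℕ} (f : ℝ → ℝ) (θ : Vec d) (a : Vec d) (z : ℝ) : ℝ := f (inner ℝ θ a) + z

/-- A direction in `Vᗮ`, computed from a vector `g`: the normalized projection of `g` to `Vᗮ`.
If `g` is a standard Gaussian vector, this is a uniform sample from the unit sphere of `Vᗮ`:
see `sampleDir_mem_sphere` and `sampleDir_invariant`. -/
def sampleDir {d : ℕ} (V : Submodule ℝ (Vec d)) (g : Vec d) : Vec d :=
  ‖Vᗮ.starProjection g‖⁻¹ • Vᗮ.starProjection g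

theorem measurable_sampleDir {d : ℕ} (V : Submodule ℝ (Vec d)) : Measurable (sampleDir V) := by
  have h : Measurable (fun g : Vec d => Vᗮ.starProjection g) :=
    Vᗮ.starProjection.continuous.measurable
  exact h.norm.inv.smul h

/-- Samples lie on the unit sphere of `Vᗮ`, almost surely. -/
theorem sampleDir_mem_sphere {d : ℕ} (V : Submodule ℝ (Vec d)) (hV : V ≠ ⊤) :
    ∀ᵐ g ∂(stdGaussian (Vec d)), sampleDir V g ∈ Vᗮ ∧ ‖sampleDir V g‖ = 1 := by
  obtain ⟨e, heV, he0⟩ : ∃ e ∈ Vᗮ, e ≠ 0 :=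
    Submodule.exists_mem_ne_zero_of_ne_bot
      (fun h => hV ((Submodule.orthogonal_eq_bot_iff).1 h))
  have hmap := IsGaussian.map_eq_gaussianReal (μ := stdGaussian (Vec d)) (innerSL ℝ e)
  rw [variance_dual_stdGaussian, innerSL_apply_norm] at hmap
  have hv : (‖e‖ ^ 2).toNNReal ≠ 0 := by
    have : 0 < ‖e‖ := norm_pos_iff.2 he0
    exact (Real.toNNReal_pos.2 (by positivity)).ne'
  have hnull : (stdGaussian (Vec d)) (innerSL ℝ e ⁻¹' {0}) = 0 := by
    rw [← Measure.map_apply (innerSL ℝ e).continuous.measurable (measurableSet_singleton 0), hmap]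
    have := nullSingletonClass_gaussianReal (μ := (stdGaussian (Vec d))[innerSL ℝ e]) hv
    exact measure_singleton _
  have hae : ∀ᵐ g ∂(stdGaussian (Vec d)), g ∉ innerSL ℝ e ⁻¹' {0} :=
    measure_eq_zero_iff_ae_notMem.1 hnull
  filter_upwards [hae] with g hg
  have hp : Vᗮ.starProjection g ≠ 0 := by
    intro h0
    apply hg
    have h1 := Submodule.starProjection_inner_eq_zero (K := Vᗮ) g e heV
    rw [h0, sub_zero] at h1
    rw [mem_preimage, mem_singleton_iff, innerSL_apply_apply, real_inner_comm]
    exact h1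
  refine ⟨Submodule.smul_mem _ _ (Submodule.starProjection_apply_mem _ _), ?_⟩
  rw [sampleDir, norm_smul, norm_inv, norm_norm]
  exact inv_mul_cancel₀ (norm_ne_zero_iff.2 hp)

/-- The law of the samples is invariant under all rotations that preserve `V`. -/
theorem sampleDir_invariant {d : ℕ} (V : Submodule ℝ (Vec d)) (U : Vec d ≃ₗᵢ[ℝ] Vec d)
    (hU : V.map (U.toLinearEquiv : Vec d →ₗ[ℝ] Vec d) = V) :
    ((stdGaussian (Vec d)).map (sampleDir V)).map U = (stdGaussian (Vec d)).map (sampleDir V) := by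
  have hproj : ∀ g, Vᗮ.starProjection (U g) = U (Vᗮ.starProjection g) := by
    intro g
    have h := Submodule.starProjection_map_apply U V (U g)
    simp only [hU, LinearIsometryEquiv.symm_apply_apply] at h
    simp [Submodule.starProjection_orthogonal, h]
  have hcomm : U ∘ sampleDir V = sampleDir V ∘ U := by
    funext g
    simp only [Function.comp_apply, sampleDir, hproj, LinearIsometryEquiv.norm_map, map_smul]
  rw [Measure.map_map U.continuous.measurable (measurable_sampleDir V), hcomm,
    ← Measure.map_map (measurable_sampleDir V) U.continuous.measurable, stdGaussian_map U]

/-- Fresh randomness for one pass through a while loop: a vector for sampling the test direction,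
and the noise values of the queries made in that pass. -/
abbrev Seed (d : ℕ) := Vec d × (ℕ → ℝ)

/-- The law of the randomness: everything is independent, the sampling vectors are standard
Gaussian in `ℝ^d`, the noise values are standard normal. -/
def seedLaw (d : ℕ) : Measure (ℕ → Seed d) :=
  Measure.infinitePi fun _ : ℕ =>
    (stdGaussian (Vec d)).prod (Measure.infinitePi fun _ : ℕ => gaussianReal 0 1)

/-- The average reward of `N` queries of `a`, with the noise values `z k, …, z (k + N - 1)`. -/
def avgReward {d : ℕ} (O : Vec d → ℝ → ℝ) (a : Vec d) (z : ℕ → ℝ) (k N : ℕ) : ℝ :=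
  (∑ j ∈ Finset.range N, O a (z (k + j))) / N

/-! ### The two certification tests

The argument `δ` is the error probability of the test, and `O` the oracle. -/

/-- The number of queries of the test for initial directions. -/
def initQueries (f : ℝ → ℝ) (d : ℕ) (δ : ℝ) : ℕ := ⌈2 * Real.log (2 / δ) / initGap f d ^ 2⌉₊

/-- The test for initial directions returns "true" for the direction `v`. -/
def InitialActionHypTest {d : ℕ} (f : ℝ → ℝ) (O : Vec d → ℝ → ℝ) (δ : ℝ) (v : Vec d)
    (z : ℕ → ℝ) : Prop :=
  ∃ x ∈ Icc (2.2 / √(d : ℝ)) (2.8 / √(d : ℝ)),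
    |avgReward O v z 0 (initQueries f d δ) - f x| ≤ initGap f d

/-- The tolerance of the test for subsequent directions, centered at `y`. -/
def goodGap (f : ℝ → ℝ) (d : ℕ) (y : ℝ) : ℝ := (1 / 2) * windowMin f d y

/-- The number of queries that the test for subsequent directions makes of each of its
two actions. -/
def goodQueries (f : ℝ → ℝ) (d : ℕ) (δ y : ℝ) : ℕ :=
  ⌈2 * Real.log (4 / δ) / goodGap f d y ^ 2⌉₊

/-- The test for subsequent directions returns "true" for the direction `v`; here `vpre` is the
current good action, `xpre` the estimate of its inner product with `θ`, and `y` the center. -/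
def GoodActionHypTest {d : ℕ} (f : ℝ → ℝ) (O : Vec d → ℝ → ℝ) (δ : ℝ) (vpre : Vec d)
    (xpre y : ℝ) (v : Vec d) (z : ℕ → ℝ) : Prop :=
  let lam : ℝ := √2 * y / xpre
  let N : ℕ := goodQueries f d δ y
  let aMinus : Vec d := (1 / √2 : ℝ) • (lam • vpre - v)
  let aPlus : Vec d := (1 / √2 : ℝ) • (lam • vpre + v)
  ∃ t ∈ Icc y (3 * y / 2), ∃ x ∈ Icc (2.2 / √(2 * d : ℝ)) (2.8 / √(2 * d : ℝ)),
    |avgReward O aMinus z 0 N - f (t - x)| ≤ goodGap f d y ∧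
      |avgReward O aPlus z N N - f (t + x)| ≤ goodGap f d y

/-- The estimate `2√((i-1)/d)` of the inner product that is used in epoch `i`. -/
def xPre (d i : ℕ) : ℝ := 2 * √(((i : ℝ) - 1) / d)

/-- Admissible centers `y` for the test, given `xpre`: points of `[20/√(2d), xpre/√2]` at which
`windowMin f d` is at least half of its supremum over that interval. Every maximizer is
admissible; the factor leaves room for the case that `f` is discontinuous and the supremum is
not attained. -/
def IsCenter (f : ℝ → ℝ) (d : ℕ) (xpre y : ℝ) : Prop :=
  y ∈ Icc (20 / √(2 * d : ℝ)) (xpre / √2) ∧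
    sSup (windowMin f d '' Icc (20 / √(2 * d : ℝ)) (xpre / √2)) ≤ 2 * windowMin f d y

/-! ### The iterative direction search algorithm -/

/-- The state of the algorithm: the accepted directions (the latest one first), and the number
of oracle queries made so far. -/
structure State (d : ℕ) where
  dirs : List (Vec d)
  samples : ℕ

/-- The error probability `δ/L`, `L = 2m log(2m/δ)/c`, at which the tests are called. -/
def testError (d : ℕ) (c δ : ℝ) : ℝ :=
  δ / (2 * numEpochs d * Real.log (2 * numEpochs d / δ) / c)

open Classical in
/-- One pass through the while loop of the current epoch `i` (so `i - 1` directions have been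
accepted); the state does not change any more once `⌈d/16⌉` directions have been accepted.
`center i` is the center that the test uses in epoch `i > 100`. -/
def step {d : ℕ} (f : ℝ → ℝ) (c δ : ℝ) (center : ℕ → ℝ) (O : Vec d → ℝ → ℝ)
    (s : State d) (r : Seed d) : State d :=
  if numEpochs d ≤ s.dirs.length then s
  else
    let i : ℕ := s.dirs.length + 1
    let v : Vec d := sampleDir (Submodule.span ℝ {u | u ∈ s.dirs}) r.1
    let δ' : ℝ := testError d c δ
    if i ≤ 100 then
      { dirs := if InitialActionHypTest f O δ' v r.2 then v :: s.dirs else s.dirs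
        samples := s.samples + initQueries f d δ' }
    else
      let vpre : Vec d := (1 / √((i : ℝ) - 1)) • s.dirs.sum
      { dirs := if GoodActionHypTest f O δ' vpre (xPre d i) (center i) v r.2
          then v :: s.dirs else s.dirs
        samples := s.samples + 2 * goodQueries f d δ' (center i) }

/-- The state after `n` passes. -/
def run {d : ℕ} (f : ℝ → ℝ) (c δ : ℝ) (center : ℕ → ℝ) (O : Vec d → ℝ → ℝ)
    (ω : ℕ → Seed d) : ℕ → State d
  | 0 => { dirs := [], samples := 0 }
  | n + 1 => step f c δ center O (run f c δ center O ω n) (ω n)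

/-- On the randomness `ω`, the algorithm terminates, makes `T` queries in total, and outputs
the action `a`. -/
def Outputs {d : ℕ} (f : ℝ → ℝ) (c δ : ℝ) (center : ℕ → ℝ) (O : Vec d → ℝ → ℝ)
    (ω : ℕ → Seed d) (a : Vec d) (T : ℕ) : Prop :=
  ∃ n : ℕ, (run f c δ center O ω n).dirs.length = numEpochs d ∧
    a = (1 / √(numEpochs d : ℝ)) • (run f c δ center O ω n).dirs.sum ∧
    T = (run f c δ center O ω n).samples

/-! ### The integral bound -/

/-- The integral of `d(x²) / max_y min_z f'(z)²` over `x ∈ [√(1/d), 1/2]`, where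
`y ∈ [1/(2√d), x]`, and `z ∈ [κ₁ y, κ₂ y]` is restricted to `(0, 1)`. -/
def burnInIntegral (f : ℝ → ℝ) (d : ℕ) (κ₁ κ₂ : ℝ) : ENNReal :=
  ∫⁻ x in Icc (√(1 / d : ℝ)) (1 / 2 : ℝ),
    ENNReal.ofReal (2 * x) /
      ⨆ y ∈ Icc (1 / (2 * √(d : ℝ))) x, ⨅ z ∈ Icc (κ₁ * y) (κ₂ * y) ∩ Ioo (0 : ℝ) 1,
        ENNReal.ofReal (deriv f z ^ 2)

end

end RidgeBandit

namespace RidgeBandit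

open Filter Topology Metric

/-! ### Unions of closed balls of equal radius -/

/-! One accepted direction. Let `v` be uniform on the unit sphere orthogonal to `k < m` directions
whose inner products with `θ` lie in `[2/√d, 3/√d]`. As `16k < d`, a fixed fraction of `‖θ‖²` is
left in the complement, so `⟨θ, v⟩` has typical size `1/√d` and falls into the window `[2.2/√d,
2.8/√d]` with probability at least the absolute constant `dirProb` (`le_stdGaussian_informative`).
If all averages have error below the tolerance, a test accepts every direction in this window and
accepts only directions in the wider window `[2/√d, 3/√d]`. For the initial test this is
monotonicity: `f` rises by twice the tolerance over each step `0.2/√d` in the relevant range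
(`init_sound`). For the later test the base point is known only up to a factor `3/2`; comparing
rewards at two symmetric points cancels this uncertainty (`good_sound`). After `m ≥ d/16`
acceptances the normalized sum has inner product at least `√m · 2/√d ≥ 1/2` with `θ`.

Failure probability. Allow `K = ⌊log(2m/δ)/c⌋` passes per epoch. The search can fail only by a noise
deviation, of probability at most `δ'` per pass, or by `K` consecutive uninformative samples in one
epoch. The potential `searchPotential` bounds the probability of the second kind; its mean grows by
at most `δ'` per pass (`drift_searchStep`), and Markov's inequality after `mK` passes gives `m(1 -
dirProb)^K + mKδ' ≤ δ/2 + δ/2`. The first summand is small because `c` is small, the second because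
of the choice of `δ'`.

Measurability. The argument integrates over a Markov chain, while the literal algorithm handles
lists and existential tests for a possibly discontinuous `f`. It is therefore compared with a
measurable chain, `searchStep`, whose tests accept on open sets. The open and closed acceptance
regions differ by a Lebesgue null set (`measure_biUnion_closedBall_diff_thickening`), which averages
of Gaussian noise avoid almost surely. While the chain has not failed, the algorithm follows it
(`matches_run`).

Query count. A pass of epoch `i` costs `O(log(1/δ')/ε_i²)`, and there are at most `K` passes per
epoch; each of `K` and `log(1/δ')` contributes one logarithm. For the integral bound, split
`[√(1/d), 1/2]` at the points `√(i/d)`: each cell has mass `1/d` under `d(x²)`, and there the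
denominator is at most `200dε_i²`, because a lower bound for `f'` over a wide window forces
increments of `f` (`slope_le_eps`). -/

/-- A union of closed balls of radius `g` exceeds the union of the open balls by a null set. -/
theorem measure_biUnion_closedBall_diff_thickening {E : Type*} [NormedAddCommGroup E]
    [NormedSpace ℝ E] [FiniteDimensional ℝ E] [MeasurableSpace E] [BorelSpace E]
    (μ : Measure E) [μ.IsAddHaarMeasure] (A : Set E) {g : ℝ} (hg : 0 < g) :
    μ ((⋃ a ∈ A, closedBall a g) \ thickening g A) = 0 := by
  set s := (⋃ a ∈ A, closedBall a g) \ thickening g A with hs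
  -- The density theorem holds for arbitrary sets, so neither `A` nor `s` has to be measurable.
  have hae := Besicovitch.ae_tendsto_measure_inter_div μ s
  by_contra hne
  have hne' : μ.restrict s ≠ 0 := by rwa [Ne, Measure.restrict_eq_zero]
  have : (ae (μ.restrict s)).NeBot := ae_neBot.2 hne'
  obtain ⟨x, hx, hxs⟩ : ∃ x, Tendsto (fun r => μ (s ∩ closedBall x r) / μ (closedBall x r))
      (𝓝[>] 0) (𝓝 1) ∧ x ∈ s := by
    by_contra hcon
    push Not at hcon
    have hnot : ∀ᵐ x ∂(μ.restrict s), x ∉ s := by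
      filter_upwards [hae] with x hx using hcon x hx
    have h0 : μ s = 0 := by
      have := measure_eq_zero_iff_ae_notMem.2 hnot
      rwa [Measure.restrict_apply_self] at this
    exact hne h0
  obtain ⟨hxU, hxT⟩ := hxs
  simp only [mem_iUnion, exists_prop] at hxU
  obtain ⟨a, haA, hxa⟩ := hxU
  have hsub : ball a g ⊆ thickening g A := fun y hy => mem_thickening_iff.2 ⟨a, haA, hy⟩
  set n := Module.finrank ℝ E with hn
  set q : ℝ := (1 / 2) ^ n with hq
  have hq0 : 0 < q := by positivity
  have hq1 : q ≤ 1 := pow_le_one₀ (by norm_num) (by norm_num)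
  have hbound : ∀ r ∈ Ioo (0 : ℝ) g,
      μ (s ∩ closedBall x r) / μ (closedBall x r) ≤ ENNReal.ofReal (1 - q) := by
    rintro r ⟨hr0, hrg⟩
    -- Moving from `x` towards `a` by at most `r / 2` gives the center of a ball of radius `r / 2`
    -- that lies both in `closedBall x r` and in the open ball around `a`. The set `s` misses it, so
    -- `s` fills at most a fraction `1 - 2⁻ⁿ` of `closedBall x r` and has no density point.
    set y : E := x + (r / (2 * g)) • (a - x) with hy
    have hxa' : ‖a - x‖ ≤ g := by
      have := mem_closedBall.1 hxa
      rwa [dist_comm, dist_eq_norm] at this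
    have hyx : dist y x ≤ r / 2 := by
      rw [dist_eq_norm, hy, add_sub_cancel_left, norm_smul, Real.norm_eq_abs,
        abs_of_pos (by positivity)]
      calc r / (2 * g) * ‖a - x‖ ≤ r / (2 * g) * g := by gcongr
        _ = r / 2 := by field_simp
    have hya : dist y a ≤ g - r / 2 := by
      have : y - a = (1 - r / (2 * g)) • (x - a) := by
        rw [hy]; module
      have h1 : 0 ≤ 1 - r / (2 * g) := by
        rw [sub_nonneg, div_le_one (by positivity)]; linarith
      rw [dist_eq_norm, this, norm_smul, Real.norm_eq_abs, abs_of_nonneg h1, norm_sub_rev]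
      calc (1 - r / (2 * g)) * ‖a - x‖ ≤ (1 - r / (2 * g)) * g := by gcongr
        _ = g - r / 2 := by field_simp
    have hB1 : ball y (r / 2) ⊆ closedBall x r := fun w hw => by
      have := mem_ball.1 hw
      have h2 := dist_triangle w y x
      exact mem_closedBall.2 (by linarith)
    have hB2 : ball y (r / 2) ⊆ ball a g := fun w hw => by
      have := mem_ball.1 hw
      have h2 := dist_triangle w y a
      exact mem_ball.2 (by linarith)
    have hsub2 : s ∩ closedBall x r ⊆ closedBall x r \ ball y (r / 2) := by
      rintro w ⟨hw, hwr⟩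
      exact ⟨hwr, fun hwb => hw.2 (hsub (hB2 hwb))⟩
    have hv : μ (ball y (r / 2)) = ENNReal.ofReal q * μ (closedBall x r) := by
      have e1 := Measure.addHaar_ball_of_pos μ y (r := r / 2) (by positivity)
      have e2 := Measure.addHaar_closedBall μ x (r := r) hr0.le
      rw [e1, e2, ← mul_assoc, ← ENNReal.ofReal_mul hq0.le, ← hn, hq, ← mul_pow]
      congr 3
      ring
    have hfin : μ (closedBall x r) ≠ ⊤ := measure_closedBall_lt_top.ne
    have hpos : μ (closedBall x r) ≠ 0 := (measure_closedBall_pos μ x hr0).ne'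
    calc μ (s ∩ closedBall x r) / μ (closedBall x r)
        ≤ μ (closedBall x r \ ball y (r / 2)) / μ (closedBall x r) := by
          gcongr
      _ = (μ (closedBall x r) - ENNReal.ofReal q * μ (closedBall x r)) / μ (closedBall x r) := by
          rw [measure_sdiff hB1 measurableSet_ball.nullMeasurableSet measure_ball_lt_top.ne, hv]
      _ = (ENNReal.ofReal (1 - q) * μ (closedBall x r)) / μ (closedBall x r) := by
          rw [ENNReal.ofReal_sub _ hq0.le, ENNReal.sub_mul (fun _ _ => hfin)]
          simp
      _ = ENNReal.ofReal (1 - q) := ENNReal.mul_div_cancel_right hpos hfin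
  have hle : (1 : ENNReal) ≤ ENNReal.ofReal (1 - q) := by
    refine le_of_tendsto hx ?_
    filter_upwards [Ioo_mem_nhdsGT hg] with r hr using hbound r hr
  have : (1 : ℝ) ≤ 1 - q := by
    have h := ENNReal.toReal_mono ENNReal.ofReal_ne_top hle
    rwa [ENNReal.toReal_ofReal (by linarith), ENNReal.toReal_one] at h
  linarith

/-! ### Averages of independent standard normal noise -/

/-- The law of the noise in one pass. -/
noncomputable abbrev noiseLaw : Measure (ℕ → ℝ) := Measure.infinitePi fun _ : ℕ => gaussianReal 0 1

/-- The average of the noise values `z k, …, z (k + N - 1)`. -/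
noncomputable def avgNoise (k N : ℕ) (z : ℕ → ℝ) : ℝ := (∑ j ∈ Finset.range N, z (k + j)) / N

theorem measurable_avgNoise (k N : ℕ) : Measurable (avgNoise k N) := by
  unfold avgNoise; fun_prop

theorem iIndepFun_noise : iIndepFun (fun (i : ℕ) (z : ℕ → ℝ) => z i) noiseLaw :=
  iIndepFun_infinitePi (X := fun (_ : ℕ) (x : ℝ) => x) (fun _ => measurable_id)

theorem avgNoise_eq_comp_shift (k N : ℕ) :
    avgNoise k N = avgNoise 0 N ∘ fun z i => z (k + i) := by
  funext z; simp [avgNoise]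

theorem map_shift_noiseLaw (k : ℕ) : noiseLaw.map (fun z i => z (k + i)) = noiseLaw :=
  Measure.map_infinitePi_infinitePi_of_inj (P := fun _ : ℕ => gaussianReal 0 1)
    (f := fun i => k + i) (add_right_injective k)

theorem map_sum_noiseLaw (N : ℕ) :
    noiseLaw.map (∑ j ∈ Finset.range N, fun z : ℕ → ℝ => z j) = gaussianReal 0 N := by
  induction N with
  | zero =>
    simp only [Finset.range_zero, Finset.sum_empty, Nat.cast_zero, gaussianReal_zero_var]
    have : (0 : (ℕ → ℝ) → ℝ) = fun _ => 0 := rfl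
    rw [this, Measure.map_const, measure_univ, one_smul]
  | succ n ih =>
    rw [Finset.sum_range_succ]
    have hind := iIndepFun_noise.indepFun_finsetSum_of_notMem (fun i => measurable_pi_apply i)
      (s := Finset.range n) (i := n) (by simp)
    have := gaussianReal_add_gaussianReal_of_indepFun hind ih
      (Measure.infinitePi_map_eval (μ := fun _ : ℕ => gaussianReal 0 1) n)
    rw [this]; simp

theorem map_avgNoise (k : ℕ) {N : ℕ} :
    noiseLaw.map (avgNoise k N) = gaussianReal 0 ((1 : NNReal) / N) := by
  have hshift : Measurable (fun (z : ℕ → ℝ) (i : ℕ) => z (k + i)) := by fun_prop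
  rw [avgNoise_eq_comp_shift, ← Measure.map_map (measurable_avgNoise 0 N) hshift,
    map_shift_noiseLaw]
  have h : avgNoise 0 N = (fun x => x / (N : ℝ)) ∘ ∑ j ∈ Finset.range N, fun z : ℕ → ℝ => z j := by
    funext z; simp [avgNoise]
  rw [h, ← Measure.map_map (by fun_prop) (by fun_prop), map_sum_noiseLaw, gaussianReal_map_div_const]
  congr 1
  · simp
  · ext
    push_cast
    -- For `N = 0` the variance `1 / N` has the default value `0`, which is right for the empty
    -- average.
    rcases eq_or_ne (N : ℝ) 0 with h | h
    · simp [h]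
    · field_simp

theorem gaussianReal_tail (v : NNReal) {t : ℝ} (ht : 0 ≤ t) :
    (gaussianReal 0 v) {x | t ≤ |x|} ≤ ENNReal.ofReal (2 * Real.exp (-t ^ 2 / (2 * v))) := by
  have h1 : HasSubgaussianMGF (fun x : ℝ => x) v (gaussianReal 0 v) := by
    refine ⟨fun s => integrable_exp_mul_gaussianReal s, fun s => ?_⟩
    rw [mgf_fun_id_gaussianReal]; simp
  have e1 := h1.measure_ge_le ht
  have e2 := h1.neg.measure_ge_le ht
  have hsub : {x : ℝ | t ≤ |x|} ⊆ {x | t ≤ x} ∪ {x | t ≤ (-fun x : ℝ => x) x} := by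
    intro x hx
    rcases le_abs.1 (show t ≤ |x| from hx) with h | h
    · exact Or.inl h
    · exact Or.inr h
  refine (measure_mono hsub).trans ((measure_union_le _ _).trans ?_)
  rw [two_mul, ENNReal.ofReal_add (by positivity) (by positivity)]
  gcongr
  · rw [← ofReal_measureReal]; exact ENNReal.ofReal_le_ofReal e1
  · rw [← ofReal_measureReal]; exact ENNReal.ofReal_le_ofReal e2

/-- An average of `N` standard normals has variance `1 / N`, so each of its two tails beyond `ε` is
at most `exp (-N ε² / 2) ≤ η`. This is where the query counts of the tests come from. -/
theorem noise_tail (k : ℕ) {N : ℕ} {ε : ℝ} (hε : 0 < ε) {η : ℝ} (hη : 0 < η)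
    (hN : 0 < N) (h : 2 * Real.log (1 / η) ≤ N * ε ^ 2) :
    noiseLaw {z | ε ≤ |avgNoise k N z|} ≤ ENNReal.ofReal (2 * η) := by
  have hmeas : MeasurableSet {x : ℝ | ε ≤ |x|} := measurableSet_le measurable_const (by fun_prop)
  have : {z | ε ≤ |avgNoise k N z|} = avgNoise k N ⁻¹' {x | ε ≤ |x|} := rfl
  rw [this, ← Measure.map_apply (measurable_avgNoise k N) hmeas, map_avgNoise]
  refine (gaussianReal_tail _ hε.le).trans (ENNReal.ofReal_le_ofReal ?_)
  have hN' : (0 : ℝ) < N := by exact_mod_cast hN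
  have e : -ε ^ 2 / (2 * (((1 : NNReal) / N : NNReal) : ℝ)) = -(N * ε ^ 2 / 2) := by
    push_cast; field_simp
  rw [e]
  have : Real.exp (-(N * ε ^ 2 / 2)) ≤ η := by
    rw [← Real.le_log_iff_exp_le hη]
    rw [one_div, Real.log_inv] at h
    linarith
  linarith

theorem map_avgNoise_absolutelyContinuous (k : ℕ) {N : ℕ} (hN : 0 < N) :
    noiseLaw.map (avgNoise k N) ≪ volume := by
  rw [map_avgNoise]
  refine gaussianReal_absolutelyContinuous _ ?_
  have : (0 : NNReal) < N := by exact_mod_cast hN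
  positivity

theorem indepFun_avgNoise (N : ℕ) : IndepFun (avgNoise 0 N) (avgNoise N N) noiseLaw := by
  have h := iIndepFun_noise.indepFun_finset (Finset.range N) (Finset.Ico N (N + N))
    (by rw [Finset.disjoint_left]; intro a ha hb; simp at ha hb; omega)
    (fun i => measurable_pi_apply i)
  have h2 := h.comp (φ := fun t : Finset.range N → ℝ => (∑ i, t i) / N)
    (ψ := fun t : Finset.Ico N (N + N) → ℝ => (∑ i, t i) / N) (by fun_prop) (by fun_prop)
  convert h2 using 1
  · funext z
    simp only [avgNoise, Function.comp_apply, zero_add]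
    rw [Finset.sum_coe_sort (Finset.range N) (fun i => z i)]
  · funext z
    simp only [avgNoise, Function.comp_apply]
    rw [Finset.sum_coe_sort (Finset.Ico N (N + N)) (fun i => z i), Finset.sum_Ico_eq_sum_range]
    simp

theorem map_avgNoise_pair_absolutelyContinuous {N : ℕ} (hN : 0 < N) :
    noiseLaw.map (fun z => (avgNoise 0 N z, avgNoise N N z)) ≪ (volume : Measure (ℝ × ℝ)) := by
  rw [(indepFun_avgNoise N).map_prod_eq_prod_map_map (measurable_avgNoise 0 N).aemeasurable
    (measurable_avgNoise N N).aemeasurable]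
  exact (map_avgNoise_absolutelyContinuous 0 hN).prod (map_avgNoise_absolutelyContinuous N hN)

theorem noise_null (k : ℕ) {N : ℕ} (hN : 0 < N) {B : Set ℝ} (hB : volume B = 0) (a : ℝ) :
    noiseLaw {z | a + avgNoise k N z ∈ B} = 0 := by
  have h0 : volume ((fun x => a + x) ⁻¹' B) = 0 := by rwa [measure_preimage_add]
  have h1 := map_avgNoise_absolutelyContinuous k hN h0
  exact le_antisymm ((Measure.le_map_apply (measurable_avgNoise k N).aemeasurable _).trans h1.le)
    (zero_le)

/-- The two averages use disjoint blocks of noise, hence are independent, and their joint law has a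
density in the plane. -/
theorem noise_pair_null {N : ℕ} (hN : 0 < N) {B : Set (ℝ × ℝ)} (hB : volume B = 0) (a b : ℝ) :
    noiseLaw {z | (a + avgNoise 0 N z, b + avgNoise N N z) ∈ B} = 0 := by
  have h0 : volume ((fun x => (a, b) + x) ⁻¹' B) = 0 := by rwa [measure_preimage_add]
  have h1 := map_avgNoise_pair_absolutelyContinuous hN h0
  exact le_antisymm ((Measure.le_map_apply ((measurable_avgNoise 0 N).prodMk
    (measurable_avgNoise N N)).aemeasurable _).trans h1.le) (zero_le)

end RidgeBandit

namespace RidgeBandit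

/-! ### Standard normal coordinates -/

theorem gaussianPDFReal_le (x : ℝ) : gaussianPDFReal 0 1 x ≤ 2 / 5 := by
  have h : (5 / 2 : ℝ) ≤ √(2 * Real.pi) := by
    apply Real.le_sqrt_of_sq_le
    nlinarith [Real.pi_gt_d2]
  rw [gaussianPDFReal_def]
  have e : Real.exp (-(x - 0) ^ 2 / (2 * ((1 : NNReal) : ℝ))) ≤ 1 := by
    apply Real.exp_le_one_iff.2
    have := sq_nonneg (x - 0)
    simp only [NNReal.coe_one]
    linarith
  have h2 : (√(2 * Real.pi * ((1 : NNReal) : ℝ)))⁻¹ ≤ 2 / 5 := by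
    rw [NNReal.coe_one, mul_one]
    calc (√(2 * Real.pi))⁻¹ ≤ (5 / 2 : ℝ)⁻¹ := inv_anti₀ (by norm_num) h
      _ = 2 / 5 := by norm_num
  exact (mul_le_mul h2 e (Real.exp_nonneg _) (by norm_num)).trans_eq (by norm_num)

theorem gaussianReal_small_ball_le :
    gaussianReal 0 1 {x | |x| < 1 / 4} ≤ ENNReal.ofReal (1 / 5) := by
  have hs : {x : ℝ | |x| < 1 / 4} = Ioo (-(1 / 4)) (1 / 4) := by
    ext x; simp [abs_lt]
  rw [hs, gaussianReal_apply _ one_ne_zero]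
  calc ∫⁻ x in Ioo (-(1 / 4) : ℝ) (1 / 4), gaussianPDF 0 1 x
      ≤ ∫⁻ _ in Ioo (-(1 / 4) : ℝ) (1 / 4), ENNReal.ofReal (2 / 5) :=
        lintegral_mono fun x => ENNReal.ofReal_le_ofReal (gaussianPDFReal_le x)
    _ = ENNReal.ofReal (1 / 5) := by
        rw [setLIntegral_const, Real.volume_Ioo, ← ENNReal.ofReal_mul (by norm_num)]
        norm_num

/-- On `[a, b] ⊆ [0, M]` the normal density is at least its value at `M`. -/
theorem le_gaussianReal_Icc {a b M : ℝ} (ha : 0 ≤ a) (hb : b ≤ M) :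
    ENNReal.ofReal ((b - a) * gaussianPDFReal 0 1 M) ≤ gaussianReal 0 1 (Icc a b) := by
  rw [gaussianReal_apply _ one_ne_zero]
  calc ENNReal.ofReal ((b - a) * gaussianPDFReal 0 1 M)
      = ∫⁻ _ in Icc a b, ENNReal.ofReal (gaussianPDFReal 0 1 M) := by
        rw [setLIntegral_const, Real.volume_Icc, mul_comm,
          ENNReal.ofReal_mul (gaussianPDFReal_nonneg _ _ _)]
    _ ≤ ∫⁻ x in Icc a b, gaussianPDF 0 1 x := by
        refine setLIntegral_mono (measurable_gaussianPDF _ _) fun x hx => ?_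
        refine ENNReal.ofReal_le_ofReal ?_
        simp only [gaussianPDFReal_def]
        gcongr
        · simpa using ha.trans hx.1
        · exact hx.2.trans hb

theorem lintegral_sq_gaussianReal :
    ∫⁻ x, ENNReal.ofReal (x ^ 2) ∂(gaussianReal 0 1) = 1 := by
  have hL : MemLp (fun x : ℝ => x) 2 (gaussianReal 0 1) := memLp_id_gaussianReal' 2 (by simp)
  rw [← ofReal_integral_eq_lintegral_ofReal hL.integrable_sq (ae_of_all _ fun x => sq_nonneg x)]
  have h := variance_of_integral_eq_zero (X := fun x : ℝ => x) (μ := gaussianReal 0 1)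
    (by fun_prop) (by simp)
  rw [variance_fun_id_gaussianReal] at h
  rw [← h]; simp

/-! ### Sums of squares of normal coordinates, and one coordinate compared with such a sum -/

section Coordinates

variable {ι : Type*} [Fintype ι]

/-- The law of independent standard normal coordinates. -/
noncomputable abbrev coordLaw (ι : Type*) [Fintype ι] : Measure (ι → ℝ) :=
  Measure.pi fun _ : ι => gaussianReal 0 1

theorem lintegral_sum_coord (A : Finset ι) {φ : ℝ → ENNReal} (hφ : Measurable φ) :
    ∫⁻ x, ∑ i ∈ A, φ (x i) ∂(coordLaw ι) = A.card * ∫⁻ t, φ t ∂(gaussianReal 0 1) := by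
  have hm : ∀ i, Measurable fun x : ι → ℝ => φ (x i) := fun i => hφ.comp (measurable_pi_apply i)
  rw [lintegral_finsetSum _ (fun i _ => hm i)]
  have : ∀ i ∈ A, ∫⁻ x, φ (x i) ∂(coordLaw ι) = ∫⁻ t, φ t ∂(gaussianReal 0 1) := fun i _ =>
    (measurePreserving_eval (fun _ : ι => gaussianReal 0 1) i).lintegral_comp hφ
  rw [Finset.sum_congr rfl this]
  simp

theorem coordLaw_sum_sq_large (A : Finset ι) {D : ℝ} (hD : 0 < D) (hA : (A.card : ℝ) ≤ D) :
    coordLaw ι {x | 4 * D ≤ ∑ i ∈ A, x i ^ 2} ≤ ENNReal.ofReal (1 / 4) := by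
  have hsub : {x : ι → ℝ | 4 * D ≤ ∑ i ∈ A, x i ^ 2} ⊆
      {x | ENNReal.ofReal (4 * D) ≤ ∑ i ∈ A, ENNReal.ofReal (x i ^ 2)} := by
    intro x hx
    rw [mem_ofPred_eq, ← ENNReal.ofReal_sum_of_nonneg fun i _ => sq_nonneg _]
    exact ENNReal.ofReal_le_ofReal hx
  refine (measure_mono hsub).trans ((meas_ge_le_lintegral_div
    (Finset.measurable_sum _ fun i _ => by fun_prop).aemeasurable ?_ ENNReal.ofReal_ne_top).trans ?_)
  · simpa using hD
  · rw [lintegral_sum_coord A (φ := fun t => ENNReal.ofReal (t ^ 2)) (by fun_prop),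
      lintegral_sq_gaussianReal, mul_one]
    refine ENNReal.div_le_of_le_mul ?_
    rw [← ENNReal.ofReal_mul (by norm_num), ← ENNReal.ofReal_natCast]
    exact ENNReal.ofReal_le_ofReal (by linarith)

/-- A coordinate with `|x i| ≥ 1/4` contributes at least `1/16`, so a sum of at most `D / 40` leaves
at most `2D/5 ≤ card A / 2` of them. Hence at least half of the coordinates are below `1/4` in
absolute value; each one is so with probability at most `1/5`, and Markov's inequality for their
number gives `2/5`. -/
theorem coordLaw_sum_sq_small (A : Finset ι) {D : ℝ} (hD : 0 < D) (hA : 4 / 5 * D ≤ A.card) :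
    coordLaw ι {x | ∑ i ∈ A, x i ^ 2 ≤ D / 40} ≤ ENNReal.ofReal (2 / 5) := by
  classical
  set φ : ℝ → ENNReal := indicator {t : ℝ | |t| < 1 / 4} 1 with hφ
  have hms : MeasurableSet {t : ℝ | |t| < 1 / 4} := measurableSet_lt (by fun_prop) (by fun_prop)
  have hφm : Measurable φ := measurable_one.indicator hms
  have hm : ∀ i, Measurable fun x : ι → ℝ => φ (x i) := fun i => hφm.comp (measurable_pi_apply i)
  have hc : (0 : ℝ) < A.card := lt_of_lt_of_le (by positivity) hA
  have hsub : {x : ι → ℝ | ∑ i ∈ A, x i ^ 2 ≤ D / 40} ⊆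
      {x | ENNReal.ofReal (A.card / 2) ≤ ∑ i ∈ A, φ (x i)} := by
    intro x hx
    have hx' : ∑ i ∈ A, x i ^ 2 ≤ D / 40 := hx
    set B := A.filter fun i => |x i| < 1 / 4
    have h1 : ∑ i ∈ A, φ (x i) = B.card := by
      rw [Finset.card_filter]
      push_cast
      refine Finset.sum_congr rfl fun i _ => ?_
      simp [hφ, indicator_apply]
    have h2 : ((A.filter fun i => ¬ |x i| < 1 / 4).card : ℝ) * (1 / 16) ≤ ∑ i ∈ A, x i ^ 2 := by
      rw [← nsmul_eq_mul]
      refine (Finset.card_nsmul_le_sum _ (fun i => x i ^ 2) _ fun i hi => ?_).trans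
        (Finset.sum_le_sum_of_subset_of_nonneg (Finset.filter_subset _ _)
          fun i _ _ => sq_nonneg _)
      have := (Finset.mem_filter.1 hi).2
      rw [not_lt] at this
      rw [← sq_abs (x i)]
      nlinarith
    have h3 : (B.card : ℝ) + (A.filter fun i => ¬ |x i| < 1 / 4).card = A.card := by
      exact_mod_cast Finset.card_filter_add_card_filter_not (s := A) fun i => |x i| < 1 / 4
    rw [mem_ofPred_eq, h1, ← ENNReal.ofReal_natCast]
    refine ENNReal.ofReal_le_ofReal ?_
    linarith
  refine (measure_mono hsub).trans ((meas_ge_le_lintegral_div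
    (Finset.measurable_sum _ fun i _ => hm i).aemeasurable
    ?_ ENNReal.ofReal_ne_top).trans ?_)
  · simpa using hc
  · rw [lintegral_sum_coord A hφm, hφ, lintegral_indicator_one hms]
    refine ENNReal.div_le_of_le_mul ?_
    calc (A.card : ENNReal) * gaussianReal 0 1 {t : ℝ | |t| < 1 / 4}
        ≤ (A.card : ENNReal) * ENNReal.ofReal (1 / 5) := by
          gcongr; exact gaussianReal_small_ball_le
      _ = ENNReal.ofReal (2 / 5) * ENNReal.ofReal (A.card / 2) := by
          rw [← ENNReal.ofReal_natCast, ← ENNReal.ofReal_mul (by positivity),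
            ← ENNReal.ofReal_mul (by positivity)]
          congr 1; ring

theorem le_coordLaw_sum_sq_mem (A : Finset ι) {D : ℝ} (hD : 0 < D) (hA : 4 / 5 * D ≤ A.card)
    (hA' : (A.card : ℝ) ≤ D) :
    ENNReal.ofReal (1 / 4) ≤ coordLaw ι {x | ∑ i ∈ A, x i ^ 2 ∈ Icc (D / 40) (4 * D)} := by
  have h1 := coordLaw_sum_sq_large A hD hA'
  have h2 := coordLaw_sum_sq_small A hD hA
  have hcov : (univ : Set (ι → ℝ)) ⊆ {x | ∑ i ∈ A, x i ^ 2 ∈ Icc (D / 40) (4 * D)} ∪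
      ({x | 4 * D ≤ ∑ i ∈ A, x i ^ 2} ∪ {x | ∑ i ∈ A, x i ^ 2 ≤ D / 40}) := by
    intro x _
    by_cases ha : 4 * D ≤ ∑ i ∈ A, x i ^ 2
    · exact Or.inr (Or.inl ha)
    by_cases hb : ∑ i ∈ A, x i ^ 2 ≤ D / 40
    · exact Or.inr (Or.inr hb)
    · exact Or.inl ⟨(not_le.1 hb).le, (not_le.1 ha).le⟩
  have h3 := (measure_mono (μ := coordLaw ι) hcov).trans
    ((measure_union_le _ _).trans (add_le_add_right (measure_union_le _ _) _))
  rw [measure_univ] at h3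
  have h4 := h3.trans (add_le_add_right (add_le_add h1 h2) _)
  rw [← ENNReal.ofReal_add (by norm_num) (by norm_num)] at h4
  have h5 : (1 : ENNReal) - ENNReal.ofReal (1 / 4 + 2 / 5) ≤
      coordLaw ι {x | ∑ i ∈ A, x i ^ 2 ∈ Icc (D / 40) (4 * D)} := tsub_le_iff_right.2 h4
  refine le_trans ?_ h5
  rw [← ENNReal.ofReal_one, ← ENNReal.ofReal_sub _ (by norm_num)]
  exact ENNReal.ofReal_le_ofReal (by norm_num)

/-- The constant in the lower bound for the probability of an informative direction. -/
noncomputable def dirProb : ℝ := (1 / 4) * (9 / 100 * gaussianPDFReal 0 1 14)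

theorem dirProb_pos : 0 < dirProb := by
  have := gaussianPDFReal_pos 0 1 14 one_ne_zero
  unfold dirProb; positivity

theorem dirProb_lt_one : dirProb < 1 := by
  have := gaussianPDFReal_le 14
  unfold dirProb; linarith

/-- The sum `Q` is independent of `x i₀` and lies in `[D/40, 4D]` with probability at least `1/4`.
For such a value of `Q` the bounds on `α² D` give `0.33 ≤ α√Q ≤ 11`, so the target interval for `x
i₀` has length at least `(3/11) · 0.33 = 9/100` and lies in `[0, 14]`. -/
theorem le_coordLaw_window (A : Finset ι) {i₀ : ι} (hi₀ : i₀ ∉ A) {D α : ℝ} (hD : 0 < D)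
    (hA : 4 / 5 * D ≤ A.card) (hA' : (A.card : ℝ) ≤ D) (hα : 0 ≤ α) (hα1 : 484 / 100 ≤ α ^ 2 * D)
    (hα2 : α ^ 2 * D ≤ 29) :
    ENNReal.ofReal dirProb ≤ coordLaw ι {x | 0 < ∑ i ∈ A, x i ^ 2 ∧
      x i₀ ∈ Icc (α * √(∑ i ∈ A, x i ^ 2)) (14 / 11 * (α * √(∑ i ∈ A, x i ^ 2)))} := by
  classical
  set Q : (ι → ℝ) → ℝ := fun x => ∑ i ∈ A, x i ^ 2 with hQ
  have hQm : Measurable Q := by fun_prop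
  have hX : IndepFun (fun x : ι → ℝ => x i₀) Q (coordLaw ι) := by
    have hiid : iIndepFun (fun (i : ι) (x : ι → ℝ) => x i) (coordLaw ι) := by
      have := iIndepFun_pi (μ := fun _ : ι => gaussianReal 0 1) (X := fun _ (t : ℝ) => t)
        (fun _ => by fun_prop)
      exact this
    have h := hiid.indepFun_finset {i₀} A (by simpa using hi₀) (fun i => measurable_pi_apply i)
    have m1 : Measurable fun t : ({i₀} : Finset ι) → ℝ => t ⟨i₀, by simp⟩ := measurable_pi_apply _
    have m2 : Measurable fun t : A → ℝ => ∑ i, t i ^ 2 := by fun_prop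
    have h2 := h.comp m1 m2
    have hQ' : Q = (fun t : A → ℝ => ∑ i, t i ^ 2) ∘ fun x (i : A) => x i :=
      funext fun x => (Finset.sum_coe_sort A fun i => x i ^ 2).symm
    rw [hQ']
    exact h2
  set S : Set (ℝ × ℝ) := {y | 0 < y.2 ∧ y.1 ∈ Icc (α * √y.2) (14 / 11 * (α * √y.2))} with hS
  have hSm : MeasurableSet S := by
    refine (measurableSet_lt measurable_const measurable_snd).inter ?_
    have h1 : Measurable fun y : ℝ × ℝ => α * √y.2 := by fun_prop
    exact (measurableSet_le h1 measurable_fst).inter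
      (measurableSet_le measurable_fst (h1.const_mul _))
  have hmap := hX.map_prod_eq_prod_map_map (measurable_pi_apply i₀).aemeasurable hQm.aemeasurable
  have hev : (coordLaw ι).map (fun x => x i₀) = gaussianReal 0 1 :=
    (measurePreserving_eval (fun _ : ι => gaussianReal 0 1) i₀).map_eq
  rw [hev] at hmap
  have hmeas : coordLaw ι {x | 0 < Q x ∧ x i₀ ∈ Icc (α * √(Q x)) (14 / 11 * (α * √(Q x)))} =
      ((gaussianReal 0 1).prod ((coordLaw ι).map Q)) S := by
    rw [← hmap, Measure.map_apply (by fun_prop) hSm]; rfl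
  have hprob : IsProbabilityMeasure ((coordLaw ι).map Q) :=
    Measure.isProbabilityMeasure_map hQm.aemeasurable
  rw [hmeas, Measure.prod_apply_symm hSm]
  have hge : ∀ q ∈ Icc (D / 40) (4 * D), ENNReal.ofReal (9 / 100 * gaussianPDFReal 0 1 14) ≤
      gaussianReal 0 1 ((fun x => (x, q)) ⁻¹' S) := by
    intro q hq
    have hq0 : 0 < q := lt_of_lt_of_le (by positivity) hq.1
    have hpre : (fun x => (x, q)) ⁻¹' S = Icc (α * √q) (14 / 11 * (α * √q)) := by
      ext x; simp [hS, hq0]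
    have hsq : (α * √q) ^ 2 = α ^ 2 * q := by rw [mul_pow, Real.sq_sqrt hq0.le]
    have hlow : 33 / 100 ≤ α * √q := by
      refine abs_le_of_sq_le_sq' ?_ (by positivity) |>.2
      rw [hsq]
      nlinarith [hq.1, sq_nonneg α]
    have hup : α * √q ≤ 11 := by
      refine abs_le_of_sq_le_sq' ?_ (by positivity) |>.2
      rw [hsq]
      nlinarith [hq.2, sq_nonneg α]
    rw [hpre]
    refine le_trans (ENNReal.ofReal_le_ofReal ?_)
      (le_gaussianReal_Icc (M := 14) (by positivity) (by linarith))
    have := gaussianPDFReal_nonneg 0 1 14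
    gcongr
    linarith
  calc ENNReal.ofReal dirProb
      = ENNReal.ofReal (9 / 100 * gaussianPDFReal 0 1 14) * ENNReal.ofReal (1 / 4) := by
        rw [dirProb, mul_comm, ENNReal.ofReal_mul]
        have := gaussianPDFReal_nonneg 0 1 14
        positivity
    _ ≤ ENNReal.ofReal (9 / 100 * gaussianPDFReal 0 1 14) *
          ((coordLaw ι).map Q) (Icc (D / 40) (4 * D)) := by
        gcongr
        rw [Measure.map_apply hQm measurableSet_Icc]
        exact le_coordLaw_sum_sq_mem A hD hA hA'
    _ = ∫⁻ _ in Icc (D / 40) (4 * D), ENNReal.ofReal (9 / 100 * gaussianPDFReal 0 1 14)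
          ∂((coordLaw ι).map Q) := by rw [setLIntegral_const]
    _ ≤ ∫⁻ q in Icc (D / 40) (4 * D), gaussianReal 0 1 ((fun x => (x, q)) ⁻¹' S)
          ∂((coordLaw ι).map Q) := by
        refine setLIntegral_mono (measurable_measure_prodMk_right hSm) hge
    _ ≤ _ := setLIntegral_le_lintegral _ _

end Coordinates

end RidgeBandit

namespace RidgeBandit

/-! ### Sampling in the orthogonal complement of orthonormal vectors -/

/-- The vectors `V 0, …, V (k - 1)` are orthonormal. -/
def OrthonormalUpTo {d : ℕ} (k : ℕ) (V : ℕ → Vec d) : Prop :=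
  ∀ i < k, ∀ j < k, inner ℝ (V i) (V j) = if i = j then (1 : ℝ) else 0

/-- The component of `g` orthogonal to the orthonormal vectors `V 0, …, V (k - 1)`. -/
noncomputable def residual {d : ℕ} (k : ℕ) (V : ℕ → Vec d) (g : Vec d) : Vec d :=
  g - ∑ j ∈ Finset.range k, (inner ℝ (V j) g : ℝ) • V j

/-- The normalized component of `g` orthogonal to `V 0, …, V (k - 1)`. -/
noncomputable def residualDir {d : ℕ} (k : ℕ) (V : ℕ → Vec d) (g : Vec d) : Vec d :=
  ‖residual k V g‖⁻¹ • residual k V g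

section Residual

variable {d k : ℕ} {V : ℕ → Vec d}

theorem inner_residual (hV : OrthonormalUpTo k V) {i : ℕ} (hi : i < k) (g : Vec d) :
    inner ℝ (V i) (residual k V g) = 0 := by
  rw [residual, inner_sub_right, inner_sum]
  have : ∀ j ∈ Finset.range k, inner ℝ (V i) ((inner ℝ (V j) g : ℝ) • V j) =
      if i = j then (inner ℝ (V i) g : ℝ) else 0 := by
    intro j hj
    rw [real_inner_smul_right, hV i hi j (Finset.mem_range.1 hj)]
    split_ifs with h
    · rw [h, mul_one]
    · rw [mul_zero]
  rw [Finset.sum_congr rfl this, Finset.sum_ite_eq, if_pos (Finset.mem_range.2 hi), sub_self]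

theorem inner_residual_residual (hV : OrthonormalUpTo k V) (x g : Vec d) :
    inner ℝ (residual k V x) (residual k V g) = inner ℝ x (residual k V g) := by
  conv_lhs => rw [residual]
  rw [inner_sub_left, sum_inner, Finset.sum_eq_zero, sub_zero]
  intro j hj
  rw [real_inner_smul_left, inner_residual hV (Finset.mem_range.1 hj), mul_zero]

theorem inner_residual_right_eq (hV : OrthonormalUpTo k V) (x g : Vec d) :
    inner ℝ x (residual k V g) = inner ℝ (residual k V x) g := by
  rw [← inner_residual_residual hV, real_inner_comm, inner_residual_residual hV, real_inner_comm]

theorem norm_sq_residual (hV : OrthonormalUpTo k V) (x : Vec d) :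
    ‖residual k V x‖ ^ 2 = ‖x‖ ^ 2 - ∑ j ∈ Finset.range k, (inner ℝ x (V j) : ℝ) ^ 2 := by
  rw [← real_inner_self_eq_norm_sq, inner_residual_residual hV, residual, inner_sub_right,
    real_inner_self_eq_norm_sq, inner_sum]
  congr 1
  refine Finset.sum_congr rfl fun j _ => ?_
  rw [real_inner_smul_right, real_inner_comm, sq]

/-- Replaces the projection by an explicit formula that is jointly measurable in `V` and `g`. -/
theorem sampleDir_eq_residualDir (hV : OrthonormalUpTo k V) (g : Vec d) :
    sampleDir (Submodule.span ℝ (V '' Iio k)) g = residualDir k V g := by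
  have h : (Submodule.span ℝ (V '' Iio k))ᗮ.starProjection g = residual k V g := by
    refine Submodule.eq_starProjection_of_mem_orthogonal ?_ ?_
    · rw [Submodule.mem_orthogonal]
      intro u hu
      induction hu using Submodule.span_induction with
      | mem x hx => obtain ⟨j, hj, rfl⟩ := hx; exact inner_residual hV hj g
      | zero => exact inner_zero_left _
      | add x y _ _ hx hy => rw [inner_add_left, hx, hy, add_zero]
      | smul a x _ hx => rw [real_inner_smul_left, hx, mul_zero]
    · refine Submodule.le_orthogonal_orthogonal _ ?_
      rw [residual, sub_sub_cancel]
      exact Submodule.sum_mem _ fun j hj => Submodule.smul_mem _ _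
        (Submodule.subset_span ⟨j, Finset.mem_range.1 hj, rfl⟩)
  rw [sampleDir, h, residualDir]

theorem stdGaussian_residual_eq_zero (hV : OrthonormalUpTo k V) (hk : k < d) :
    stdGaussian (Vec d) {g | residual k V g = 0} = 0 := by
  have hne : Submodule.span ℝ (V '' Iio k) ≠ ⊤ := by
    intro h
    have h1 : Module.finrank ℝ (Submodule.span ℝ (V '' Iio k)) ≤ k := by
      have e : V '' Iio k = ((Finset.range k).image V : Finset (Vec d)) := by
        ext; simp
      rw [e]
      refine (finrank_span_finset_le_card _).trans (Finset.card_image_le.trans ?_)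
      simp
    rw [h, finrank_top, finrank_euclideanSpace_fin] at h1
    omega
  refine measure_mono_null ?_ (ae_iff.1 (sampleDir_mem_sphere _ hne))
  intro g hg h
  have hg' : residual k V g = 0 := hg
  rw [sampleDir_eq_residualDir hV, residualDir, hg'] at h
  simp at h

theorem OrthonormalUpTo.update (hV : OrthonormalUpTo k V) {g : Vec d} (hg : residual k V g ≠ 0) :
    OrthonormalUpTo (k + 1) (Function.update V k (residualDir k V g)) := by
  have h0 : ∀ i < k, inner ℝ (V i) (residualDir k V g) = 0 := fun i hi => by
    rw [residualDir, real_inner_smul_right, inner_residual hV hi, mul_zero]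
  have h1 : ‖residualDir k V g‖ = 1 := by
    rw [residualDir, norm_smul, norm_inv, norm_norm, inv_mul_cancel₀ (norm_ne_zero_iff.2 hg)]
  intro i hi j hj
  rcases Nat.lt_succ_iff_lt_or_eq.1 hi with hi' | rfl <;>
    rcases Nat.lt_succ_iff_lt_or_eq.1 hj with hj' | rfl
  · rw [Function.update_of_ne hi'.ne, Function.update_of_ne hj'.ne, hV i hi' j hj']
  · rw [Function.update_of_ne hi'.ne, Function.update_self, h0 i hi', if_neg hi'.ne]
  · rw [Function.update_of_ne hj'.ne, Function.update_self, real_inner_comm, h0 j hj',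
      if_neg hj'.ne']
  · rw [Function.update_self, real_inner_self_eq_norm_sq, h1, if_pos rfl, one_pow]

/-- Squaring gives `D r² = s2 X² / (X² + Q)` with `s2 = D v²`. Thus `D r² ≥ 2.2²` amounts to `X² (s2
- 4.84) ≥ 4.84 Q`, and `D r² ≤ 2.8²` follows from `X² (s2 - 4.84) ≤ 7.84 Q`, where `14/11 = 2.8/2.2`
makes the same threshold serve both ends. -/
theorem mem_window_of_ratio {D v N Q X r : ℝ} (hD : 0 < D) (h8 : 8 ≤ D * v ^ 2) (hv : 0 ≤ v)
    (hQ : 0 < Q) (hN : 0 ≤ N) (hres : N ^ 2 = X ^ 2 + Q) (hr : r * N = v * X)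
    (hx1 : 2.2 / √(D * v ^ 2 - 4.84) * √Q ≤ X)
    (hx2 : X ≤ 14 / 11 * (2.2 / √(D * v ^ 2 - 4.84) * √Q)) :
    r ∈ Icc (2.2 / √D) (2.8 / √D) := by
  set s2 := D * v ^ 2 with hs2
  have hs : 0 < s2 - 4.84 := by norm_num; linarith
  set α : ℝ := 2.2 / √(s2 - 4.84) with hα
  have hα2 : α ^ 2 = 4.84 / (s2 - 4.84) := by
    rw [hα, div_pow, Real.sq_sqrt hs.le]; norm_num
  have hα0 : 0 ≤ α := by positivity
  have hsqQ : √Q ^ 2 = Q := Real.sq_sqrt hQ.le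
  have hx0 : 0 ≤ X := le_trans (by positivity) hx1
  have hx1' : 4.84 * Q ≤ X ^ 2 * (s2 - 4.84) := by
    have h : (α * √Q) ^ 2 ≤ X ^ 2 := by gcongr
    rw [mul_pow, hsqQ, hα2, div_mul_eq_mul_div, div_le_iff₀ hs] at h
    exact h
  have hx2' : X ^ 2 * (s2 - 4.84) ≤ 7.84 * Q := by
    have h : X ^ 2 ≤ (14 / 11 * (α * √Q)) ^ 2 := by gcongr
    rw [mul_pow, mul_pow, hsqQ, hα2] at h
    have e : (14 / 11) ^ 2 * (4.84 / (s2 - 4.84) * Q) = 7.84 * Q / (s2 - 4.84) := by ring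
    rw [e, le_div_iff₀ hs] at h
    exact h
  have hNpos : 0 < N := by
    refine lt_of_le_of_ne hN fun h => ?_
    rw [← h] at hres
    nlinarith [sq_nonneg X]
  have hr0 : 0 ≤ r := by
    by_contra hcon
    have h1 : r * N < 0 := mul_neg_of_neg_of_pos (not_le.1 hcon) hNpos
    have h2 : 0 ≤ v * X := by positivity
    linarith
  have hrsq : (D * r ^ 2) * (X ^ 2 + Q) = s2 * X ^ 2 := by
    rw [← hres, hs2]
    have : r ^ 2 * N ^ 2 = v ^ 2 * X ^ 2 := by rw [← mul_pow, hr, mul_pow]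
    linear_combination D * this
  have hden : 0 < X ^ 2 + Q := by positivity
  have hlo : 2.2 ^ 2 ≤ D * r ^ 2 := by
    by_contra hcon
    have := mul_lt_mul_of_pos_right (not_le.1 hcon) hden
    rw [hrsq] at this
    norm_num at this hx1'
    linarith
  have hhi : D * r ^ 2 ≤ 2.8 ^ 2 := by
    by_contra hcon
    have := mul_lt_mul_of_pos_right (not_le.1 hcon) hden
    rw [hrsq] at this
    norm_num at this hx2'
    linarith [sq_nonneg X]
  have hsd : 0 < √D := Real.sqrt_pos.2 hD
  have hdr : D * r ^ 2 = (r * √D) ^ 2 := by rw [mul_pow, Real.sq_sqrt hD.le]; ring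
  rw [hdr] at hlo hhi
  refine ⟨?_, ?_⟩
  · rw [div_le_iff₀ hsd]
    exact (abs_le_of_sq_le_sq' hlo (by positivity)).2
  · rw [le_div_iff₀ hsd]
    exact (abs_le_of_sq_le_sq' hhi (by norm_num)).2

/-- A direction sampled orthogonally to few directions of moderate inner product with `θ` is
informative with probability bounded below. -/
theorem le_stdGaussian_informative {θ : Vec d} (hd : 9 ≤ d) (hk : 16 * k < d) (hθ : ‖θ‖ = 1)
    (hV : OrthonormalUpTo k V) (hVθ : ∀ j < k, |(inner ℝ θ (V j) : ℝ)| ≤ 3 / √d) :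
    ENNReal.ofReal dirProb ≤ stdGaussian (Vec d)
      {g | inner ℝ θ (residualDir k V g) ∈ Icc (2.2 / √(d : ℝ)) (2.8 / √(d : ℝ))} := by
  have hd0 : (0 : ℝ) < d := by exact_mod_cast (by omega : 0 < d)
  have hkd : k < d := by omega
  set w := residual k V θ with hw
  set s2 : ℝ := d * ‖w‖ ^ 2 with hs2
  have hwsq : ‖w‖ ^ 2 = 1 - ∑ j ∈ Finset.range k, (inner ℝ θ (V j) : ℝ) ^ 2 := by
    rw [hw, norm_sq_residual hV, hθ, one_pow]
  have hsum : ∑ j ∈ Finset.range k, (inner ℝ θ (V j) : ℝ) ^ 2 ≤ k * (9 / d) := by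
    have : ∀ j ∈ Finset.range k, (inner ℝ θ (V j) : ℝ) ^ 2 ≤ 9 / (d : ℝ) := by
      intro j hj
      have h := hVθ j (Finset.mem_range.1 hj)
      rw [← sq_abs]
      calc |(inner ℝ θ (V j) : ℝ)| ^ 2 ≤ (3 / √(d : ℝ)) ^ 2 := by gcongr
        _ = 9 / (d : ℝ) := by rw [div_pow, Real.sq_sqrt hd0.le]; norm_num
    simpa using Finset.sum_le_sum this
  have hs2low : (d : ℝ) - 9 * k ≤ s2 := by
    have h1 : s2 = d - d * ∑ j ∈ Finset.range k, (inner ℝ θ (V j) : ℝ) ^ 2 := by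
      rw [hs2, hwsq]; ring
    have h2 : (d : ℝ) * ∑ j ∈ Finset.range k, (inner ℝ θ (V j) : ℝ) ^ 2 ≤ d * (k * (9 / d)) := by
      gcongr
    have h3 : (d : ℝ) * (k * (9 / d)) = 9 * k := by field_simp
    linarith
  have hs2up : s2 ≤ d := by
    have h0 : 0 ≤ ∑ j ∈ Finset.range k, (inner ℝ θ (V j) : ℝ) ^ 2 :=
      Finset.sum_nonneg fun _ _ => sq_nonneg _
    rw [hs2, hwsq]
    nlinarith
  -- `16 * k < d` improves to `9 * k + 8 ≤ d` over the integers, with `9 ≤ d` needed for `k = 0`.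
  -- Together with `hs7` this keeps `s2 - 4.84` comparable to `d`, hence `α² d ≤ 29`.
  have hs8 : 8 ≤ s2 := by
    have : 9 * k + 8 ≤ d := by omega
    have : (9 : ℝ) * k + 8 ≤ d := by exact_mod_cast this
    linarith
  have hs7 : 7 / 16 * d ≤ s2 := by
    have : (16 : ℝ) * k ≤ d := by exact_mod_cast hk.le
    linarith
  have hw0 : ‖w‖ ≠ 0 := by
    intro h
    rw [hs2, h] at hs8
    norm_num at hs8
  have hwpos : 0 < ‖w‖ := lt_of_le_of_ne (norm_nonneg _) (Ne.symm hw0)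
  set u : Vec d := ‖w‖⁻¹ • w with hu
  set i₀ : Fin d := ⟨k, hkd⟩ with hi₀
  -- In an orthonormal basis that begins with the `V j` and continues with the normalized residual
  -- of `θ`, the residual of `g` loses exactly its first `k` coordinates, and its inner product with
  -- `θ` is `‖w‖` times coordinate `k`.
  obtain ⟨b, hb⟩ : ∃ b : OrthonormalBasis (Fin d) ℝ (Vec d),
      (∀ i : Fin d, (i : ℕ) < k → b i = V i) ∧ b i₀ = u := by
    have hup := hV.update (g := θ) (by rw [← hw]; exact norm_ne_zero_iff.1 hw0)
    set V' := Function.update V k (residualDir k V θ)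
    obtain ⟨b, hb⟩ := Orthonormal.exists_orthonormalBasis_extension_of_card_eq (𝕜 := ℝ)
      (E := Vec d) (ι := Fin d) (by simp) (v := fun i => V' i) (s := {i | (i : ℕ) < k + 1}) (by
        rw [orthonormal_iff_ite]
        rintro ⟨i, hi⟩ ⟨j, hj⟩
        simp only [Set.domRestrict_apply]
        rw [hup i hi j hj]
        simp [Fin.ext_iff])
    refine ⟨b, fun i hi => ?_, ?_⟩
    · rw [hb i (Nat.lt_succ_of_lt hi)]; exact Function.update_of_ne hi.ne _ _
    · rw [hb i₀ (Nat.lt_succ_self k)]; exact Function.update_self _ _ _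
  obtain ⟨hbV, hbu⟩ := hb
  set A : Finset (Fin d) := Finset.univ.filter fun i => k < (i : ℕ) with hA
  have hi₀A : i₀ ∉ A := by simp [hA, hi₀]
  have hcard : (A.card : ℝ) = d - 1 - k := by
    have : A = Finset.Ioi i₀ := by
      ext i; simp [hA, hi₀, Fin.lt_def]
    rw [this, Fin.card_Ioi, hi₀, Nat.cast_sub (by simp; omega), Nat.cast_sub (by omega)]
    push_cast; ring
  have hAl : 4 / 5 * (d : ℝ) ≤ A.card := by
    have h1 : (16 : ℝ) * k + 1 ≤ d := by exact_mod_cast hk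
    have h2 : (9 : ℝ) ≤ d := by exact_mod_cast hd
    rw [hcard]
    linarith
  have hAu : (A.card : ℝ) ≤ d := by
    have : (0 : ℝ) ≤ k := Nat.cast_nonneg k
    rw [hcard]; linarith
  set α : ℝ := 2.2 / √(s2 - 4.84) with hα
  have hs : 0 < s2 - 4.84 := by norm_num at hs8 ⊢; linarith
  have hα2 : α ^ 2 = 4.84 / (s2 - 4.84) := by
    rw [hα, div_pow, Real.sq_sqrt hs.le]; norm_num
  have hα0 : 0 ≤ α := by positivity
  have hwin := le_coordLaw_window A hi₀A hd0 hAl hAu hα0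
    (by
      rw [hα2, div_mul_eq_mul_div, le_div_iff₀ hs]
      norm_num at hs ⊢
      nlinarith)
    (by
      rw [hα2, div_mul_eq_mul_div, div_le_iff₀ hs]
      norm_num at hs ⊢
      nlinarith)
  have hT : Measurable fun x : Fin d → ℝ => ∑ i, x i • b i := by fun_prop
  rw [stdGaussian_eq_map_pi_orthonormalBasis b]
  refine hwin.trans ((measure_mono ?_).trans (Measure.le_map_apply hT.aemeasurable _))
  rintro x ⟨hQ0, hx1, hx2⟩
  set Q : ℝ := ∑ i ∈ A, x i ^ 2 with hQ
  set g : Vec d := ∑ i, x i • b i with hg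
  have hbg : ∀ i, inner ℝ (b i) g = x i := by
    intro i
    rw [hg, inner_sum]
    simp [real_inner_smul_right, orthonormal_iff_ite.1 b.orthonormal]
  have hres : ‖residual k V g‖ ^ 2 = x i₀ ^ 2 + Q := by
    rw [← b.sum_sq_norm_inner_right]
    have hcoord : ∀ i, ‖(inner ℝ (b i) (residual k V g) : ℝ)‖ ^ 2 =
        if (i : ℕ) < k then 0 else x i ^ 2 := by
      intro i
      rw [Real.norm_eq_abs, sq_abs]
      split_ifs with h
      · rw [hbV i h, inner_residual hV h]; norm_num
      · rw [residual, inner_sub_right, hbg, inner_sum, Finset.sum_eq_zero, sub_zero]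
        intro j hj
        have hj' := Finset.mem_range.1 hj
        have := hbV ⟨j, hj'.trans hkd⟩ hj'
        simp only at this
        rw [real_inner_smul_right, ← this, orthonormal_iff_ite.1 b.orthonormal, if_neg, mul_zero]
        intro h'
        exact h (by rw [h']; exact hj')
    rw [Finset.sum_congr rfl fun i _ => hcoord i]
    have hun : (Finset.univ : Finset (Fin d)) = (Finset.univ.filter fun i : Fin d => (i : ℕ) < k) ∪
        (insert i₀ A) := by
      ext i
      simp only [Finset.mem_univ, Finset.mem_union, Finset.mem_filter, true_and,
        Finset.mem_insert, hA, hi₀, Fin.ext_iff, true_iff]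
      omega
    have hdisj : Disjoint (Finset.univ.filter fun i : Fin d => (i : ℕ) < k) (insert i₀ A) := by
      rw [Finset.disjoint_left]
      intro i h1 h2
      simp only [Finset.mem_filter, Finset.mem_univ, true_and, Finset.mem_insert, hA, hi₀,
        Fin.ext_iff] at h1 h2
      omega
    rw [hun, Finset.sum_union hdisj, Finset.sum_insert hi₀A, Finset.sum_eq_zero, zero_add,
      if_neg (by simp [hi₀]), hQ]
    · congr 1
      refine Finset.sum_congr rfl fun i hi => if_neg ?_
      have := (Finset.mem_filter.1 hi).2
      omega
    · intro i hi
      exact if_pos (Finset.mem_filter.1 hi).2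
  have hinner : inner ℝ θ (residual k V g) = ‖w‖ * x i₀ := by
    rw [inner_residual_right_eq hV, ← hw, ← hbg i₀, hbu, hu, real_inner_smul_left,
      mul_inv_cancel_left₀ hw0]
  have hr : inner ℝ θ (residualDir k V g) * ‖residual k V g‖ = ‖w‖ * x i₀ := by
    have hNpos : ‖residual k V g‖ ≠ 0 := by
      intro h
      rw [h] at hres
      nlinarith [sq_nonneg (x i₀)]
    rw [residualDir, real_inner_smul_right, hinner]
    field_simp
  exact mem_window_of_ratio hd0 hs8 hwpos.le hQ0 (norm_nonneg _) hres hr hx1 hx2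

end Residual

end RidgeBandit

namespace RidgeBandit

/-! ### Potential functions for chains driven by independent seeds -/

section Chain

variable {S R : Type*}

/-- The state after `n` steps of a chain that is driven by the seeds `ω`. -/
def chain (step : S → R → S) (s₀ : S) (ω : ℕ → R) : ℕ → S
  | 0 => s₀
  | n + 1 => step (chain step s₀ ω n) (ω n)

theorem chain_congr (step : S → R → S) (s₀ : S) {ω ω' : ℕ → R} {n : ℕ}
    (h : ∀ i < n, ω i = ω' i) : chain step s₀ ω n = chain step s₀ ω' n := by
  induction n with
  | zero => rfl
  | succ n ih =>
    rw [chain, chain, ih fun i hi => h i (hi.trans n.lt_succ_self), h n n.lt_succ_self]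

theorem chain_induction {step : S → R → S} {s₀ : S} {p : S → Prop} (h0 : p s₀)
    (h : ∀ s r, p s → p (step s r)) (ω : ℕ → R) (n : ℕ) : p (chain step s₀ ω n) := by
  induction n with
  | zero => exact h0
  | succ n ih => exact h _ _ ih

variable [MeasurableSpace S] [MeasurableSpace R]

theorem measurable_chain {step : S → R → S} (hstep : Measurable (Function.uncurry step)) (s₀ : S)
    (n : ℕ) : Measurable fun ω : ℕ → R => chain step s₀ ω n := by
  induction n with
  | zero => exact measurable_const
  | succ n ih => exact hstep.comp (ih.prodMk (measurable_pi_apply n))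

/-- The state after `n` steps is a function of the seeds `0, …, n - 1`, while step `n` uses seed
`n`. -/
theorem indepFun_chain {step : S → R → S} (hstep : Measurable (Function.uncurry step)) (s₀ : S)
    (μ : Measure R) [IsProbabilityMeasure μ] (n : ℕ) :
    IndepFun (fun ω : ℕ → R => chain step s₀ ω n) (fun ω => ω n)
      (Measure.infinitePi fun _ => μ) := by
  classical
  have hR : Nonempty R := nonempty_of_isProbabilityMeasure μ
  obtain ⟨r₀⟩ := hR
  have hind : iIndepFun (fun (i : ℕ) (ω : ℕ → R) => ω i) (Measure.infinitePi fun _ => μ) :=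
    iIndepFun_infinitePi (X := fun (_ : ℕ) (x : R) => x) (fun _ => measurable_id)
  have h := hind.indepFun_finset (Finset.range n) {n} (by simp) (fun i => measurable_pi_apply i)
  -- The seeds from `n` on do not influence the state, so they may be replaced by a fixed value
  -- `r₀`.
  have m1 : Measurable fun t : Finset.range n → R =>
      chain step s₀ (fun i => if hi : i ∈ Finset.range n then t ⟨i, hi⟩ else r₀) n := by
    refine (measurable_chain hstep s₀ n).comp (measurable_pi_lambda _ fun i => ?_)
    by_cases hi : i ∈ Finset.range n
    · simp only [hi, dif_pos]; exact measurable_pi_apply _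
    · simp only [hi, dif_neg, not_false_iff]; exact measurable_const
  have m2 : Measurable fun t : ({n} : Finset ℕ) → R => t ⟨n, Finset.mem_singleton_self n⟩ :=
    measurable_pi_apply _
  have h2 := h.comp m1 m2
  have e : (fun ω : ℕ → R => chain step s₀ ω n) = (fun t : Finset.range n → R =>
      chain step s₀ (fun i => if hi : i ∈ Finset.range n then t ⟨i, hi⟩ else r₀) n) ∘
      fun ω (i : Finset.range n) => ω i := by
    funext ω
    refine chain_congr step s₀ fun i hi => ?_
    simp [hi]
  rw [e]
  exact h2

/-- If the mean of the potential grows by at most `η` in each step, it grows by at most `n η`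
in `n` steps. -/
theorem lintegral_chain_le {step : S → R → S} (hstep : Measurable (Function.uncurry step)) {s₀ : S}
    (μ : Measure R) [IsProbabilityMeasure μ] {Φ : S → ENNReal} (hΦ : Measurable Φ)
    {p : S → Prop} (h0 : p s₀) (hp : ∀ s r, p s → p (step s r)) {η : ENNReal}
    (hdrift : ∀ s, p s → ∫⁻ r, Φ (step s r) ∂μ ≤ Φ s + η) (n : ℕ) :
    ∫⁻ ω, Φ (chain step s₀ ω n) ∂(Measure.infinitePi fun _ : ℕ => μ) ≤ Φ s₀ + n * η := by
  induction n with
  | zero => simp [chain]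
  | succ n ih =>
    set P := Measure.infinitePi fun _ : ℕ => μ with hP
    have hX := measurable_chain hstep s₀ n
    have hn : Measurable fun ω : ℕ → R => ω n := measurable_pi_apply n
    have hlaw := (indepFun_chain hstep s₀ μ n).map_prod_eq_prod_map_map hX.aemeasurable
      hn.aemeasurable
    rw [Measure.infinitePi_map_eval (μ := fun _ : ℕ => μ) n] at hlaw
    have hΦs : Measurable fun y : S × R => Φ (step y.1 y.2) := hΦ.comp hstep
    calc ∫⁻ ω, Φ (chain step s₀ ω (n + 1)) ∂P
        = ∫⁻ y, Φ (step y.1 y.2) ∂(P.map fun ω => (chain step s₀ ω n, ω n)) := by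
          rw [lintegral_map hΦs (hX.prodMk hn)]; rfl
      _ = ∫⁻ s, ∫⁻ r, Φ (step s r) ∂μ ∂(P.map fun ω => chain step s₀ ω n) := by
          have : IsProbabilityMeasure (P.map fun ω => chain step s₀ ω n) :=
            Measure.isProbabilityMeasure_map hX.aemeasurable
          rw [hlaw, lintegral_prod _ hΦs.aemeasurable]
      _ = ∫⁻ ω, ∫⁻ r, Φ (step (chain step s₀ ω n) r) ∂μ ∂P := by
          rw [lintegral_map hΦs.lintegral_prod_right' hX]
      _ ≤ ∫⁻ ω, (Φ (chain step s₀ ω n) + η) ∂P :=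
          lintegral_mono fun ω => hdrift _ (chain_induction h0 hp ω n)
      _ = (∫⁻ ω, Φ (chain step s₀ ω n) ∂P) + η := by
          rw [lintegral_add_right _ measurable_const, lintegral_const, measure_univ, mul_one]
      _ ≤ Φ s₀ + n * η + η := by gcongr
      _ = Φ s₀ + (n + 1 : ℕ) * η := by push_cast; ring

end Chain

end RidgeBandit

namespace RidgeBandit

open Metric

/-! ### Increments -/

section Increments

variable {f : ℝ → ℝ} {d : ℕ}

theorem bddBelow_image_abs (g : ℝ → ℝ) (s : Set ℝ) : BddBelow ((fun z => |g z|) '' s) :=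
  ⟨0, by rintro _ ⟨z, _, rfl⟩; exact abs_nonneg _⟩

theorem two_mul_initGap_le (hd : 9 ≤ d) (hf : MonotoneOn f (Icc (-1) 1)) {z : ℝ}
    (hz : z ∈ Icc (2 / √(d : ℝ)) (2.8 / √(d : ℝ))) :
    2 * initGap f d ≤ f (z + 0.2 / √(d : ℝ)) - f z := by
  have h := csInf_le (bddBelow_image_abs (fun z => f (z + 0.2 / √(d : ℝ)) - f z) _)
    (mem_image_of_mem (fun z => |f (z + 0.2 / √(d : ℝ)) - f z|) hz)
  have hs : (3 : ℝ) ≤ √(d : ℝ) := by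
    apply Real.le_sqrt_of_sq_le
    have : (9 : ℝ) ≤ d := by exact_mod_cast hd
    linarith
  have hp : 0 < 0.2 / √(d : ℝ) := by positivity
  have hz0 : 0 ≤ z := le_trans (by positivity) hz.1
  have hz1 : z + 0.2 / √(d : ℝ) ≤ 1 := by
    calc z + 0.2 / √(d : ℝ) ≤ 2.8 / √(d : ℝ) + 0.2 / √(d : ℝ) := by linarith [hz.2]
      _ = 3 / √(d : ℝ) := by rw [← add_div]; norm_num
      _ ≤ 1 := (div_le_one (by linarith)).2 hs
  have hm := hf (a := z) (b := z + 0.2 / √(d : ℝ)) ⟨by linarith, by linarith⟩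
    ⟨by linarith, hz1⟩ (by linarith)
  rw [abs_of_nonneg (sub_nonneg.2 hm)] at h
  unfold initGap
  linarith

theorem step_pos (hd : 9 ≤ d) : 0 < 1 / √(2 * d : ℝ) := by
  have : (9 : ℝ) ≤ d := by exact_mod_cast hd
  positivity

theorem windowMin_le (hd : 9 ≤ d) (hf : MonotoneOn f (Icc (-1) 1)) {y z : ℝ}
    (hy : y ∈ Icc (20 / √(2 * d : ℝ)) (1 / 2)) (hz : z ∈ Icc (5 * y / 6) (5 * y / 3)) :
    windowMin f d y ≤ f (z + 0.2 / √(2 * d : ℝ)) - f z := by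
  have h := csInf_le (bddBelow_image_abs (fun z => f (z + 0.2 / √(2 * d : ℝ)) - f z) _)
    (mem_image_of_mem (fun z => |f (z + 0.2 / √(2 * d : ℝ)) - f z|) hz)
  change windowMin f d y ≤ _ at h
  have hp := step_pos hd
  have e1 : 0.2 / √(2 * d : ℝ) = 0.2 * (1 / √(2 * d : ℝ)) := by ring
  have e2 : 20 / √(2 * d : ℝ) = 20 * (1 / √(2 * d : ℝ)) := by ring
  obtain ⟨hy1, hy2⟩ := hy
  obtain ⟨hz1, hz2⟩ := hz
  simp only [e1] at h ⊢
  rw [e2] at hy1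
  set η := 1 / √(2 * d : ℝ)
  have hm := hf (a := z) (b := z + 0.2 * η) ⟨by linarith, by linarith⟩
    ⟨by linarith, by linarith⟩ (by linarith)
  rw [abs_of_nonneg (sub_nonneg.2 hm)] at h
  exact h

/-- Soundness of the test for initial directions. -/
theorem init_sound (hd : 9 ≤ d) (hf : MonotoneOn f (Icc (-1) 1)) {x x' : ℝ}
    (hx : x ∈ Icc (-1 : ℝ) 1) (hx' : x' ∈ Icc (2.2 / √(d : ℝ)) (2.8 / √(d : ℝ)))
    (h : |f x - f x'| < 2 * initGap f d) : x ∈ Icc (2 / √(d : ℝ)) (3 / √(d : ℝ)) := by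
  have hs : (3 : ℝ) ≤ √(d : ℝ) := by
    apply Real.le_sqrt_of_sq_le
    have : (9 : ℝ) ≤ d := by exact_mod_cast hd
    linarith
  have h3 : 3 / √(d : ℝ) ≤ 1 := (div_le_one (by linarith)).2 hs
  obtain ⟨hx1, hx2⟩ := hx'
  have hp : 0 < 1 / √(d : ℝ) := by positivity
  have e1 : 0.2 / √(d : ℝ) = 0.2 * (1 / √(d : ℝ)) := by ring
  have e2 : 2 / √(d : ℝ) = 2 * (1 / √(d : ℝ)) := by ring
  have e3 : 3 / √(d : ℝ) = 3 * (1 / √(d : ℝ)) := by ring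
  have e4 : 2.2 / √(d : ℝ) = 2.2 * (1 / √(d : ℝ)) := by ring
  have e5 : 2.8 / √(d : ℝ) = 2.8 * (1 / √(d : ℝ)) := by ring
  have hgap := fun z hz => two_mul_initGap_le (z := z) hd hf hz
  rw [e1, e2, e5] at hgap
  rw [e3] at h3
  rw [e4] at hx1
  rw [e5] at hx2
  rw [e2, e3]
  set η := 1 / √(d : ℝ)
  rw [abs_lt] at h
  refine ⟨?_, ?_⟩
  -- If `x` were outside the interval, a full step of length `0.2 * η` would fit between `x` and
  -- `x'`, and `f` would change by at least `2 * initGap f d` over it.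
  · by_contra hcon
    rw [not_le] at hcon
    have g1 := hgap (x' - 0.2 * η) ⟨by linarith, by linarith⟩
    have g2 := hf (a := x) (b := x' - 0.2 * η) hx ⟨by linarith, by linarith⟩ (by linarith)
    rw [sub_add_cancel] at g1
    linarith [h.1]
  · by_contra hcon
    rw [not_le] at hcon
    have g1 := hgap x' ⟨by linarith, by linarith⟩
    have g2 := hf (a := x' + 0.2 * η) (b := x) ⟨by linarith, by linarith⟩ hx (by linarith)
    linarith [h.2]

/-- Soundness of the test for subsequent directions. -/
theorem good_sound (hd : 9 ≤ d) (hf : MonotoneOn f (Icc (-1) 1)) {y t x t' x' : ℝ}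
    (hy : y ∈ Icc (20 / √(2 * d : ℝ)) (1 / 2))
    (hm : t - x ∈ Icc (-1 : ℝ) 1) (hp : t + x ∈ Icc (-1 : ℝ) 1)
    (ht' : t' ∈ Icc y (3 * y / 2))
    (hx' : x' ∈ Icc (2.2 / √(2 * d : ℝ)) (2.8 / √(2 * d : ℝ)))
    (h1 : |f (t - x) - f (t' - x')| < windowMin f d y)
    (h2 : |f (t + x) - f (t' + x')| < windowMin f d y) :
    x ∈ Icc (2 / √(2 * d : ℝ)) (3 / √(2 * d : ℝ)) := by
  -- As `y ≥ 20η`, shifts by at most `3η` change a point of `[y, 3y/2]` by at most `y/6`, so all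
  -- points used below stay in `[5y/6, 5y/3]`.
  have hwin := fun z hz => windowMin_le (z := z) hd hf hy hz
  have hη := step_pos hd
  have e1 : 0.2 / √(2 * d : ℝ) = 0.2 * (1 / √(2 * d : ℝ)) := by ring
  have e2 : 2 / √(2 * d : ℝ) = 2 * (1 / √(2 * d : ℝ)) := by ring
  have e3 : 3 / √(2 * d : ℝ) = 3 * (1 / √(2 * d : ℝ)) := by ring
  have e4 : 2.2 / √(2 * d : ℝ) = 2.2 * (1 / √(2 * d : ℝ)) := by ring
  have e5 : 2.8 / √(2 * d : ℝ) = 2.8 * (1 / √(2 * d : ℝ)) := by ring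
  have e6 : 20 / √(2 * d : ℝ) = 20 * (1 / √(2 * d : ℝ)) := by ring
  rw [e1] at hwin
  rw [e4, e5] at hx'
  rw [e6] at hy
  rw [e2, e3]
  set η := 1 / √(2 * d : ℝ)
  obtain ⟨hy1, hy2⟩ := hy
  obtain ⟨hx1, hx2⟩ := hx'
  obtain ⟨ht1, ht2⟩ := ht'
  rw [abs_lt] at h1 h2
  refine ⟨?_, ?_⟩
  · by_contra hcon
    rw [not_le] at hcon
    -- The differences `(t' + x') - (t + x)` and `(t - x) - (t' - x')` add up to `2 (x' - x) >
    -- 0.4η`, whatever `t` and `t'` are. So one of them is at least `0.2η`, and the corresponding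
    -- reward exposes the discrepancy. The case of too large `x` is symmetric.
    rcases le_total (t + x + 0.2 * η) (t' + x') with hc | hc
    · have g1 := hwin (t' + x' - 0.2 * η) ⟨by linarith, by linarith⟩
      have g2 := hf (a := t + x) (b := t' + x' - 0.2 * η) hp ⟨by linarith, by linarith⟩
        (by linarith)
      rw [sub_add_cancel] at g1
      linarith [h2.1]
    · have g1 := hwin (t' - x') ⟨by linarith, by linarith⟩
      have g2 := hf (a := t' - x' + 0.2 * η) (b := t - x) ⟨by linarith, by linarith⟩ hm
        (by linarith)
      linarith [h1.2]
  · by_contra hcon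
    rw [not_le] at hcon
    rcases le_total (t' + x' + 0.2 * η) (t + x) with hc | hc
    · have g1 := hwin (t' + x') ⟨by linarith, by linarith⟩
      have g2 := hf (a := t' + x' + 0.2 * η) (b := t + x) ⟨by linarith, by linarith⟩ hp
        (by linarith)
      linarith [h2.2]
    · have g1 := hwin (t' - x' - 0.2 * η) ⟨by linarith, by linarith⟩
      have g2 := hf (a := t - x) (b := t' - x' - 0.2 * η) hm ⟨by linarith, by linarith⟩
        (by linarith)
      rw [sub_add_cancel] at g1
      linarith [h1.1]

end Increments

/-! ### The tests as events of the noise -/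

/-- The function `f`, extended by constants outside `[-1, 1]`. -/
noncomputable def clip (f : ℝ → ℝ) (x : ℝ) : ℝ := f (max (-1) (min 1 x))

theorem clip_of_mem (f : ℝ → ℝ) {x : ℝ} (hx : x ∈ Icc (-1 : ℝ) 1) : clip f x = f x := by
  rw [clip, min_eq_right hx.2, max_eq_right hx.1]

theorem measurable_clip {f : ℝ → ℝ} (hf : MonotoneOn f (Icc (-1) 1)) : Measurable (clip f) := by
  have : Monotone (clip f) := fun x y hxy =>
    hf ⟨le_max_left _ _, max_le (by norm_num) (min_le_left _ _)⟩
      ⟨le_max_left _ _, max_le (by norm_num) (min_le_left _ _)⟩ (by gcongr)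
  exact this.measurable

theorem avgReward_oracle {d : ℕ} (f : ℝ → ℝ) (θ a : Vec d) (z : ℕ → ℝ) (k : ℕ) {N : ℕ}
    (hN : 0 < N) : avgReward (oracle f θ) a z k N = f (inner ℝ θ a) + avgNoise k N z := by
  have : (N : ℝ) ≠ 0 := by exact_mod_cast hN.ne'
  simp only [avgReward, oracle, avgNoise, Finset.sum_add_distrib, Finset.sum_const,
    Finset.card_range, nsmul_eq_mul]
  field_simp

theorem ceil_queries {a η g : ℝ} (hη : 0 < η) (hηa : η < a) (hg : 0 < g) :
    0 < ⌈2 * Real.log (a / η) / g ^ 2⌉₊ ∧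
      2 * Real.log (1 / (η / a)) ≤ ⌈2 * Real.log (a / η) / g ^ 2⌉₊ * g ^ 2 := by
  have hlog : 0 < Real.log (a / η) := Real.log_pos (by rwa [one_lt_div hη])
  refine ⟨Nat.ceil_pos.2 (by positivity), ?_⟩
  rw [one_div_div, ← div_le_iff₀ (by positivity)]
  exact Nat.le_ceil _

/-- The test of epoch `k + 1` accepts the direction `v`, where `s` is the sum of the directions
that have been accepted before. -/
def Accepts {d : ℕ} (f : ℝ → ℝ) (O : Vec d → ℝ → ℝ) (η : ℝ) (center : ℕ → ℝ) (k : ℕ)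
    (s v : Vec d) (z : ℕ → ℝ) : Prop :=
  if k + 1 ≤ 100 then InitialActionHypTest f O η v z
  else GoodActionHypTest f O η ((1 / √(((k + 1 : ℕ) : ℝ) - 1)) • s) (xPre d (k + 1))
    (center (k + 1)) v z

section Tests

variable {f : ℝ → ℝ} {d : ℕ} {θ : Vec d} {η : ℝ}

/-- The test for initial directions coincides with a measurable test outside an event of
probability at most `η`. -/
theorem exists_init_events (hd : 9 ≤ d) (hf : MonotoneOn f (Icc (-1) 1)) (hθ : ‖θ‖ = 1)
    (hη : 0 < η) (hη1 : η < 1) (hgap : 0 < initGap f d) :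
    ∃ B F : Set (ℝ × (ℕ → ℝ)), MeasurableSet B ∧ MeasurableSet F ∧
      (∀ x, noiseLaw {z | (x, z) ∈ F} ≤ ENNReal.ofReal η) ∧
      ∀ (v : Vec d) (z : ℕ → ℝ), ‖v‖ = 1 → ((inner ℝ θ v : ℝ), z) ∉ F →
        (InitialActionHypTest f (oracle f θ) η v z ↔ ((inner ℝ θ v : ℝ), z) ∈ B) ∧
        ((inner ℝ θ v : ℝ) ∈ Icc (2.2 / √(d : ℝ)) (2.8 / √(d : ℝ)) →
          ((inner ℝ θ v : ℝ), z) ∈ B) ∧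
        (((inner ℝ θ v : ℝ), z) ∈ B →
          (inner ℝ θ v : ℝ) ∈ Icc (2 / √(d : ℝ)) (3 / √(d : ℝ))) := by
  set N := initQueries f d η with hN
  obtain ⟨hNpos, hNlog⟩ : 0 < N ∧ 2 * Real.log (1 / (η / 2)) ≤ N * initGap f d ^ 2 :=
    ceil_queries hη (by linarith) hgap
  set g := initGap f d with hg
  set E : Set ℝ := f '' Icc (2.2 / √(d : ℝ)) (2.8 / √(d : ℝ)) with hE
  -- Closed balls describe the actual test and open balls the modeled one. The outcomes where they
  -- may disagree are covered by a measurable null set, which becomes part of `F`.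
  set D : Set ℝ := toMeasurable volume ((⋃ a ∈ E, closedBall a g) \ thickening g E) with hD
  have hD0 : volume D = 0 := by
    rw [hD, measure_toMeasurable]
    exact measure_biUnion_closedBall_diff_thickening volume E hgap
  have hr : Measurable fun p : ℝ × (ℕ → ℝ) => clip f p.1 + avgNoise 0 N p.2 :=
    ((measurable_clip hf).comp measurable_fst).add
      ((measurable_avgNoise 0 N).comp measurable_snd)
  refine ⟨{p | clip f p.1 + avgNoise 0 N p.2 ∈ thickening g E},
    {p | g ≤ |avgNoise 0 N p.2|} ∪ {p | clip f p.1 + avgNoise 0 N p.2 ∈ D},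
    hr isOpen_thickening.measurableSet,
    (measurableSet_le measurable_const
      (((measurable_avgNoise 0 N).comp measurable_snd).abs)).union
      (hr (measurableSet_toMeasurable _ _)), ?_, ?_⟩
  · intro x
    refine (measure_union_le {z | g ≤ |avgNoise 0 N z|}
      {z | clip f x + avgNoise 0 N z ∈ D}).trans ?_
    rw [noise_null 0 hNpos hD0, add_zero]
    -- Two tails of probability `η / 2` each; hence the `log (2 / δ)` in the query count.
    refine (noise_tail 0 hgap (half_pos hη) hNpos hNlog).trans (le_of_eq ?_)
    congr 1; ring
  · intro v z hv hF
    have hx : (inner ℝ θ v : ℝ) ∈ Icc (-1 : ℝ) 1 := by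
      have := abs_real_inner_le_norm θ v
      rw [hθ, hv, one_mul] at this
      exact abs_le.1 this
    have hF1 : |avgNoise 0 N z| < g := by
      by_contra h; exact hF (Or.inl (not_lt.1 h))
    have hF2 : clip f (inner ℝ θ v) + avgNoise 0 N z ∉ D := fun h => hF (Or.inr h)
    rw [clip_of_mem f hx] at hF2
    simp only [mem_ofPred_eq, clip_of_mem f hx]
    set x : ℝ := inner ℝ θ v
    refine ⟨?_, ?_, ?_⟩
    · have h1 : InitialActionHypTest f (oracle f θ) η v z ↔
          f x + avgNoise 0 N z ∈ ⋃ a ∈ E, closedBall a g := by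
        simp only [InitialActionHypTest, hE, biUnion_image, mem_iUnion, exists_prop,
          mem_closedBall, Real.dist_eq]
        rw [← hN, avgReward_oracle f θ v z 0 hNpos]
      rw [h1]
      constructor
      · intro h
        by_contra hcon
        exact hF2 (subset_toMeasurable _ _ ⟨h, hcon⟩)
      · intro h
        obtain ⟨e, he, hlt⟩ := mem_thickening_iff.1 h
        exact mem_biUnion he (mem_closedBall.2 hlt.le)
    · intro h
      refine mem_thickening_iff.2 ⟨f x, mem_image_of_mem f h, ?_⟩
      rwa [Real.dist_eq, add_sub_cancel_left]
    · intro h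
      obtain ⟨_, ⟨x', hx', rfl⟩, hlt⟩ := mem_thickening_iff.1 h
      refine init_sound hd hf hx hx' ?_
      rw [Real.dist_eq] at hlt
      rw [abs_lt] at hlt hF1 ⊢
      constructor <;> linarith [hlt.1, hlt.2, hF1.1, hF1.2]

/-- The inner products with `θ` of the two actions of the test for subsequent directions. -/
theorem good_geometry (hd : 9 ≤ d) (hθ : ‖θ‖ = 1) {k : ℕ} (hk : 0 < k) {y : ℝ} (hy0 : 0 < y)
    (hyx : y ≤ xPre d (k + 1) / √2) {s v : Vec d} (hv : ‖v‖ = 1) (hs : ‖s‖ = √(k : ℝ))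
    (hsv : inner ℝ s v = (0 : ℝ))
    (hθs : (inner ℝ θ s : ℝ) ∈ Icc (k * (2 / √(d : ℝ))) (k * (3 / √(d : ℝ)))) :
    (inner ℝ θ ((1 / √2 : ℝ) • ((√2 * y / xPre d (k + 1)) •
        ((1 / √(((k + 1 : ℕ) : ℝ) - 1)) • s) - v)) : ℝ) =
      y / xPre d (k + 1) * (1 / √(k : ℝ) * inner ℝ θ s) - inner ℝ θ v / √2 ∧
    (inner ℝ θ ((1 / √2 : ℝ) • ((√2 * y / xPre d (k + 1)) •
        ((1 / √(((k + 1 : ℕ) : ℝ) - 1)) • s) + v)) : ℝ) =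
      y / xPre d (k + 1) * (1 / √(k : ℝ) * inner ℝ θ s) + inner ℝ θ v / √2 ∧
    y / xPre d (k + 1) * (1 / √(k : ℝ) * inner ℝ θ s) - inner ℝ θ v / √2 ∈ Icc (-1 : ℝ) 1 ∧
    y / xPre d (k + 1) * (1 / √(k : ℝ) * inner ℝ θ s) + inner ℝ θ v / √2 ∈ Icc (-1 : ℝ) 1 ∧
    y / xPre d (k + 1) * (1 / √(k : ℝ) * inner ℝ θ s) ∈ Icc y (3 * y / 2) := by
  have hkr : (0 : ℝ) < k := by exact_mod_cast hk
  have hdr : (0 : ℝ) < d := by exact_mod_cast (by omega : 0 < d)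
  have hkk : ((k + 1 : ℕ) : ℝ) - 1 = k := by push_cast; ring
  have hxp : xPre d (k + 1) = 2 * (√(k : ℝ) / √(d : ℝ)) := by
    rw [xPre, hkk, Real.sqrt_div hkr.le]
  have hxpos : 0 < xPre d (k + 1) := by rw [hxp]; positivity
  set σ : ℝ := inner ℝ θ s with hσ
  set x : ℝ := inner ℝ θ v with hx
  set τ : ℝ → ℝ := fun σ => y / xPre d (k + 1) * (1 / √(k : ℝ) * σ) with hτ
  set lam : ℝ := √2 * y / xPre d (k + 1) with hlam
  set vpre : Vec d := (1 / √(((k + 1 : ℕ) : ℝ) - 1)) • s with hvpre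
  have h2 : (0 : ℝ) < √2 := by positivity
  have h22 : √2 * √2 = (2 : ℝ) := Real.mul_self_sqrt (by norm_num)
  have hsk : (0 : ℝ) < √(k : ℝ) := Real.sqrt_pos.2 hkr
  have hsd : (0 : ℝ) < √(d : ℝ) := Real.sqrt_pos.2 hdr
  have hnpre : ‖vpre‖ = 1 := by
    rw [hvpre, hkk, norm_smul, hs, Real.norm_eq_abs, abs_of_pos (by positivity)]
    field_simp
  have hvv : inner ℝ vpre v = (0 : ℝ) := by
    rw [hvpre, real_inner_smul_left, hsv, mul_zero]
  have hlam0 : 0 ≤ lam := by positivity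
  -- The constraint `y ≤ xpre / √2` says exactly that `lam ≤ 1`; since `vpre` and `v` are orthogonal
  -- unit vectors, both queried actions then lie in the unit ball.
  have hlam1 : lam ≤ 1 := by
    rw [hlam, div_le_one hxpos]
    rwa [le_div_iff₀ h2, mul_comm] at hyx
  have hipre : (inner ℝ θ vpre : ℝ) = 1 / √(k : ℝ) * σ := by
    rw [hvpre, hkk, real_inner_smul_right]
  have hlt : (1 / √2 : ℝ) * (lam * (1 / √(k : ℝ) * σ)) = τ σ := by
    rw [hlam, hτ]; field_simp
  have him : (inner ℝ θ ((1 / √2 : ℝ) • (lam • vpre - v)) : ℝ) = τ σ - x / √2 := by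
    rw [real_inner_smul_right, inner_sub_right, real_inner_smul_right, hipre, mul_sub, hlt]
    ring
  have hip : (inner ℝ θ ((1 / √2 : ℝ) • (lam • vpre + v)) : ℝ) = τ σ + x / √2 := by
    rw [real_inner_smul_right, inner_add_right, real_inner_smul_right, hipre, mul_add, hlt]
    ring
  have hle2 : ∀ w : Vec d, ‖w‖ ^ 2 = lam ^ 2 + 1 → ‖(1 / √2 : ℝ) • w‖ ≤ 1 := by
    intro w hw
    rw [norm_smul, Real.norm_eq_abs, abs_of_pos (by positivity), one_div, inv_mul_le_one₀ h2]
    refine Real.le_sqrt_of_sq_le ?_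
    rw [hw]
    nlinarith
  have hmem : ∀ a : Vec d, ‖a‖ ≤ 1 → (inner ℝ θ a : ℝ) ∈ Icc (-1 : ℝ) 1 := by
    intro a ha
    have := abs_real_inner_le_norm θ a
    rw [hθ, one_mul] at this
    exact abs_le.1 (this.trans ha)
  have hmm : τ σ - x / √2 ∈ Icc (-1 : ℝ) 1 := by
    rw [← him]
    refine hmem _ (hle2 _ ?_)
    rw [norm_sub_sq_real, norm_smul, real_inner_smul_left, hvv, hv, hnpre, Real.norm_eq_abs,
      mul_one, sq_abs]
    ring
  have hpm : τ σ + x / √2 ∈ Icc (-1 : ℝ) 1 := by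
    rw [← hip]
    refine hmem _ (hle2 _ ?_)
    rw [norm_add_sq_real, norm_smul, real_inner_smul_left, hvv, hv, hnpre, Real.norm_eq_abs,
      mul_one, sq_abs]
    ring
  -- `xPre` is the least value that `⟨θ, vpre⟩` can have, and the greatest is `3/2` times as large.
  have hτm : τ σ ∈ Icc y (3 * y / 2) := by
    have e : τ σ = y * (√(d : ℝ) / (2 * k) * σ) := by
      rw [hτ, hxp]
      have : √(k : ℝ) * √(k : ℝ) = k := Real.mul_self_sqrt hkr.le
      field_simp
      rw [sq, this, mul_comm]
    have l1 : 1 ≤ √(d : ℝ) / (2 * k) * σ := by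
      calc (1 : ℝ) = √(d : ℝ) / (2 * k) * (k * (2 / √(d : ℝ))) := by field_simp
        _ ≤ _ := by gcongr; exact hθs.1
    have l2 : √(d : ℝ) / (2 * k) * σ ≤ 3 / 2 := by
      calc √(d : ℝ) / (2 * k) * σ ≤ √(d : ℝ) / (2 * k) * (k * (3 / √(d : ℝ))) := by
            gcongr; exact hθs.2
        _ = 3 / 2 := by field_simp
    rw [e]
    constructor <;> nlinarith
  exact ⟨him, hip, hmm, hpm, hτm⟩

/-- The test for subsequent directions coincides with a measurable test outside an event of
probability at most `η`. -/
theorem exists_good_events (hd : 9 ≤ d) (hf : MonotoneOn f (Icc (-1) 1)) (hθ : ‖θ‖ = 1)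
    (hη : 0 < η) (hη1 : η < 1) {k : ℕ} (hk : 0 < k) {y : ℝ}
    (hy : y ∈ Icc (20 / √(2 * d : ℝ)) (1 / 2)) (hyx : y ≤ xPre d (k + 1) / √2)
    (hgap : 0 < windowMin f d y) :
    ∃ B F : Set (ℝ × ℝ × (ℕ → ℝ)), MeasurableSet B ∧ MeasurableSet F ∧
      (∀ σ x, noiseLaw {z | (σ, x, z) ∈ F} ≤ ENNReal.ofReal η) ∧
      ∀ (s v : Vec d) (z : ℕ → ℝ), ‖v‖ = 1 → ‖s‖ = √(k : ℝ) → inner ℝ s v = (0 : ℝ) →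
        (inner ℝ θ s : ℝ) ∈ Icc (k * (2 / √(d : ℝ))) (k * (3 / √(d : ℝ))) →
        ((inner ℝ θ s : ℝ), (inner ℝ θ v : ℝ), z) ∉ F →
        (GoodActionHypTest f (oracle f θ) η ((1 / √(((k + 1 : ℕ) : ℝ) - 1)) • s)
          (xPre d (k + 1)) y v z ↔ ((inner ℝ θ s : ℝ), (inner ℝ θ v : ℝ), z) ∈ B) ∧
        ((inner ℝ θ v : ℝ) ∈ Icc (2.2 / √(d : ℝ)) (2.8 / √(d : ℝ)) →
          ((inner ℝ θ s : ℝ), (inner ℝ θ v : ℝ), z) ∈ B) ∧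
        (((inner ℝ θ s : ℝ), (inner ℝ θ v : ℝ), z) ∈ B →
          (inner ℝ θ v : ℝ) ∈ Icc (2 / √(d : ℝ)) (3 / √(d : ℝ))) := by
  set g := goodGap f d y with hg
  have hg2 : windowMin f d y = 2 * g := by rw [hg, goodGap]; ring
  have hgpos : 0 < g := by rw [hg, goodGap]; positivity
  set N := goodQueries f d η y with hN
  obtain ⟨hNpos, hNlog⟩ : 0 < N ∧ 2 * Real.log (1 / (η / 4)) ≤ N * goodGap f d y ^ 2 :=
    ceil_queries hη (by linarith) hgpos
  set E : Set (ℝ × ℝ) := (fun p : ℝ × ℝ => (f (p.1 - p.2), f (p.1 + p.2))) ''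
    (Icc y (3 * y / 2) ×ˢ Icc (2.2 / √(2 * d : ℝ)) (2.8 / √(2 * d : ℝ))) with hE
  set D : Set (ℝ × ℝ) := toMeasurable volume ((⋃ a ∈ E, closedBall a g) \ thickening g E) with hD
  have hD0 : volume D = 0 := by
    rw [hD, measure_toMeasurable]
    exact measure_biUnion_closedBall_diff_thickening volume E hgpos
  have hkr : (0 : ℝ) < k := by exact_mod_cast hk
  have hdr : (0 : ℝ) < d := by exact_mod_cast (by omega : 0 < d)
  have hkk : ((k + 1 : ℕ) : ℝ) - 1 = k := by push_cast; ring
  have hxp : xPre d (k + 1) = 2 * (√(k : ℝ) / √(d : ℝ)) := by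
    rw [xPre, hkk, Real.sqrt_div hkr.le]
  have hxpos : 0 < xPre d (k + 1) := by rw [hxp]; positivity
  have hy0 : 0 < y := lt_of_lt_of_le (by positivity) hy.1
  set τ : ℝ → ℝ := fun σ => y / xPre d (k + 1) * (1 / √(k : ℝ) * σ) with hτ
  set rm : ℝ × ℝ × (ℕ → ℝ) → ℝ := fun p => clip f (τ p.1 - p.2.1 / √2) with hrm
  set rp : ℝ × ℝ × (ℕ → ℝ) → ℝ := fun p => clip f (τ p.1 + p.2.1 / √2) with hrp
  have hrmm : Measurable rm := (measurable_clip hf).comp (by fun_prop)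
  have hrpm : Measurable rp := (measurable_clip hf).comp (by fun_prop)
  have hν0 : Measurable fun p : ℝ × ℝ × (ℕ → ℝ) => avgNoise 0 N p.2.2 :=
    (measurable_avgNoise 0 N).comp (measurable_snd.comp measurable_snd)
  have hνN : Measurable fun p : ℝ × ℝ × (ℕ → ℝ) => avgNoise N N p.2.2 :=
    (measurable_avgNoise N N).comp (measurable_snd.comp measurable_snd)
  have hr : Measurable fun p : ℝ × ℝ × (ℕ → ℝ) =>
      (rm p + avgNoise 0 N p.2.2, rp p + avgNoise N N p.2.2) :=
    (hrmm.add hν0).prodMk (hrpm.add hνN)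
  refine ⟨{p | (rm p + avgNoise 0 N p.2.2, rp p + avgNoise N N p.2.2) ∈ thickening g E},
    ({p | g ≤ |avgNoise 0 N p.2.2|} ∪ {p | g ≤ |avgNoise N N p.2.2|}) ∪
      {p | (rm p + avgNoise 0 N p.2.2, rp p + avgNoise N N p.2.2) ∈ D},
    hr isOpen_thickening.measurableSet,
    ((measurableSet_le measurable_const hν0.abs).union
      (measurableSet_le measurable_const hνN.abs)).union
      (hr (measurableSet_toMeasurable _ _)), ?_, ?_⟩
  · intro σ x
    refine (measure_union_le ({z | g ≤ |avgNoise 0 N z|} ∪ {z | g ≤ |avgNoise N N z|})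
      {z | (clip f (τ σ - x / √2) + avgNoise 0 N z, clip f (τ σ + x / √2) + avgNoise N N z) ∈
        D}).trans ?_
    rw [noise_pair_null hNpos hD0, add_zero]
    -- Two averages with two tails each, at `η / 4` per tail; hence the `log (4 / δ)` in the query
    -- count.
    refine (measure_union_le _ _).trans ((add_le_add
      (noise_tail 0 hgpos (by linarith : 0 < η / 4) hNpos hNlog)
      (noise_tail N hgpos (by linarith : 0 < η / 4) hNpos hNlog)).trans (le_of_eq ?_))
    rw [← ENNReal.ofReal_add (by linarith) (by linarith)]
    congr 1; ring
  · intro s v z hv hs hsv hθs hF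
    set σ : ℝ := inner ℝ θ s with hσ
    set x : ℝ := inner ℝ θ v with hx
    have hτσ : τ σ = y / xPre d (k + 1) * (1 / √(k : ℝ) * σ) := rfl
    obtain ⟨him, hip, hmm, hpm, hτm⟩ := good_geometry hd hθ hk hy0 hyx hv hs hsv hθs
    rw [← hσ, ← hx, ← hτσ] at him hip hmm hpm
    rw [← hσ, ← hτσ] at hτm
    have h2 : (0 : ℝ) < √2 := by positivity
    have hs2d : √(2 * d : ℝ) = √2 * √(d : ℝ) := Real.sqrt_mul (by norm_num) _
    have hdiv : ∀ a : ℝ, a / √(2 * d : ℝ) = a / √(d : ℝ) / √2 := by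
      intro a; rw [hs2d]; field_simp
    have hF1 : |avgNoise 0 N z| < g := by
      by_contra h; exact hF (Or.inl (Or.inl (not_lt.1 h)))
    have hF2 : |avgNoise N N z| < g := by
      by_contra h; exact hF (Or.inl (Or.inr (not_lt.1 h)))
    have hF3 : (rm (σ, x, z) + avgNoise 0 N z, rp (σ, x, z) + avgNoise N N z) ∉ D :=
      fun h => hF (Or.inr h)
    have hrme : rm (σ, x, z) = f (τ σ - x / √2) := clip_of_mem f hmm
    have hrpe : rp (σ, x, z) = f (τ σ + x / √2) := clip_of_mem f hpm
    rw [hrme, hrpe] at hF3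
    simp only [mem_ofPred_eq, hrme, hrpe]
    refine ⟨?_, ?_, ?_⟩
    · have h1 : GoodActionHypTest f (oracle f θ) η ((1 / √(((k + 1 : ℕ) : ℝ) - 1)) • s) (xPre d (k + 1)) y v z ↔
          (f (τ σ - x / √2) + avgNoise 0 N z, f (τ σ + x / √2) + avgNoise N N z) ∈
            ⋃ a ∈ E, closedBall a g := by
        simp only [GoodActionHypTest, hE, biUnion_image, mem_iUnion, exists_prop,
          mem_closedBall, Prod.dist_eq, max_le_iff, Real.dist_eq, mem_prod, Prod.exists]
        rw [← hN, avgReward_oracle f θ _ z 0 hNpos, avgReward_oracle f θ _ z N hNpos,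
          him, hip]
        constructor
        · rintro ⟨t, ht, x', hx', h1, h2⟩; exact ⟨t, x', ⟨ht, hx'⟩, h1, h2⟩
        · rintro ⟨t, x', ⟨ht, hx'⟩, h1, h2⟩; exact ⟨t, ht, x', hx', h1, h2⟩
      rw [h1]
      constructor
      · intro h
        by_contra hcon
        exact hF3 (subset_toMeasurable _ _ ⟨h, hcon⟩)
      · intro h
        obtain ⟨e, he, hlt⟩ := mem_thickening_iff.1 h
        exact mem_biUnion he (mem_closedBall.2 hlt.le)
    · intro h
      refine mem_thickening_iff.2 ⟨_, mem_image_of_mem _ (mk_mem_prod hτm ?_ :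
        (τ σ, x / √2) ∈ _), ?_⟩
      · rw [hdiv, hdiv]
        exact ⟨by gcongr; exact h.1, by gcongr; exact h.2⟩
      · simp only [Prod.dist_eq, Real.dist_eq, add_sub_cancel_left]
        exact max_lt hF1 hF2
    · intro h
      obtain ⟨_, ⟨⟨t', x'⟩, ⟨ht', hx'⟩, rfl⟩, hlt⟩ := mem_thickening_iff.1 h
      simp only [Prod.dist_eq, Real.dist_eq, max_lt_iff] at hlt
      obtain ⟨hlt1, hlt2⟩ := hlt
      have := good_sound hd hf hy hmm hpm ht' hx'
        (by
          rw [hg2]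
          rw [abs_lt] at hlt1 hF1 ⊢
          constructor <;> linarith [hlt1.1, hlt1.2, hF1.1, hF1.2])
        (by
          rw [hg2]
          rw [abs_lt] at hlt2 hF2 ⊢
          constructor <;> linarith [hlt2.1, hlt2.2, hF2.1, hF2.2])
      rw [hdiv, hdiv] at this
      exact ⟨(div_le_div_iff_of_pos_right h2).1 this.1, (div_le_div_iff_of_pos_right h2).1 this.2⟩

end Tests

end RidgeBandit

namespace RidgeBandit

/-! ### A measurable model of the search -/

/-- The event `B` models acceptance by the test of epoch `k + 1`, outside the event `F`. An outcome
`(σ, x, z)` consists of the inner product of `θ` with the sum of the previous directions, its inner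
product with the tested direction, and the noise. -/
structure TestEvents {d : ℕ} (f : ℝ → ℝ) (θ : Vec d) (η : ℝ) (center : ℕ → ℝ) (k : ℕ)
    (B F : Set (ℝ × ℝ × (ℕ → ℝ))) : Prop where
  measurable_accept : MeasurableSet B
  measurable_fail : MeasurableSet F
  fail_le : ∀ σ x, noiseLaw {z | (σ, x, z) ∈ F} ≤ ENNReal.ofReal η
  spec : ∀ (s v : Vec d) (z : ℕ → ℝ), ‖v‖ = 1 → ‖s‖ = √(k : ℝ) → inner ℝ s v = (0 : ℝ) →
    (inner ℝ θ s : ℝ) ∈ Icc (k * (2 / √(d : ℝ))) (k * (3 / √(d : ℝ))) →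
    ((inner ℝ θ s : ℝ), (inner ℝ θ v : ℝ), z) ∉ F →
    (Accepts f (oracle f θ) η center k s v z ↔
      ((inner ℝ θ s : ℝ), (inner ℝ θ v : ℝ), z) ∈ B) ∧
    ((inner ℝ θ v : ℝ) ∈ Icc (2.2 / √(d : ℝ)) (2.8 / √(d : ℝ)) →
      ((inner ℝ θ s : ℝ), (inner ℝ θ v : ℝ), z) ∈ B) ∧
    (((inner ℝ θ s : ℝ), (inner ℝ θ v : ℝ), z) ∈ B →
      (inner ℝ θ v : ℝ) ∈ Icc (2 / √(d : ℝ)) (3 / √(d : ℝ)))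

theorem exists_testEvents {f : ℝ → ℝ} {d : ℕ} {θ : Vec d} {η : ℝ} {center : ℕ → ℝ} {k : ℕ}
    (hd : 9 ≤ d) (hf : MonotoneOn f (Icc (-1) 1)) (hθ : ‖θ‖ = 1) (hη : 0 < η) (hη1 : η < 1)
    (hinit : k + 1 ≤ 100 → 0 < initGap f d)
    (hgood : 100 < k + 1 → center (k + 1) ∈ Icc (20 / √(2 * d : ℝ)) (1 / 2) ∧
      center (k + 1) ≤ xPre d (k + 1) / √2 ∧ 0 < windowMin f d (center (k + 1))) :
    ∃ B F, TestEvents f θ η center k B F := by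
  rcases le_or_gt (k + 1) 100 with hk | hk
  · obtain ⟨B, F, hB, hF, hFle, h⟩ := exists_init_events hd hf hθ hη hη1 (hinit hk)
    refine ⟨{p | p.2 ∈ B}, {p | p.2 ∈ F}, measurable_snd hB, measurable_snd hF,
      fun _ x => hFle x, ?_⟩
    intro s v z hv _ _ _ hnF
    simp only [Accepts, if_pos hk]
    exact h v z hv hnF
  · obtain ⟨hy, hyx, hgap⟩ := hgood hk
    obtain ⟨B, F, hB, hF, hFle, h⟩ :=
      exists_good_events hd hf hθ hη hη1 (by omega : 0 < k) hy hyx hgap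
    refine ⟨B, F, hB, hF, hFle, ?_⟩
    simp only [Accepts, if_neg (not_le.2 hk)]
    exact h

/-- The outcome of testing the direction determined by the randomness `r`. -/
noncomputable def outcome {d : ℕ} (θ : Vec d) (k : ℕ) (V : ℕ → Vec d) (r : Seed d) : ℝ × ℝ × (ℕ → ℝ) :=
  (inner ℝ θ (∑ j ∈ Finset.range k, V j), inner ℝ θ (residualDir k V r.1), r.2)

/-- The state of the modeled search: the number of accepted directions, the number of passes in the
current epoch, and the accepted directions. The search has failed if the second entry has reached
the bound on the number of passes per epoch before all directions have been found. -/
abbrev SearchState (d : ℕ) := ℕ × ℕ × (ℕ → Vec d)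

open Classical in
/-- One pass of the modeled search for `m` directions, with at most `K` passes per epoch. -/
noncomputable def searchStep {d : ℕ} (θ : Vec d) (m K : ℕ) (B F : ℕ → Set (ℝ × ℝ × (ℕ → ℝ)))
    (s : SearchState d) (r : Seed d) : SearchState d :=
  if m ≤ s.1 ∨ K ≤ s.2.1 then s
  else
    if residual s.1 s.2.2 r.1 = 0 ∨ outcome θ s.1 s.2.2 r ∈ F s.1 then (s.1, K, s.2.2)
    else if outcome θ s.1 s.2.2 r ∈ B s.1 then
      (s.1 + 1, 0, Function.update s.2.2 s.1 (residualDir s.1 s.2.2 r.1))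
    else (s.1, s.2.1 + 1, s.2.2)

/-- The directions found so far are orthonormal, and their inner products with `θ` are of the
expected size. -/
def SearchState.Valid {d : ℕ} (θ : Vec d) (m : ℕ) (s : SearchState d) : Prop :=
  s.1 ≤ m ∧ OrthonormalUpTo s.1 s.2.2 ∧
    ∀ j < s.1, (inner ℝ θ (s.2.2 j) : ℝ) ∈ Icc (2 / √(d : ℝ)) (3 / √(d : ℝ))

/-- A bound for the probability that the modeled search fails, starting from the state `s`. -/
noncomputable def searchPotential {d : ℕ} (m K : ℕ) (ρ : ENNReal) (s : SearchState d) : ENNReal :=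
  if m ≤ s.1 then 0 else if K ≤ s.2.1 then 1 else (m - 1 - s.1 : ℕ) * ρ ^ K + ρ ^ (K - s.2.1)

section Search

variable {d : ℕ} {θ : Vec d} {m K : ℕ} {B F : ℕ → Set (ℝ × ℝ × (ℕ → ℝ))}

/-! ### Measurability of one pass of the modeled search -/

section Measurability

variable {Ω : Type*} [MeasurableSpace Ω]

theorem measurable_residual (k : ℕ) {X : Ω → ℕ → Vec d} {g : Ω → Vec d} (hX : Measurable X)
    (hg : Measurable g) : Measurable fun ω => residual k (X ω) (g ω) := by
  have h : ∀ j, Measurable fun ω => X ω j := fun j => (measurable_pi_apply j).comp hX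
  have h1 : ∀ j, Measurable fun ω => (inner ℝ (X ω j) (g ω) : ℝ) := fun j => (h j).inner hg
  have h2 : ∀ j, Measurable fun ω => (inner ℝ (X ω j) (g ω) : ℝ) • X ω j := fun j =>
    (h1 j).smul (h j)
  exact hg.sub (Finset.measurable_sum _ fun j _ => h2 j)

theorem measurable_residualDir (k : ℕ) {X : Ω → ℕ → Vec d} {g : Ω → Vec d} (hX : Measurable X)
    (hg : Measurable g) : Measurable fun ω => residualDir k (X ω) (g ω) :=
  (measurable_residual k hX hg).norm.inv.smul (measurable_residual k hX hg)

theorem measurable_inner_const (θ : Vec d) {X : Ω → Vec d} (hX : Measurable X) :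
    Measurable fun ω => (inner ℝ θ (X ω) : ℝ) :=
  (innerSL ℝ θ).continuous.measurable.comp hX

theorem measurable_outcome (θ : Vec d) (k : ℕ) {X : Ω → ℕ → Vec d} {r : Ω → Seed d}
    (hX : Measurable X) (hr : Measurable r) : Measurable fun ω => outcome θ k (X ω) (r ω) := by
  have h : ∀ j, Measurable fun ω => X ω j := fun j => (measurable_pi_apply j).comp hX
  exact (measurable_inner_const θ (Finset.measurable_sum _ fun j _ => h j)).prodMk
    ((measurable_inner_const θ (measurable_residualDir k hX hr.fst)).prodMk hr.snd)

theorem measurable_update (k : ℕ) {X : Ω → ℕ → Vec d} {g : Ω → Vec d} (hX : Measurable X)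
    (hg : Measurable g) : Measurable fun ω => Function.update (X ω) k (g ω) := by
  refine measurable_pi_lambda _ fun j => ?_
  by_cases hj : j = k
  · subst hj
    simp only [Function.update_self]
    exact hg
  · simp only [Function.update_of_ne hj]
    exact (measurable_pi_apply j).comp hX

theorem measurable_searchStep_fixed (θ : Vec d) (m K k q : ℕ) (hB : ∀ k < m, MeasurableSet (B k))
    (hF : ∀ k < m, MeasurableSet (F k)) : Measurable fun p : (ℕ → Vec d) × Seed d =>
      searchStep θ m K B F (k, q, p.1) p.2 := by
  classical
  have h1 : Measurable fun p : (ℕ → Vec d) × Seed d => p.1 := measurable_fst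
  have h2 : Measurable fun p : (ℕ → Vec d) × Seed d => p.2 := measurable_snd
  have hc : ∀ a b : ℕ, Measurable fun p : (ℕ → Vec d) × Seed d => ((a, b, p.1) : SearchState d) :=
    fun a b => measurable_const.prodMk (measurable_const.prodMk h1)
  by_cases hkq : m ≤ k ∨ K ≤ q
  · simp only [searchStep, if_pos hkq]
    exact hc k q
  · simp only [searchStep, if_neg hkq]
    have hk : k < m := by
      by_contra h; exact hkq (Or.inl (not_lt.1 h))
    have hy := measurable_outcome θ k h1 h2
    refine Measurable.ite ?_ (hc _ _) (Measurable.ite (hy (hB k hk)) ?_ (hc _ _))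
    · exact ((measurable_residual k h1 h2.fst) (measurableSet_singleton 0)).union (hy (hF k hk))
    · exact measurable_const.prodMk (measurable_const.prodMk
        (measurable_update k h1 (measurable_residualDir k h1 h2.fst)))

/-- The two counters range over countable sets, so it suffices to treat each of their values
separately. -/
theorem measurable_searchStep (θ : Vec d) (m K : ℕ) (hB : ∀ k < m, MeasurableSet (B k))
    (hF : ∀ k < m, MeasurableSet (F k)) :
    Measurable (Function.uncurry (searchStep θ m K B F)) := by
  have h1 : Measurable fun p : ℕ × ℕ × ((ℕ → Vec d) × Seed d) =>
      searchStep θ m K B F (p.1, p.2.1, p.2.2.1) p.2.2.2 :=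
    measurable_from_prod_countable_right fun k =>
      measurable_from_prod_countable_right fun q => measurable_searchStep_fixed θ m K k q hB hF
  have h2 : Measurable fun p : SearchState d × Seed d =>
      ((p.1.1, p.1.2.1, (p.1.2.2, p.2)) : ℕ × ℕ × ((ℕ → Vec d) × Seed d)) := by fun_prop
  exact h1.comp h2

theorem measurable_searchPotential (m K : ℕ) (ρ : ENNReal) :
    Measurable (searchPotential (d := d) m K ρ) := by
  have h : Measurable fun p : ℕ × ℕ => (if m ≤ p.1 then 0 else if K ≤ p.2 then 1 else
      ((m - 1 - p.1 : ℕ) * ρ ^ K + ρ ^ (K - p.2)) : ENNReal) := measurable_of_countable _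
  exact h.comp (measurable_fst.prodMk (measurable_fst.comp measurable_snd))

end Measurability

/-! ### Invariants and failure probability of the modeled search -/

theorem SearchState.Valid.norm_sum {s : SearchState d} (hs : s.Valid θ m) :
    ‖∑ j ∈ Finset.range s.1, s.2.2 j‖ = √(s.1 : ℝ) := by
  rw [eq_comm, Real.sqrt_eq_iff_eq_sq (Nat.cast_nonneg _) (norm_nonneg _),
    ← real_inner_self_eq_norm_sq, sum_inner]
  have : ∀ i ∈ Finset.range s.1, inner ℝ (s.2.2 i) (∑ j ∈ Finset.range s.1, s.2.2 j) = (1 : ℝ) := by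
    intro i hi
    rw [inner_sum, Finset.sum_congr rfl fun j hj =>
      hs.2.1 i (Finset.mem_range.1 hi) j (Finset.mem_range.1 hj)]
    rw [Finset.sum_ite_eq, if_pos hi]
  rw [Finset.sum_congr rfl this]
  simp

theorem SearchState.Valid.inner_sum_mem {s : SearchState d} (hs : s.Valid θ m) :
    (inner ℝ θ (∑ j ∈ Finset.range s.1, s.2.2 j) : ℝ) ∈
      Icc (s.1 * (2 / √(d : ℝ))) (s.1 * (3 / √(d : ℝ))) := by
  rw [inner_sum]
  constructor
  · have := Finset.card_nsmul_le_sum (Finset.range s.1) (fun j => (inner ℝ θ (s.2.2 j) : ℝ)) _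
      fun j hj => (hs.2.2 j (Finset.mem_range.1 hj)).1
    simpa using this
  · have := Finset.sum_le_card_nsmul (Finset.range s.1) (fun j => (inner ℝ θ (s.2.2 j) : ℝ)) _
      fun j hj => (hs.2.2 j (Finset.mem_range.1 hj)).2
    simpa using this

theorem inner_sum_residualDir {k : ℕ} {V : ℕ → Vec d} (hV : OrthonormalUpTo k V) (g : Vec d) :
    inner ℝ (∑ j ∈ Finset.range k, V j) (residualDir k V g) = (0 : ℝ) := by
  rw [sum_inner, Finset.sum_eq_zero]
  intro j hj
  rw [residualDir, real_inner_smul_right, inner_residual hV (Finset.mem_range.1 hj), mul_zero]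

theorem norm_residualDir {k : ℕ} {V : ℕ → Vec d} {g : Vec d} (hg : residual k V g ≠ 0) :
    ‖residualDir k V g‖ = 1 := by
  rw [residualDir, norm_smul, norm_inv, norm_norm, inv_mul_cancel₀ (norm_ne_zero_iff.2 hg)]

variable {f : ℝ → ℝ} {η : ℝ} {center : ℕ → ℝ}

theorem SearchState.Valid.outcome_spec {s : SearchState d} (hs : s.Valid θ m)
    (hE : TestEvents f θ η center s.1 (B s.1) (F s.1)) {r : Seed d}
    (hr : residual s.1 s.2.2 r.1 ≠ 0) (hrF : outcome θ s.1 s.2.2 r ∉ F s.1) :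
    (Accepts f (oracle f θ) η center s.1 (∑ j ∈ Finset.range s.1, s.2.2 j)
      (residualDir s.1 s.2.2 r.1) r.2 ↔ outcome θ s.1 s.2.2 r ∈ B s.1) ∧
    ((inner ℝ θ (residualDir s.1 s.2.2 r.1) : ℝ) ∈ Icc (2.2 / √(d : ℝ)) (2.8 / √(d : ℝ)) →
      outcome θ s.1 s.2.2 r ∈ B s.1) ∧
    (outcome θ s.1 s.2.2 r ∈ B s.1 →
      (inner ℝ θ (residualDir s.1 s.2.2 r.1) : ℝ) ∈ Icc (2 / √(d : ℝ)) (3 / √(d : ℝ))) :=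
  hE.spec _ _ _ (norm_residualDir hr) hs.norm_sum (inner_sum_residualDir hs.2.1 _)
    hs.inner_sum_mem hrF

/-- Outside `F` the modeled test is sound, and an outcome in `F` never adds a direction. Hence
validity is a deterministic invariant, with no exceptional event. -/
theorem valid_searchStep (hBF : ∀ k < m, TestEvents f θ η center k (B k) (F k))
    (s : SearchState d) (r : Seed d) (hs : s.Valid θ m) :
    (searchStep θ m K B F s r).Valid θ m := by
  unfold searchStep
  split_ifs with h1 h2 h3
  · exact hs
  · exact hs
  · push Not at h1 h2
    refine ⟨h1.1, hs.2.1.update h2.1, fun j hj => ?_⟩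
    have h := (hs.outcome_spec (hBF s.1 h1.1) h2.1 h2.2).2.2 h3
    rcases Nat.lt_succ_iff_lt_or_eq.1 hj with hj' | rfl
    · simp only [Function.update_of_ne hj'.ne]
      exact hs.2.2 j hj'
    · simp only [Function.update_self]
      exact h
  · exact hs

/-- The law of the randomness of one pass. -/
noncomputable abbrev passLaw (d : ℕ) : Measure (Seed d) := (stdGaussian (Vec d)).prod noiseLaw

/-- The randomness for which a pass is invalid. -/
def badSeeds (θ : Vec d) (F : ℕ → Set (ℝ × ℝ × (ℕ → ℝ))) (k : ℕ) (V : ℕ → Vec d) :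
    Set (Seed d) := {r | residual k V r.1 = 0} ∪ {r | outcome θ k V r ∈ F k}

/-- The randomness for which the sampled direction is not informative. -/
def missSeeds (θ : Vec d) (k : ℕ) (V : ℕ → Vec d) : Set (Seed d) :=
  {g : Vec d | (inner ℝ θ (residualDir k V g) : ℝ) ∈
    Icc (2.2 / √(d : ℝ)) (2.8 / √(d : ℝ))}ᶜ ×ˢ univ

theorem measurableSet_informative (θ : Vec d) (k : ℕ) (V : ℕ → Vec d) :
    MeasurableSet {g : Vec d | (inner ℝ θ (residualDir k V g) : ℝ) ∈
      Icc (2.2 / √(d : ℝ)) (2.8 / √(d : ℝ))} :=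
  (measurable_inner_const θ (measurable_residualDir k measurable_const measurable_id))
    measurableSet_Icc

theorem measurableSet_missSeeds (θ : Vec d) (k : ℕ) (V : ℕ → Vec d) :
    MeasurableSet (missSeeds θ k V) :=
  (measurableSet_informative θ k V).compl.prod MeasurableSet.univ

theorem measurableSet_outcome_mem {V : ℕ → Vec d} {k : ℕ} (hF : MeasurableSet (F k)) :
    MeasurableSet {r : Seed d | outcome θ k V r ∈ F k} :=
  (measurable_outcome θ k measurable_const measurable_id) hF

theorem measurableSet_badSeeds {V : ℕ → Vec d} {k : ℕ} (hF : MeasurableSet (F k)) :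
    MeasurableSet (badSeeds θ F k V) :=
  ((measurable_residual k measurable_const measurable_fst) (measurableSet_singleton 0)).union
    (measurableSet_outcome_mem hF)

theorem passLaw_badSeeds_le {V : ℕ → Vec d} {k : ℕ} (hV : OrthonormalUpTo k V) (hk : k < d)
    (hE : TestEvents f θ η center k (B k) (F k)) :
    passLaw d (badSeeds θ F k V) ≤ ENNReal.ofReal η := by
  have e1 : passLaw d {r | residual k V r.1 = 0} = 0 := by
    have : {r : Seed d | residual k V r.1 = 0} = {g | residual k V g = 0} ×ˢ univ := by
      ext r; simp
    rw [this, Measure.prod_prod, stdGaussian_residual_eq_zero hV hk, zero_mul]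
  have e2 : passLaw d {r | outcome θ k V r ∈ F k} ≤ ENNReal.ofReal η := by
    rw [Measure.prod_apply (measurableSet_outcome_mem hE.measurable_fail)]
    refine (lintegral_mono fun g => ?_).trans_eq
      (by rw [lintegral_const, measure_univ, mul_one] : ∫⁻ _ : Vec d, ENNReal.ofReal η
        ∂(stdGaussian (Vec d)) = ENNReal.ofReal η)
    exact hE.fail_le (inner ℝ θ (∑ j ∈ Finset.range k, V j)) (inner ℝ θ (residualDir k V g))
  exact (measure_union_le _ _).trans (by rw [e1, zero_add]; exact e2)

theorem passLaw_missSeeds_le (hd : 9 ≤ d) (hθ : ‖θ‖ = 1) {V : ℕ → Vec d} {k : ℕ} (hk : 16 * k < d)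
    (hV : OrthonormalUpTo k V)
    (hVθ : ∀ j < k, (inner ℝ θ (V j) : ℝ) ∈ Icc (2 / √(d : ℝ)) (3 / √(d : ℝ))) :
    passLaw d (missSeeds θ k V) ≤ ENNReal.ofReal (1 - dirProb) := by
  rw [missSeeds, Measure.prod_prod, measure_univ, mul_one,
    prob_compl_eq_one_sub (measurableSet_informative θ k V),
    ENNReal.ofReal_sub _ dirProb_pos.le, ENNReal.ofReal_one]
  refine tsub_le_tsub_left (le_stdGaussian_informative hd hk hθ hV fun j hj => ?_) _
  rw [abs_of_nonneg (le_trans (by positivity) (hVθ j hj).1)]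
  exact (hVθ j hj).2

/-- An invalid pass raises the potential to `1`. An acceptance moves one of the `m - 1 - k` reserved
summands `ρ ^ K` into the role of the current epoch. A rejection in a valid pass can only come from
an uninformative direction, and it uses up one of the remaining passes. -/
theorem searchPotential_searchStep_le (hBF : ∀ k < m, TestEvents f θ η center k (B k) (F k))
    {k q : ℕ} {V : ℕ → Vec d} (hs : SearchState.Valid θ m (k, q, V)) (hkm : k < m) (hqK : q < K)
    (ρ : ENNReal) (r : Seed d) :
    searchPotential m K ρ (searchStep θ m K B F (k, q, V) r) ≤
      (m - 1 - k : ℕ) * ρ ^ K + (badSeeds θ F k V).indicator 1 r +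
        (missSeeds θ k V).indicator (fun _ => ρ ^ (K - q - 1)) r := by
  have hkq : ¬ (m ≤ k ∨ K ≤ q) := by omega
  simp only [searchStep, if_neg hkq]
  split_ifs with h2 h3
  · have : r ∈ badSeeds θ F k V := h2
    simp only [searchPotential, if_neg (not_le.2 hkm), le_refl, if_true,
      indicator_of_mem this, Pi.one_apply]
    exact le_trans le_add_self le_self_add
  · refine le_trans ?_ (le_trans (le_self_add (b := (badSeeds θ F k V).indicator 1 r)) le_self_add)
    simp only [searchPotential]
    rw [if_neg (not_le.2 (lt_of_le_of_lt (Nat.zero_le _) hqK))]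
    split_ifs with h4
    · exact zero_le
    · rw [Nat.sub_zero]
      have : (m - 1 - k : ℕ) = (m - 1 - (k + 1) : ℕ) + 1 := by omega
      rw [this]
      push_cast
      rw [add_mul, one_mul]
  · push Not at h2
    have hmem : r ∈ missSeeds θ k V := by
      refine ⟨fun hcon => ?_, mem_univ _⟩
      exact h3 ((hs.outcome_spec (hBF k hkm) h2.1 h2.2).2.1 hcon)
    rw [indicator_of_mem hmem]
    simp only [searchPotential, if_neg (not_le.2 hkm)]
    split_ifs with h4
    · have : K - q - 1 = 0 := by omega
      rw [this, pow_zero]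
      exact le_add_self
    · rw [← Nat.sub_sub]
      gcongr
      exact le_self_add

/-- An uninformative sample has probability at most `ρ`, which restores the factor lost in `ρ ^ (K -
q - 1)`. Only the probability `η` of an invalid pass remains as drift. -/
theorem drift_searchStep (hd : 9 ≤ d) (hθ : ‖θ‖ = 1) (hm : 16 * m < d + 16)
    (hBF : ∀ k < m, TestEvents f θ η center k (B k) (F k))
    (s : SearchState d) (hs : s.Valid θ m) :
    ∫⁻ r, searchPotential m K (ENNReal.ofReal (1 - dirProb)) (searchStep θ m K B F s r)
      ∂(passLaw d) ≤
      searchPotential m K (ENNReal.ofReal (1 - dirProb)) s + ENNReal.ofReal η := by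
  obtain ⟨k, q, V⟩ := s
  by_cases hkq : m ≤ k ∨ K ≤ q
  · simp only [searchStep, if_pos hkq, lintegral_const, measure_univ, mul_one]
    exact le_self_add
  obtain ⟨hkm, hqK⟩ : k < m ∧ q < K := by push Not at hkq; exact hkq
  have hV : OrthonormalUpTo k V := hs.2.1
  set ρ : ENNReal := ENNReal.ofReal (1 - dirProb) with hρ
  have hbadm := measurableSet_badSeeds (θ := θ) (V := V) (hBF k hkm).measurable_fail
  have hmissm := measurableSet_missSeeds θ k V
  calc ∫⁻ r, searchPotential m K ρ (searchStep θ m K B F (k, q, V) r) ∂(passLaw d)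
      ≤ ∫⁻ r, ((m - 1 - k : ℕ) * ρ ^ K + (badSeeds θ F k V).indicator 1 r +
        (missSeeds θ k V).indicator (fun _ => ρ ^ (K - q - 1)) r) ∂(passLaw d) :=
        lintegral_mono (searchPotential_searchStep_le hBF hs hkm hqK ρ)
    _ = (m - 1 - k : ℕ) * ρ ^ K + passLaw d (badSeeds θ F k V) +
          ρ ^ (K - q - 1) * passLaw d (missSeeds θ k V) := by
        rw [lintegral_add_right _ (measurable_const.indicator hmissm),
          lintegral_add_right _ (measurable_one.indicator hbadm), lintegral_const, measure_univ,
          mul_one, lintegral_indicator_one hbadm, lintegral_indicator_const hmissm]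
    _ ≤ (m - 1 - k : ℕ) * ρ ^ K + ENNReal.ofReal η + ρ ^ (K - q - 1) * ρ := by
        gcongr
        · exact passLaw_badSeeds_le hV (by omega) (hBF k hkm)
        · exact passLaw_missSeeds_le hd hθ (by omega) hV hs.2.2
    _ = searchPotential m K ρ (k, q, V) + ENNReal.ofReal η := by
        simp only [searchPotential, if_neg (not_le.2 hkm), if_neg (not_le.2 hqK)]
        rw [← pow_succ, show K - q - 1 + 1 = K - q by omega]
        ring

/-- The initial state of the modeled search. -/
def searchStart (d : ℕ) : SearchState d := (0, 0, fun _ => 0)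

theorem valid_searchStart : (searchStart d).Valid θ m :=
  ⟨Nat.zero_le _, fun i hi => absurd hi (Nat.not_lt_zero i),
    fun i hi => absurd hi (Nat.not_lt_zero i)⟩

/-- As long as the search is running, each finished epoch took at most `K` passes. -/
theorem searchStep_passes (θ : Vec d) (m K : ℕ) (B F : ℕ → Set (ℝ × ℝ × (ℕ → ℝ)))
    (ω : ℕ → Seed d) (n : ℕ) :
    let s := chain (searchStep θ m K B F) (searchStart d) ω n
    s.1 < m → s.2.1 < K → n ≤ s.1 * K + s.2.1 := by
  induction n with
  | zero => intro s _ _; exact Nat.zero_le _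
  | succ n ih =>
    simp only [chain] at ih ⊢
    set s := chain (searchStep θ m K B F) (searchStart d) ω n
    unfold searchStep
    split_ifs with h1 h2 h3
    · intro h h'
      omega
    · intro _ h; exact absurd h (lt_irrefl _)
    · push Not at h1
      have := ih h1.1 h1.2
      intro _ _
      simp only [add_mul, one_mul]
      omega
    · push Not at h1
      have := ih h1.1 h1.2
      intro _ _
      simp only
      omega

/-- The modeled search finds all directions, up to a small probability. -/
theorem search_incomplete_le (hd : 9 ≤ d) (hθ : ‖θ‖ = 1) (hm : 16 * m < d + 16) (hm0 : 0 < m)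
    (hK : 0 < K) (hBF : ∀ k < m, TestEvents f θ η center k (B k) (F k)) :
    seedLaw d {ω | (chain (searchStep θ m K B F) (searchStart d) ω (m * K)).1 < m} ≤
      m * ENNReal.ofReal (1 - dirProb) ^ K + (m * K : ℕ) * ENNReal.ofReal η := by
  set ρ : ENNReal := ENNReal.ofReal (1 - dirProb) with hρ
  have hstep := measurable_searchStep θ m K (fun k hk => (hBF k hk).measurable_accept)
    (fun k hk => (hBF k hk).measurable_fail)
  have hΦ := measurable_searchPotential (d := d) m K ρ
  have h := lintegral_chain_le hstep (passLaw d) hΦ (valid_searchStart (d := d) (θ := θ) (m := m))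
    (valid_searchStep hBF) (drift_searchStep hd hθ hm hBF) (m * K)
  have h0 : searchPotential m K ρ (searchStart d) = m * ρ ^ K := by
    have h1 : ¬ m ≤ (searchStart d).1 := not_le.2 hm0
    have h2 : ¬ K ≤ (searchStart d).2.1 := not_le.2 hK
    rw [searchPotential, if_neg h1, if_neg h2]
    change ((m - 1 - 0 : ℕ) : ENNReal) * ρ ^ K + ρ ^ (K - 0) = m * ρ ^ K
    obtain ⟨n, rfl⟩ := Nat.exists_eq_add_of_lt hm0
    simp only [zero_add, Nat.sub_zero, Nat.add_sub_cancel]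
    push_cast
    rw [add_mul, one_mul]
  rw [h0] at h
  refine le_trans ?_ h
  have hmk := mul_meas_ge_le_lintegral (μ := seedLaw d)
    (hΦ.comp (measurable_chain hstep (searchStart d) (m * K))) 1
  rw [one_mul] at hmk
  refine le_trans (measure_mono fun ω hω => ?_) hmk
  have hω' : (chain (searchStep θ m K B F) (searchStart d) ω (m * K)).1 < m := hω
  -- A search still running in one of the first `m` epochs has made fewer than `m * K` passes. So an
  -- incomplete search has failed after `m * K` passes, and its potential is `1`.
  have hq : K ≤ (chain (searchStep θ m K B F) (searchStart d) ω (m * K)).2.1 := by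
    by_contra hcon
    have h1 := searchStep_passes θ m K B F ω (m * K) hω' (not_le.1 hcon)
    have h2 : (chain (searchStep θ m K B F) (searchStart d) ω (m * K)).1 * K + K ≤ m * K := by
      rw [← Nat.succ_mul]
      exact Nat.mul_le_mul_right K hω'
    omega
  change 1 ≤ searchPotential m K ρ _
  rw [searchPotential, if_neg (not_le.2 hω'), if_pos hq]

end Search

end RidgeBandit

namespace RidgeBandit

/-! ### The algorithm follows the modeled search -/

/-- The list `V (k - 1), …, V 0`. -/
def dirList {α : Type*} (V : ℕ → α) : ℕ → List α
  | 0 => []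
  | k + 1 => V k :: dirList V k

section DirList

variable {α : Type*} (V : ℕ → α)

theorem length_dirList (k : ℕ) : (dirList V k).length = k := by
  induction k with
  | zero => rfl
  | succ k ih => rw [dirList, List.length_cons, ih]

theorem sum_dirList [AddCommMonoid α] (k : ℕ) :
    (dirList V k).sum = ∑ j ∈ Finset.range k, V j := by
  induction k with
  | zero => rfl
  | succ k ih => rw [dirList, List.sum_cons, ih, Finset.sum_range_succ, add_comm]

theorem setOf_mem_dirList (k : ℕ) : {u | u ∈ dirList V k} = V '' Iio k := by
  induction k with
  | zero => ext; simp [dirList]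
  | succ k ih =>
    ext u
    have : u ∈ dirList V k ↔ u ∈ V '' Iio k := by rw [← ih]; rfl
    simp only [mem_ofPred_eq, dirList, List.mem_cons, this, mem_image, mem_Iio]
    constructor
    · rintro (rfl | ⟨j, hj, rfl⟩)
      · exact ⟨k, k.lt_succ_self, rfl⟩
      · exact ⟨j, hj.trans k.lt_succ_self, rfl⟩
    · rintro ⟨j, hj, rfl⟩
      rcases Nat.lt_succ_iff_lt_or_eq.1 hj with h | rfl
      · exact Or.inr ⟨j, h, rfl⟩
      · exact Or.inl rfl

theorem dirList_congr {V W : ℕ → α} {k : ℕ} (h : ∀ j < k, V j = W j) :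
    dirList V k = dirList W k := by
  induction k with
  | zero => rfl
  | succ k ih =>
    rw [dirList, dirList, h k k.lt_succ_self, ih fun j hj => h j (hj.trans k.lt_succ_self)]

end DirList

/-- The number of queries in each pass of epoch `k + 1`. -/
noncomputable def passQueries (f : ℝ → ℝ) (d : ℕ) (η : ℝ) (center : ℕ → ℝ) (k : ℕ) : ℕ :=
  if k + 1 ≤ 100 then initQueries f d η else 2 * goodQueries f d η (center (k + 1))

open Classical in
theorem step_eq {d : ℕ} (f : ℝ → ℝ) (c δ : ℝ) (center : ℕ → ℝ) (O : Vec d → ℝ → ℝ)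
    (s : State d) (r : Seed d) (hs : s.dirs.length < numEpochs d) :
    step f c δ center O s r =
      { dirs := if Accepts f O (testError d c δ) center s.dirs.length s.dirs.sum
            (sampleDir (Submodule.span ℝ {u | u ∈ s.dirs}) r.1) r.2
          then sampleDir (Submodule.span ℝ {u | u ∈ s.dirs}) r.1 :: s.dirs else s.dirs
        samples := s.samples + passQueries f d (testError d c δ) center s.dirs.length } := by
  unfold step
  rw [if_neg (not_le.2 hs)]
  by_cases h : s.dirs.length + 1 ≤ 100
  · simp only [Accepts, passQueries, if_pos h]
  · simp only [Accepts, passQueries, if_neg h]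

/-- The state `r` of the algorithm corresponds to the state `s` of the modeled search. -/
structure Matches {d : ℕ} (f : ℝ → ℝ) (η : ℝ) (center : ℕ → ℝ) (m K : ℕ) (s : SearchState d)
    (r : State d) : Prop where
  dirs : r.dirs = dirList s.2.2 s.1
  samples : r.samples ≤ K * ∑ j ∈ Finset.range s.1, passQueries f d η center j +
    s.2.1 * passQueries f d η center s.1
  passes : m ≤ s.1 → s.2.1 = 0

/-- Outside the failure event the actual and the modeled test agree, so both searches accept the
same direction. Survival after the step, `hK'`, is what excludes the failure event. -/
theorem matches_step {d : ℕ} {f : ℝ → ℝ} {c δ : ℝ} {center : ℕ → ℝ} {θ : Vec d} {K : ℕ}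
    {B F : ℕ → Set (ℝ × ℝ × (ℕ → ℝ))}
    (hBF : ∀ k < numEpochs d, TestEvents f θ (testError d c δ) center k (B k) (F k))
    {s : SearchState d} {t : State d} {r : Seed d} (hs : s.Valid θ (numEpochs d))
    (hst : Matches f (testError d c δ) center (numEpochs d) K s t)
    (hK : s.1 < numEpochs d → s.2.1 < K)
    (hK' : (searchStep θ (numEpochs d) K B F s r).1 < numEpochs d →
      (searchStep θ (numEpochs d) K B F s r).2.1 < K) :
    Matches f (testError d c δ) center (numEpochs d) K
      (searchStep θ (numEpochs d) K B F s r) (step f c δ center (oracle f θ) t r) := by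
  have hlen : t.dirs.length = s.1 := by rw [hst.dirs, length_dirList]
  by_cases hm : numEpochs d ≤ s.1
  · have e1 : searchStep θ (numEpochs d) K B F s r = s := by rw [searchStep, if_pos (Or.inl hm)]
    have e2 : step f c δ center (oracle f θ) t r = t := by rw [step, if_pos (by rwa [hlen])]
    rw [e1, e2]
    exact hst
  have hm' : s.1 < numEpochs d := not_le.1 hm
  have hq := hK hm'
  have hdir : sampleDir (Submodule.span ℝ {u | u ∈ t.dirs}) r.1 =
      residualDir s.1 s.2.2 r.1 := by
    rw [hst.dirs, setOf_mem_dirList, sampleDir_eq_residualDir hs.2.1]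
  rw [step_eq f c δ center _ t r (by rwa [hlen]), hlen, hdir]
  have hsum : t.dirs.sum = ∑ j ∈ Finset.range s.1, s.2.2 j := by
    rw [hst.dirs, sum_dirList]
  rw [hsum]
  have hcond : ¬ (numEpochs d ≤ s.1 ∨ K ≤ s.2.1) := by omega
  unfold searchStep at hK' ⊢
  rw [if_neg hcond] at hK' ⊢
  by_cases h2 : residual s.1 s.2.2 r.1 = 0 ∨ outcome θ s.1 s.2.2 r ∈ F s.1
  · rw [if_pos h2] at hK'
    exact absurd (hK' hm') (lt_irrefl _)
  rw [if_neg h2]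
  push Not at h2
  have hiff := (hs.outcome_spec (hBF s.1 hm') h2.1 h2.2).1
  by_cases h3 : outcome θ s.1 s.2.2 r ∈ B s.1
  · rw [if_pos h3, if_pos (hiff.2 h3)]
    refine ⟨?_, ?_, fun _ => rfl⟩
    · simp only [dirList, Function.update_self, hst.dirs]
      congr 1
      exact dirList_congr fun j hj => (Function.update_of_ne hj.ne _ _).symm
    · simp only [zero_mul, add_zero, Finset.sum_range_succ, mul_add]
      have h1 : s.2.1 * passQueries f d (testError d c δ) center s.1 +
          passQueries f d (testError d c δ) center s.1 ≤
          K * passQueries f d (testError d c δ) center s.1 := by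
        rw [← Nat.succ_mul]
        exact Nat.mul_le_mul_right _ hq
      have := hst.samples
      omega
  · rw [if_neg h3, if_neg fun h => h3 (hiff.1 h)]
    refine ⟨hst.dirs, ?_, fun h => absurd h hm⟩
    simp only [add_mul, one_mul]
    have := hst.samples
    omega

theorem matches_run {d : ℕ} {f : ℝ → ℝ} {c δ : ℝ} {center : ℕ → ℝ} {θ : Vec d} {K : ℕ}
    {B F : ℕ → Set (ℝ × ℝ × (ℕ → ℝ))}
    (hBF : ∀ k < numEpochs d, TestEvents f θ (testError d c δ) center k (B k) (F k))
    (ω : ℕ → Seed d) (n : ℕ) :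
    let s := chain (searchStep θ (numEpochs d) K B F) (searchStart d) ω n
    (s.1 < numEpochs d → s.2.1 < K) →
      Matches f (testError d c δ) center (numEpochs d) K s
        (run f c δ center (oracle f θ) ω n) := by
  induction n with
  | zero =>
    intro s _
    exact ⟨rfl, Nat.zero_le _, fun _ => rfl⟩
  | succ n ih =>
    intro s hs
    -- Failed states are absorbing, so survival at time `n + 1` implies survival at time `n`.
    have hprev : (chain (searchStep θ (numEpochs d) K B F) (searchStart d) ω n).1 < numEpochs d →
        (chain (searchStep θ (numEpochs d) K B F) (searchStart d) ω n).2.1 < K := by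
      intro h
      by_contra hcon
      have : s = chain (searchStep θ (numEpochs d) K B F) (searchStart d) ω n := by
        change searchStep θ (numEpochs d) K B F _ _ = _
        rw [searchStep, if_pos (Or.inr (not_lt.1 hcon))]
      rw [this] at hs
      exact hcon (hs h)
    exact matches_step hBF (chain_induction valid_searchStart (valid_searchStep hBF) ω n)
      (ih hprev) hprev hs

/-- If the modeled search is complete, then the algorithm outputs a good action. -/
theorem outputs_of_complete {d : ℕ} {f : ℝ → ℝ} {c δ : ℝ} {center : ℕ → ℝ} {θ : Vec d} {K n : ℕ}
    {B F : ℕ → Set (ℝ × ℝ × (ℕ → ℝ))} (hd : 0 < d)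
    (hBF : ∀ k < numEpochs d, TestEvents f θ (testError d c δ) center k (B k) (F k))
    {ω : ℕ → Seed d}
    (h : ¬ (chain (searchStep θ (numEpochs d) K B F) (searchStart d) ω n).1 < numEpochs d) :
    ∃ (a : Vec d) (T : ℕ), Outputs f c δ center (oracle f θ) ω a T ∧ ‖a‖ ≤ 1 ∧
      1 / 2 ≤ (inner ℝ θ a : ℝ) ∧
      T ≤ K * ∑ j ∈ Finset.range (numEpochs d), passQueries f d (testError d c δ) center j := by
  have hdr : (0 : ℝ) < d := by exact_mod_cast hd
  have hmge : (d : ℝ) / 16 ≤ numEpochs d := Nat.le_ceil _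
  have hm0 : 0 < numEpochs d := Nat.ceil_pos.2 (by positivity)
  have hm0' : (0 : ℝ) < numEpochs d := by exact_mod_cast hm0
  have hM := matches_run hBF ω n fun hlt => absurd hlt h
  have hV : SearchState.Valid θ (numEpochs d)
      (chain (searchStep θ (numEpochs d) K B F) (searchStart d) ω n) :=
    chain_induction valid_searchStart (valid_searchStep hBF) ω n
  set s := chain (searchStep θ (numEpochs d) K B F) (searchStart d) ω n
  have hs1 : s.1 = numEpochs d := le_antisymm hV.1 (not_lt.1 h)
  have hsum : (run f c δ center (oracle f θ) ω n).dirs.sum =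
      ∑ j ∈ Finset.range s.1, s.2.2 j := by rw [hM.dirs, sum_dirList]
  have hsm : 0 < √(numEpochs d : ℝ) := Real.sqrt_pos.2 hm0'
  refine ⟨_, _, ⟨n, ?_, rfl, rfl⟩, ?_, ?_, ?_⟩
  · rw [hM.dirs, length_dirList, hs1]
  · rw [hsum, norm_smul, hV.norm_sum, hs1, Real.norm_eq_abs, abs_of_pos (by positivity)]
    exact (one_div_mul_cancel hsm.ne').le
  · rw [hsum, real_inner_smul_right]
    have h1 := hV.inner_sum_mem.1
    rw [hs1] at h1 ⊢
    have hsd : 0 < √(d : ℝ) := Real.sqrt_pos.2 hdr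
    -- This is the bound `m ≥ d / 16`, the reason for the number of epochs.
    have h2 : √(d : ℝ) ≤ 4 * √(numEpochs d : ℝ) := by
      rw [show (4 : ℝ) = √16 by rw [show (16 : ℝ) = 4 ^ 2 by norm_num, Real.sqrt_sq (by norm_num)],
        ← Real.sqrt_mul (by norm_num)]
      exact Real.sqrt_le_sqrt (by linarith)
    calc (1 : ℝ) / 2 ≤ 1 / √(numEpochs d : ℝ) * (numEpochs d * (2 / √(d : ℝ))) := by
          have e : 1 / √(numEpochs d : ℝ) * (numEpochs d * (2 / √(d : ℝ))) =
              2 * √(numEpochs d : ℝ) / √(d : ℝ) := by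
            nth_rw 2 [← Real.mul_self_sqrt hm0'.le]
            field_simp
          rw [e, div_le_div_iff₀ (by norm_num) hsd]
          linarith
      _ ≤ _ := by gcongr
  · have h1 := hM.samples
    rw [hM.passes (not_lt.1 h), zero_mul, add_zero, hs1] at h1
    exact h1

end RidgeBandit

namespace RidgeBandit

/-! ### The tolerances of the tests -/

section Tolerances

variable {f : ℝ → ℝ} {d : ℕ}

theorem lt_of_lt_numEpochs {k : ℕ} (hk : k < numEpochs d) : 16 * k < d := by
  have h : (k : ℝ) < d / 16 := Nat.lt_ceil.1 hk
  have : (16 : ℝ) * k < d := by linarith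
  exact_mod_cast this

theorem numEpochs_lt : 16 * numEpochs d < d + 16 := by
  have h : (numEpochs d : ℝ) < d / 16 + 1 := Nat.ceil_lt_add_one (by positivity)
  have : (16 : ℝ) * numEpochs d < d + 16 := by linarith
  exact_mod_cast this

theorem xPre_div_sqrt_two (d : ℕ) {i : ℕ} (hi : 1 ≤ i) :
    xPre d i / √2 = √(2 * ((i : ℝ) - 1) / d) := by
  have h0 : (0 : ℝ) ≤ (i : ℝ) - 1 := by
    have : (1 : ℝ) ≤ i := by exact_mod_cast hi
    linarith
  rw [xPre, mul_div_assoc 2 ((i : ℝ) - 1), Real.sqrt_mul (by norm_num) (((i : ℝ) - 1) / d)]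
  have h2 : √2 * √2 = (2 : ℝ) := Real.mul_self_sqrt (by norm_num)
  have h3 : (0 : ℝ) < √2 := by positivity
  rw [div_eq_iff h3.ne']
  linear_combination -√(((i : ℝ) - 1) / d) * h2

theorem sqrt_epoch_le {i : ℕ} (hi : 1 ≤ i) (him : i ≤ numEpochs d) :
    √(2 * ((i : ℝ) - 1) / d) ≤ 9 / 25 := by
  obtain ⟨k, rfl⟩ : ∃ k, i = k + 1 := ⟨i - 1, by omega⟩
  have hk := lt_of_lt_numEpochs (d := d) (k := k) (by omega)
  have hd : (0 : ℝ) < d := by exact_mod_cast (by omega : 0 < d)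
  have hk' : (16 : ℝ) * k ≤ d := by exact_mod_cast hk.le
  rw [Real.sqrt_le_left (by norm_num), div_le_iff₀ hd]
  push_cast
  linarith

/-- A center is half optimal, which offsets the factor `1/2` in `eps`. The tolerance `goodGap`, half
of `windowMin`, is thus at least `eps / 2`. -/
theorem center_spec {y : ℝ} {i : ℕ} (hi : 101 ≤ i) (him : i ≤ numEpochs d)
    (hε : 0 < eps f d i) (hy : IsCenter f d (xPre d i) y) :
    y ∈ Icc (20 / √(2 * d : ℝ)) (1 / 2) ∧ y ≤ xPre d i / √2 ∧ 0 < windowMin f d y ∧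
      eps f d i ≤ windowMin f d y := by
  obtain ⟨⟨hy1, hy2⟩, hy3⟩ := hy
  have hx := xPre_div_sqrt_two d (by omega : 1 ≤ i)
  have hle := sqrt_epoch_le (d := d) (by omega : 1 ≤ i) him
  have he : eps f d i = (1 / 2) *
      sSup (windowMin f d '' Icc (20 / √(2 * d : ℝ)) (xPre d i / √2)) := by
    rw [eps, if_neg (by omega), hx]
  have h4 : eps f d i ≤ windowMin f d y := by rw [he]; linarith
  exact ⟨⟨hy1, by rw [hx] at hy2; linarith⟩, hy2, lt_of_lt_of_le hε h4, h4⟩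

theorem initGap_le_one (hd : 9 ≤ d) (hf : MonotoneOn f (Icc (-1) 1)) (h0 : f 0 = 0)
    (h1 : f 1 = 1) : initGap f d ≤ 1 := by
  have hs : (3 : ℝ) ≤ √(d : ℝ) := by
    apply Real.le_sqrt_of_sq_le
    have : (9 : ℝ) ≤ d := by exact_mod_cast hd
    linarith
  have hs0 : (0 : ℝ) < √(d : ℝ) := by linarith
  have h := two_mul_initGap_le hd hf (z := 2 / √(d : ℝ)) ⟨le_refl _, by gcongr; norm_num⟩
  have e : 2 / √(d : ℝ) + 0.2 / √(d : ℝ) ≤ 1 := by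
    rw [← add_div, div_le_one hs0]; norm_num; linarith
  have hp1 : 0 < 2 / √(d : ℝ) := by positivity
  have hp2 : 0 < 0.2 / √(d : ℝ) := by positivity
  have a1 := hf (a := 2 / √(d : ℝ) + 0.2 / √(d : ℝ)) (b := 1) ⟨by linarith, e⟩
    ⟨by norm_num, le_refl _⟩ e
  have a2 := hf (a := 0) (b := 2 / √(d : ℝ)) ⟨by norm_num, by norm_num⟩
    ⟨by linarith, by linarith⟩ hp1.le
  linarith

theorem windowMin_le_one (hd : 9 ≤ d) (hf : MonotoneOn f (Icc (-1) 1)) (h0 : f 0 = 0)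
    (h1 : f 1 = 1) {y : ℝ} (hy : y ∈ Icc (20 / √(2 * d : ℝ)) (1 / 2)) : windowMin f d y ≤ 1 := by
  have hη := step_pos hd
  have hy0 : 0 < y := lt_of_lt_of_le (by positivity) hy.1
  have h := windowMin_le hd hf hy (z := 5 * y / 6) ⟨le_refl _, by linarith⟩
  have e1 : 0.2 / √(2 * d : ℝ) = 0.2 * (1 / √(2 * d : ℝ)) := by ring
  have e2 : 20 / √(2 * d : ℝ) = 20 * (1 / √(2 * d : ℝ)) := by ring
  rw [e1] at h
  have hy1 := hy.1
  have hy2 := hy.2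
  rw [e2] at hy1
  set η := 1 / √(2 * d : ℝ)
  have a1 := hf (a := 5 * y / 6 + 0.2 * η) (b := 1) ⟨by linarith, by linarith⟩
    ⟨by norm_num, le_refl _⟩ (by linarith)
  have a2 := hf (a := 0) (b := 5 * y / 6) ⟨by norm_num, by norm_num⟩
    ⟨by linarith, by linarith⟩ (by linarith)
  linarith

/-- The slack `ε / 2 ≤ g` covers centers that are not maximizers, and `ε ≤ 1` absorbs the rounding
up. -/
theorem ceil_div_sq_le {a g ε : ℝ} (ha : 0 ≤ a) (hε : 0 < ε) (hε1 : ε ≤ 1) (hg : ε / 2 ≤ g) :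
    (⌈2 * a / g ^ 2⌉₊ : ℝ) ≤ (8 * a + 1) / ε ^ 2 := by
  have hg0 : 0 < g := by linarith
  have h1 : (⌈2 * a / g ^ 2⌉₊ : ℝ) ≤ 2 * a / g ^ 2 + 1 :=
    (Nat.ceil_lt_add_one (by positivity)).le
  have h2 : 2 * a / g ^ 2 ≤ 2 * a / (ε / 2) ^ 2 := by gcongr
  have h3 : 2 * a / (ε / 2) ^ 2 = 8 * a / ε ^ 2 := by field_simp; ring
  have h4 : 1 ≤ 1 / ε ^ 2 := by
    rw [le_div_iff₀ (by positivity), one_mul]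
    exact pow_le_one₀ hε.le hε1
  rw [add_div]
  linarith

theorem passQueries_le (hd : 9 ≤ d) (hf : MonotoneOn f (Icc (-1) 1)) (h0 : f 0 = 0) (h1 : f 1 = 1)
    {η : ℝ} (hη : 0 < η) (hη1 : η < 1) {center : ℕ → ℝ} {k : ℕ} (hk : k < numEpochs d)
    (hε : 0 < eps f d (k + 1))
    (hc : 101 ≤ k + 1 → IsCenter f d (xPre d (k + 1)) (center (k + 1))) :
    (passQueries f d η center k : ℝ) ≤ (16 * Real.log (4 / η) + 2) * (1 / eps f d (k + 1) ^ 2) := by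
  have hlog : Real.log (2 / η) ≤ Real.log (4 / η) :=
    Real.log_le_log (by positivity) (by gcongr; norm_num)
  have hlog0 : 0 ≤ Real.log (2 / η) := Real.log_nonneg (by rw [one_le_div hη]; linarith)
  rw [mul_one_div]
  rcases le_or_gt (k + 1) 100 with hk1 | hk1
  · have he : eps f d (k + 1) = initGap f d := by rw [eps, if_pos hk1]
    rw [passQueries, if_pos hk1]
    rw [he] at hε ⊢
    refine (ceil_div_sq_le hlog0 hε (initGap_le_one hd hf h0 h1) (by linarith)).trans ?_
    gcongr
    · linarith
    · norm_num
  · obtain ⟨hy, -, -, hle⟩ := center_spec (by omega) (by omega) hε (hc hk1)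
    have hε1 : eps f d (k + 1) ≤ 1 := hle.trans (windowMin_le_one hd hf h0 h1 hy)
    rw [passQueries, if_neg (not_le.2 hk1)]
    push_cast
    have := ceil_div_sq_le (hlog0.trans hlog) hε hε1
      (g := goodGap f d (center (k + 1))) (by rw [goodGap]; linarith)
    calc (2 : ℝ) * goodQueries f d η (center (k + 1))
        ≤ 2 * ((8 * Real.log (4 / η) + 1) / eps f d (k + 1) ^ 2) := by gcongr; exact this
      _ = _ := by ring

end Tolerances

/-! ### Choice of the number of passes -/

section Passes

variable {d : ℕ} {c δ : ℝ}

/-- The number of passes that each epoch is allowed to take. -/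
noncomputable def maxPasses (d : ℕ) (c δ : ℝ) : ℕ := ⌊Real.log (2 * numEpochs d / δ) / c⌋₊

theorem numEpochs_pos (hd : 0 < d) : 0 < numEpochs d :=
  Nat.ceil_pos.2 (by have : (0 : ℝ) < d := by exact_mod_cast hd
                     positivity)

theorem one_le_log_epochs (hd : 0 < d) (hδ : 0 < δ) (hδ2 : δ < 1 / 2) :
    1 ≤ Real.log (2 * numEpochs d / δ) := by
  have hm : (1 : ℝ) ≤ numEpochs d := by exact_mod_cast numEpochs_pos hd
  rw [Real.le_log_iff_exp_le (by positivity), le_div_iff₀ hδ]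
  have := Real.exp_one_lt_d9
  nlinarith

theorem testError_pos (hd : 0 < d) (hc : 0 < c) (hδ : 0 < δ) (hδ2 : δ < 1 / 2) :
    0 < testError d c δ := by
  have h1 := one_le_log_epochs hd hδ hδ2
  have h2 : (0 : ℝ) < numEpochs d := by exact_mod_cast numEpochs_pos hd
  rw [testError]
  have : 0 < Real.log (2 * numEpochs d / δ) := by linarith
  positivity

theorem testError_lt_one (hd : 0 < d) (hc : 0 < c) (hc1 : c ≤ 1) (hδ : 0 < δ) (hδ2 : δ < 1 / 2) :
    testError d c δ < 1 := by
  have h1 := one_le_log_epochs hd hδ hδ2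
  have h2 : (1 : ℝ) ≤ numEpochs d := by exact_mod_cast numEpochs_pos hd
  have h3 : 1 ≤ 2 * numEpochs d * Real.log (2 * numEpochs d / δ) / c := by
    rw [le_div_iff₀ hc]
    nlinarith
  rw [testError, div_lt_one (by linarith)]
  linarith

/-- The number `L` in the error probability `δ / L` is at least `2 m K`. -/
theorem maxPasses_mul_testError (hd : 0 < d) (hc : 0 < c) (hδ : 0 < δ) (hδ2 : δ < 1 / 2) :
    numEpochs d * maxPasses d c δ * testError d c δ ≤ δ / 2 := by
  have h1 := one_le_log_epochs hd hδ hδ2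
  have h2 : (0 : ℝ) < numEpochs d := by exact_mod_cast numEpochs_pos hd
  have hK : (maxPasses d c δ : ℝ) ≤ Real.log (2 * numEpochs d / δ) / c :=
    Nat.floor_le (by positivity)
  have hη := testError_pos hd hc hδ hδ2
  calc numEpochs d * maxPasses d c δ * testError d c δ
      ≤ numEpochs d * (Real.log (2 * numEpochs d / δ) / c) * testError d c δ := by gcongr
    _ = δ / 2 := by
        rw [testError]
        generalize Real.log (2 * numEpochs d / δ) = l at h1
        have : 0 < l := by linarith
        field_simp

/-- With `l = log (2m/δ) ≥ 1`, the bound on `c` gives `p l / c ≥ l (1 + p) ≥ l + p`, which leaves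
room for the loss of `p` by rounding down. -/
theorem le_maxPasses {p : ℝ} (hp : 0 < p) (hd : 0 < d) (hc : 0 < c) (hcp : c ≤ p / (1 + p))
    (hδ : 0 < δ) (hδ2 : δ < 1 / 2) :
    Real.log (2 * numEpochs d / δ) ≤ p * maxPasses d c δ := by
  have h1 := one_le_log_epochs hd hδ hδ2
  set l := Real.log (2 * numEpochs d / δ) with hl
  have hK : l / c - 1 < maxPasses d c δ := Nat.sub_one_lt_floor _
  rw [le_div_iff₀ (by positivity)] at hcp
  have h2 : l * (1 + p) ≤ p * (l / c) := by
    rw [mul_div_assoc', le_div_iff₀ hc]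
    nlinarith
  nlinarith

theorem mul_pow_maxPasses_le (hd : 0 < d) (hc : 0 < c) (hcp : c ≤ dirProb / (1 + dirProb))
    (hδ : 0 < δ) (hδ2 : δ < 1 / 2) :
    numEpochs d * (1 - dirProb) ^ maxPasses d c δ ≤ δ / 2 := by
  have h2 : (0 : ℝ) < numEpochs d := by exact_mod_cast numEpochs_pos hd
  have h3 := le_maxPasses dirProb_pos hd hc hcp hδ hδ2
  have h4 : (1 - dirProb) ^ maxPasses d c δ ≤ δ / (2 * numEpochs d) := by
    calc (1 - dirProb) ^ maxPasses d c δ ≤ Real.exp (-dirProb) ^ maxPasses d c δ := by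
          have := dirProb_lt_one
          have := Real.one_sub_le_exp_neg dirProb
          gcongr
      _ = Real.exp (-(dirProb * maxPasses d c δ)) := by rw [← Real.exp_nat_mul]; congr 1; ring
      _ ≤ Real.exp (-Real.log (2 * numEpochs d / δ)) := by gcongr
      _ = δ / (2 * numEpochs d) := by
          rw [← Real.log_inv, inv_div, Real.exp_log (by positivity)]
  calc numEpochs d * (1 - dirProb) ^ maxPasses d c δ
      ≤ numEpochs d * (δ / (2 * numEpochs d)) := by gcongr
    _ = δ / 2 := by field_simp

/-- The constant in the bound for the number of queries. -/
noncomputable def queryConst (c : ℝ) : ℝ := (1 / c) * (66 + 16 * Real.log (1 / c))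

/-- With `l = log (2m/δ)` one has `log (4/δ') = log 4 + l + log l + log (1/c)`, of order `W = log
(d/δ)` because `2m ≤ d` and `W ≥ 1`. The other factor `W` comes from the number of passes. -/
theorem maxPasses_mul_log_le (hd : 9 ≤ d) (hc : 0 < c) (hc1 : c ≤ 1) (hδ : 0 < δ)
    (hδ2 : δ < 1 / 2) :
    maxPasses d c δ * (16 * Real.log (4 / testError d c δ) + 2) ≤
      queryConst c * Real.log (d / δ) ^ 2 := by
  have hd0 : 0 < d := by omega
  have hl1 := one_le_log_epochs hd0 hδ hδ2
  have hm : (1 : ℝ) ≤ numEpochs d := by exact_mod_cast numEpochs_pos hd0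
  have hmd : (2 : ℝ) * numEpochs d ≤ d := by
    have h := numEpochs_lt (d := d)
    have : 2 * numEpochs d ≤ d := by omega
    exact_mod_cast this
  set W := Real.log (d / δ) with hW
  set l := Real.log (2 * numEpochs d / δ) with hl
  have hdr : (0 : ℝ) < d := by linarith
  have hlW : l ≤ W := Real.log_le_log (by positivity) (by gcongr)
  have hW1 : 1 ≤ W := hl1.trans hlW
  have hlc : 0 ≤ Real.log (1 / c) := Real.log_nonneg (by rwa [one_le_div hc])
  have hK : (maxPasses d c δ : ℝ) ≤ l / c := Nat.floor_le (by positivity)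
  have hΛ : Real.log (4 / testError d c δ) ≤ (4 + Real.log (1 / c)) * W := by
    have e : 4 / testError d c δ = 4 * (2 * numEpochs d / δ) * l * (1 / c) := by
      rw [testError, ← hl]
      field_simp
    have l0 : 0 < l := by linarith
    rw [e, Real.log_mul (by positivity) (by positivity), Real.log_mul (by positivity) l0.ne',
      Real.log_mul (by norm_num) (by positivity), ← hl]
    have h4 : Real.log 4 ≤ 2 := by
      rw [Real.log_le_iff_le_exp (by norm_num)]
      have : Real.exp 2 = Real.exp 1 * Real.exp 1 := by rw [← Real.exp_add]; norm_num
      rw [this]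
      have := Real.exp_one_gt_d9
      nlinarith
    have hll : Real.log l ≤ l := (Real.log_le_sub_one_of_pos l0).trans (by linarith)
    nlinarith
  have hW0 : 0 ≤ W := by linarith
  have hsecond : 16 * Real.log (4 / testError d c δ) + 2 ≤ (66 + 16 * Real.log (1 / c)) * W := by
    nlinarith
  have hΛ0 : 0 ≤ 16 * Real.log (4 / testError d c δ) + 2 := by
    have : 0 ≤ Real.log (4 / testError d c δ) := by
      refine Real.log_nonneg ?_
      rw [one_le_div (testError_pos hd0 hc hδ hδ2)]
      linarith [testError_lt_one hd0 hc hc1 hδ hδ2]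
    linarith
  calc maxPasses d c δ * (16 * Real.log (4 / testError d c δ) + 2)
      ≤ (l / c) * (16 * Real.log (4 / testError d c δ) + 2) := by gcongr
    _ ≤ (W / c) * ((66 + 16 * Real.log (1 / c)) * W) := by gcongr
    _ = queryConst c * W ^ 2 := by rw [queryConst]; ring

end Passes

/-- With probability at least `1 - δ`, the algorithm outputs a good action after a number of
queries that is bounded in terms of the tolerances of the tests. -/
theorem search_failure_le {d : ℕ} {f : ℝ → ℝ} {c δ : ℝ} {θ : Vec d} {center : ℕ → ℝ}
    (hc : 0 < c) (hcp : c ≤ dirProb / (1 + dirProb)) (hd : 9 ≤ d)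
    (hf : MonotoneOn f (Icc (-1) 1)) (h0 : f 0 = 0) (h1 : f 1 = 1) (hδ : 0 < δ) (hδ2 : δ < 1 / 2)
    (hθ : ‖θ‖ = 1) (hε : ∀ i ∈ Finset.Icc 1 (numEpochs d), 0 < eps f d i)
    (hcenter : ∀ i ∈ Finset.Icc 101 (numEpochs d), IsCenter f d (xPre d i) (center i)) :
    seedLaw d {ω | ¬ ∃ (a : Vec d) (T : ℕ), Outputs f c δ center (oracle f θ) ω a T ∧ ‖a‖ ≤ 1 ∧
      1 / 2 ≤ (inner ℝ θ a : ℝ) ∧ (T : ℝ) ≤ queryConst c * Real.log (d / δ) ^ 2 *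
        ∑ i ∈ Finset.Icc 1 (numEpochs d), 1 / eps f d i ^ 2} ≤ ENNReal.ofReal δ := by
  have hd0 : 0 < d := by omega
  have hc1 : c ≤ 1 := hcp.trans (by
    have := dirProb_pos
    rw [div_le_one (by linarith)]; linarith)
  have hη := testError_pos hd0 hc hδ hδ2
  have hη1 := testError_lt_one hd0 hc hc1 hδ hδ2
  have hex : ∀ k, ∃ B F, k < numEpochs d → TestEvents f θ (testError d c δ) center k B F := by
    intro k
    by_cases hk : k < numEpochs d
    · have hεk := hε (k + 1) (Finset.mem_Icc.2 ⟨by omega, hk⟩)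
      obtain ⟨B, F, h⟩ := exists_testEvents (center := center) (k := k) hd hf hθ hη hη1
        (fun h => by rwa [eps, if_pos h] at hεk)
        (fun h => by
          obtain ⟨a1, a2, a3, -⟩ := center_spec (by omega) hk hεk
            (hcenter (k + 1) (Finset.mem_Icc.2 ⟨by omega, hk⟩))
          exact ⟨a1, a2, a3⟩)
      exact ⟨B, F, fun _ => h⟩
    · exact ⟨∅, ∅, fun h => absurd h hk⟩
  choose B F hBF using hex
  set K := maxPasses d c δ with hKdef
  have hKpos : 0 < K := by
    have h3 := le_maxPasses dirProb_pos hd0 hc hcp hδ hδ2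
    have h4 := one_le_log_epochs hd0 hδ hδ2
    rcases Nat.eq_zero_or_pos K with h | h
    · rw [← hKdef, h] at h3
      norm_num at h3
      linarith
    · exact h
  have hmain := search_incomplete_le hd hθ numEpochs_lt (numEpochs_pos hd0) hKpos hBF
  have hp0 : (0 : ℝ) ≤ 1 - dirProb := by linarith [dirProb_lt_one]
  refine le_trans (measure_mono fun ω hω => ?_) (hmain.trans ?_)
  -- The failure event of the algorithm is only shown to be contained in the event that the modeled
  -- search is incomplete, so its own measurability does not matter.
  · by_contra hcon
    obtain ⟨a, T, hout, ha, hia, hT⟩ := outputs_of_complete hd0 hBF hcon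
    refine hω ⟨a, T, hout, ha, hia, ?_⟩
    have hT' : (T : ℝ) ≤ K * ∑ j ∈ Finset.range (numEpochs d),
        (passQueries f d (testError d c δ) center j : ℝ) := by exact_mod_cast hT
    have hsum : ∑ i ∈ Finset.Icc 1 (numEpochs d), 1 / eps f d i ^ 2 =
        ∑ j ∈ Finset.range (numEpochs d), 1 / eps f d (j + 1) ^ 2 := by
      rw [Finset.range_eq_Ico, Finset.sum_Ico_add' (fun i => 1 / eps f d i ^ 2) 0 (numEpochs d) 1]
      rfl
    calc (T : ℝ) ≤ K * ∑ j ∈ Finset.range (numEpochs d),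
          (passQueries f d (testError d c δ) center j : ℝ) := hT'
      _ ≤ K * ∑ j ∈ Finset.range (numEpochs d),
          (16 * Real.log (4 / testError d c δ) + 2) * (1 / eps f d (j + 1) ^ 2) := by
          gcongr with j hj
          have hj' := Finset.mem_range.1 hj
          exact passQueries_le hd hf h0 h1 hη hη1 hj'
            (hε (j + 1) (Finset.mem_Icc.2 ⟨by omega, hj'⟩))
            fun h => hcenter (j + 1) (Finset.mem_Icc.2 ⟨h, hj'⟩)
      _ = (K * (16 * Real.log (4 / testError d c δ) + 2)) *
          ∑ i ∈ Finset.Icc 1 (numEpochs d), 1 / eps f d i ^ 2 := by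
          rw [hsum, ← Finset.mul_sum, mul_assoc]
      _ ≤ _ := by
          refine mul_le_mul_of_nonneg_right (maxPasses_mul_log_le hd hc hc1 hδ hδ2)
            (Finset.sum_nonneg fun i _ => by positivity)
  · rw [← ENNReal.ofReal_natCast, ← ENNReal.ofReal_natCast, ← ENNReal.ofReal_pow hp0,
      ← ENNReal.ofReal_mul (by positivity), ← ENNReal.ofReal_mul (by positivity),
      ← ENNReal.ofReal_add (by positivity) (by positivity)]
    refine ENNReal.ofReal_le_ofReal ?_
    have a1 := mul_pow_maxPasses_le hd0 hc hcp hδ hδ2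
    have a2 := maxPasses_mul_testError hd0 hc hδ hδ2
    push_cast
    linarith

end RidgeBandit

namespace RidgeBandit

open Filter Topology

/-! ### The integral bound -/

section Integral

variable {f : ℝ → ℝ} {d : ℕ}

/-- At `b = 1` the function may be discontinuous. The mean value inequality is applied on `[a, w]`
with `w < b`, monotonicity gives `f w ≤ f b`, and then `w` tends to `b`. -/
theorem mul_sub_le_of_le_deriv (hf : MonotoneOn f (Icc (-1) 1))
    (hdiff : DifferentiableOn ℝ f (Ioo 0 1)) {a b M : ℝ} (ha : 0 < a) (hab : a < b) (hb : b ≤ 1)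
    (hM : ∀ z ∈ Ioo a b, M ≤ deriv f z) : M * (b - a) ≤ f b - f a := by
  have key : ∀ w ∈ Ioo a b, M * (w - a) ≤ f b - f a := by
    intro w hw
    have hsub : Icc a w ⊆ Ioo 0 1 := fun z hz =>
      ⟨lt_of_lt_of_le ha hz.1, lt_of_le_of_lt hz.2 (lt_of_lt_of_le hw.2 hb)⟩
    have h1 := (convex_Icc a w).mul_sub_le_image_sub_of_le_deriv
      ((hdiff.mono hsub).continuousOn) (hdiff.mono (interior_subset.trans hsub)) (C := M)
      (fun z hz => by
        rw [interior_Icc] at hz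
        exact hM z ⟨hz.1, hz.2.trans hw.2⟩) a (left_mem_Icc.2 hw.1.le) w
      (right_mem_Icc.2 hw.1.le) hw.1.le
    have h2 := hf (a := w) (b := b) ⟨by linarith [hw.1], by linarith [hw.2]⟩
      ⟨by linarith, hb⟩ hw.2.le
    linarith
  have hlim : Tendsto (fun w => M * (w - a)) (𝓝[<] b) (𝓝 (M * (b - a))) := by
    have : Continuous fun w : ℝ => M * (w - a) := by fun_prop
    exact (this.tendsto b).mono_left nhdsWithin_le_nhds
  refine le_of_tendsto hlim ?_
  filter_upwards [Ioo_mem_nhdsLT hab] with w hw using key w hw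

theorem deriv_nonneg_of_monotoneOn (hf : MonotoneOn f (Icc (-1) 1)) {z : ℝ} (hz : z ∈ Ioo (0 : ℝ) 1) :
    0 ≤ deriv f z := by
  have h : Icc (-1 : ℝ) 1 ∈ 𝓝 z := Icc_mem_nhds (by linarith [hz.1]) hz.2
  rw [← derivWithin_of_mem_nhds h]
  exact hf.derivWithin_nonneg

/-- The points in `x ∈ [√(i/d), √((i+1)/d)]` are those where the local slopes of `f` are bounded in
terms of `eps f d i`. -/
theorem slope_le_eps (hd : 9 ≤ d) (hf : MonotoneOn f (Icc (-1) 1)) (h0 : f 0 = 0) (h1 : f 1 = 1)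
    (hdiff : DifferentiableOn ℝ f (Ioo 0 1)) {i : ℕ} (hi : 1 ≤ i) (him : i ≤ numEpochs d)
    {x y M : ℝ} (hx : x ≤ √(((i + 1 : ℕ) : ℝ) / d)) (hy : y ∈ Icc (1 / (2 * √(d : ℝ))) x)
    (hM : 0 ≤ M)
    (hslope : ∀ z ∈ Icc (1 / 10 * y) (50 * y) ∩ Ioo (0 : ℝ) 1, M ≤ deriv f z) :
    M ≤ 10 * √(2 * d : ℝ) * eps f d i := by
  have hdr : (9 : ℝ) ≤ d := by exact_mod_cast hd
  have hd0 : (0 : ℝ) < d := by linarith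
  have hs : (3 : ℝ) ≤ √(d : ℝ) := Real.le_sqrt_of_sq_le (by linarith)
  have hs0 : (0 : ℝ) < √(d : ℝ) := by linarith
  have hs2d : √(2 * d : ℝ) = √2 * √(d : ℝ) := Real.sqrt_mul (by norm_num) _
  have hsq2 : (7 / 5 : ℝ) ≤ √2 := Real.le_sqrt_of_sq_le (by norm_num)
  have hyx := hy.2.trans hx
  rcases le_or_gt i 100 with hi1 | hi1
  · set η := 1 / √(d : ℝ) with hη
    have hη0 : 0 < η := by positivity
    have hη1 : 3 * η ≤ 1 := by rw [hη, mul_one_div, div_le_one hs0]; exact hs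
    have e1 : 0.2 / √(d : ℝ) = 0.2 * η := by rw [hη]; ring
    have e2 : 2 / √(d : ℝ) = 2 * η := by rw [hη]; ring
    have e5 : 2.8 / √(d : ℝ) = 2.8 * η := by rw [hη]; ring
    have e6 : 1 / (2 * √(d : ℝ)) = η / 2 := by rw [hη]; field_simp
    -- With `η / 2 ≤ y ≤ 20η` the interval `[y/10, 50y]` contains `[2η, 25η]`, and so every point
    -- that enters `initGap`.
    have hyu : y ≤ 20 * η := by
      refine hyx.trans ?_
      rw [Real.sqrt_div (Nat.cast_nonneg _), div_le_iff₀ hs0, hη]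
      have : 20 * (1 / √(d : ℝ)) * √(d : ℝ) = 20 := by field_simp
      rw [this, Real.sqrt_le_left (by norm_num)]
      have : (i : ℝ) ≤ 100 := by exact_mod_cast hi1
      push_cast
      linarith
    have hyl := hy.1
    rw [e6] at hyl
    have hgap : M * (0.2 * η) / 2 ≤ initGap f d := by
      rw [initGap, e1, e2, e5]
      have : M * (0.2 * η) ≤ sInf ((fun z : ℝ => |f (z + 0.2 * η) - f z|) ''
          Icc (2 * η) (2.8 * η)) := by
        refine le_csInf ((nonempty_Icc.2 (by linarith)).image _) ?_
        rintro _ ⟨z, hz, rfl⟩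
        refine le_trans ?_ (le_abs_self _)
        have h := mul_sub_le_of_le_deriv hf hdiff (a := z) (b := z + 0.2 * η) (M := M)
          (by linarith [hz.1]) (by linarith) (by linarith [hz.2])
          (fun w hw => hslope w ⟨⟨by linarith [hz.1, hw.1], by linarith [hz.2, hw.2]⟩,
            ⟨by linarith [hz.1, hw.1], by linarith [hz.2, hw.2]⟩⟩)
        rwa [add_sub_cancel_left] at h
      linarith
    have he : eps f d i = initGap f d := by rw [eps, if_pos hi1]
    rw [he]
    have hη' : √(d : ℝ) * η = 1 := by rw [hη]; field_simp
    have hg0 : 0 ≤ initGap f d := le_trans (by positivity) hgap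
    calc M = 10 * √(d : ℝ) * (M * (0.2 * η) / 2) := by linear_combination (-M) * hη'
      _ ≤ 10 * √(d : ℝ) * initGap f d := by gcongr
      _ ≤ 10 * √(2 * d : ℝ) * initGap f d := by
          gcongr
          linarith
  · set h := 1 / √(2 * d : ℝ) with hh
    have hh0 : 0 < h := step_pos hd
    have e1 : 0.2 / √(2 * d : ℝ) = 0.2 * h := by rw [hh]; ring
    have e2 : 20 / √(2 * d : ℝ) = 20 * h := by rw [hh]; ring
    have hir : (101 : ℝ) ≤ i := by exact_mod_cast hi1
    set Y := √(2 * ((i : ℝ) - 1) / d) with hY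
    have hY1 : Y ≤ 9 / 25 := sqrt_epoch_le hi him
    have hyY : y ≤ Y := by
      refine hyx.trans (Real.sqrt_le_sqrt ?_)
      gcongr
      push_cast
      linarith
    -- This reads `200 ≤ 2 (i - 1)`, which holds from `i = 101` on: the reason for `100` initial
    -- epochs.
    have hhY : 20 * h ≤ Y := by
      rw [← e2]
      refine Real.le_sqrt_of_sq_le ?_
      rw [div_pow, Real.sq_sqrt (by positivity), div_le_div_iff₀ (by positivity) hd0]
      nlinarith
    -- `y` may lie below the range of centers, but raising it to `20h` multiplies it by at most
    -- `40/√2 < 29`. Then `5y'/3 + 0.2h < 50y` and `5y'/6 ≥ y/10`, so the increments at `y'` only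
    -- involve slopes over `[y/10, 50y]`.
    set y' := max (20 * h) y with hy'
    have hy'1 : 20 * h ≤ y' := le_max_left _ _
    have hy'2 : y ≤ y' := le_max_right _ _
    have hy'3 : y' ≤ Y := max_le hhY hyY
    have hy0 : 0 ≤ y := le_trans (by positivity) hy.1
    have hy'4 : y' ≤ 29 * y := by
      refine max_le ?_ (by linarith)
      have hyl' : h ≤ 29 / 20 * y := by
        have h3 : 1 / (2 * √(d : ℝ)) ≤ y := hy.1
        refine le_trans ?_ (mul_le_mul_of_nonneg_left h3 (by norm_num))
        rw [hh, hs2d, mul_one_div, div_le_div_iff₀ (by positivity) (by positivity)]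
        nlinarith
      linarith
    have hwin : M * (0.2 * h) ≤ windowMin f d y' := by
      rw [windowMin, e1]
      refine le_csInf ((nonempty_Icc.2 (by linarith)).image _) ?_
      rintro _ ⟨z, hz, rfl⟩
      refine le_trans ?_ (le_abs_self _)
      have hz1 := hz.1
      have hz2 := hz.2
      have h := mul_sub_le_of_le_deriv hf hdiff (a := z) (b := z + 0.2 * h) (M := M)
        (by linarith) (by linarith) (by linarith)
        (fun w hw => hslope w ⟨⟨by linarith [hw.1], by linarith [hw.2]⟩,
          ⟨by linarith [hw.1], by linarith [hw.2]⟩⟩)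
      rwa [add_sub_cancel_left] at h
    have hbdd : BddAbove (windowMin f d '' Icc (20 / √(2 * d : ℝ)) Y) := by
      refine ⟨1, ?_⟩
      rintro _ ⟨t, ht, rfl⟩
      exact windowMin_le_one hd hf h0 h1 ⟨ht.1, by linarith [ht.2]⟩
    have hsup := le_csSup hbdd (mem_image_of_mem (windowMin f d)
      (⟨by rw [e2]; exact hy'1, hy'3⟩ : y' ∈ Icc (20 / √(2 * d : ℝ)) Y))
    have he : M * (0.2 * h) / 2 ≤ eps f d i := by
      rw [eps, if_neg (not_le.2 hi1)]
      linarith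
    have hh' : √(2 * d : ℝ) * h = 1 := by rw [hh]; field_simp
    calc M = 10 * √(2 * d : ℝ) * (M * (0.2 * h) / 2) := by linear_combination (-M) * hh'
      _ ≤ 10 * √(2 * d : ℝ) * eps f d i := by gcongr

/-- If the supremum were larger, some `y` would have all its squared slopes above a number `q`
exceeding `200dε²`, and `slope_le_eps` with `M = √q` would give `q ≤ (10√(2d) ε)² = 200dε²`. -/
theorem iSup_iInf_slope_le (hd : 9 ≤ d) (hf : MonotoneOn f (Icc (-1) 1)) (h0 : f 0 = 0)
    (h1 : f 1 = 1) (hdiff : DifferentiableOn ℝ f (Ioo 0 1)) {i : ℕ} (hi : 1 ≤ i)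
    (him : i ≤ numEpochs d) (hε : 0 < eps f d i) {x : ℝ} (hx : x ≤ √(((i + 1 : ℕ) : ℝ) / d)) :
    (⨆ y ∈ Icc (1 / (2 * √(d : ℝ))) x, ⨅ z ∈ Icc (1 / 10 * y) (50 * y) ∩ Ioo (0 : ℝ) 1,
      ENNReal.ofReal (deriv f z ^ 2)) ≤ ENNReal.ofReal (200 * d * eps f d i ^ 2) := by
  refine iSup₂_le fun y hy => ?_
  by_contra hcon
  obtain ⟨q, hq1, hq2⟩ := exists_between (not_le.1 hcon)
  have hqtop : q ≠ ⊤ := hq2.ne_top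
  have hq1' : 200 * d * eps f d i ^ 2 < q.toReal :=
    (ENNReal.ofReal_lt_iff_lt_toReal (by positivity) hqtop).1 hq1
  have hslope : ∀ z ∈ Icc (1 / 10 * y) (50 * y) ∩ Ioo (0 : ℝ) 1, √q.toReal ≤ deriv f z := by
    intro z hz
    have h : q ≤ ENNReal.ofReal (deriv f z ^ 2) := hq2.le.trans (iInf₂_le z hz)
    have h2 := ENNReal.toReal_mono ENNReal.ofReal_ne_top h
    rw [ENNReal.toReal_ofReal (sq_nonneg _)] at h2
    exact (Real.sqrt_le_left (deriv_nonneg_of_monotoneOn hf hz.2)).2 h2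
  have h := slope_le_eps hd hf h0 h1 hdiff hi him hx hy (Real.sqrt_nonneg _) hslope
  rw [Real.sqrt_le_left (by positivity), mul_pow, mul_pow, Real.sq_sqrt (by positivity)] at h
  linarith

theorem lintegral_two_mul_Ico {a b : ℝ} (ha : 0 ≤ a) (hab : a ≤ b) :
    ∫⁻ x in Ico a b, ENNReal.ofReal (2 * x) = ENNReal.ofReal (b ^ 2 - a ^ 2) := by
  rw [← ofReal_integral_eq_lintegral_ofReal]
  · rw [integral_Ico_eq_integral_Ioc, ← intervalIntegral.integral_of_le hab,
      intervalIntegral.integral_const_mul, integral_id]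
    congr 1
    ring
  · exact ((continuous_const.mul continuous_id).integrableOn_Icc).mono_set Ico_subset_Icc_self
  · filter_upwards [ae_restrict_mem measurableSet_Ico] with x hx
    have := hx.1
    change 0 ≤ 2 * x
    linarith

/-- The sum of the inverse squared tolerances is bounded by the integral of the inverse squared
slopes. -/
theorem sum_eps_le_burnInIntegral (hd : 9 ≤ d) (hf : MonotoneOn f (Icc (-1) 1)) (h0 : f 0 = 0)
    (h1 : f 1 = 1) (hdiff : DifferentiableOn ℝ f (Ioo 0 1))
    (hε : ∀ i ∈ Finset.Icc 1 (numEpochs d), 0 < eps f d i) :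
    ENNReal.ofReal (∑ i ∈ Finset.Icc 1 (numEpochs d), 1 / eps f d i ^ 2) ≤
      ENNReal.ofReal 200 * (d : ENNReal) ^ 2 * burnInIntegral f d (1 / 10) 50 := by
  have hdr : (9 : ℝ) ≤ d := by exact_mod_cast hd
  have hd0 : (0 : ℝ) < d := by linarith
  set g : ℕ → ℝ := fun i => √((i : ℝ) / d) with hg
  have hgm : Monotone g := fun i j hij => Real.sqrt_le_sqrt (by gcongr)
  set G : ℝ → ENNReal := fun x => ENNReal.ofReal (2 * x) /
      ⨆ y ∈ Icc (1 / (2 * √(d : ℝ))) x, ⨅ z ∈ Icc (1 / 10 * y) (50 * y) ∩ Ioo (0 : ℝ) 1,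
        ENNReal.ofReal (deriv f z ^ 2) with hG
  -- The cell has mass `((i + 1) - i) / d = 1 / d` under `d(x²)`, and the denominator is at most
  -- `200dε_i²` on it.
  have hpiece : ∀ i ∈ Finset.Icc 1 (numEpochs d),
      ENNReal.ofReal (1 / (200 * d ^ 2 * eps f d i ^ 2)) ≤ ∫⁻ x in Ico (g i) (g (i + 1)), G x := by
    intro i hi
    have hi' := Finset.mem_Icc.1 hi
    have hεi := hε i hi
    have hM : 0 < 200 * d * eps f d i ^ 2 := by positivity
    calc ENNReal.ofReal (1 / (200 * d ^ 2 * eps f d i ^ 2))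
        = ENNReal.ofReal (g (i + 1) ^ 2 - g i ^ 2) *
            (ENNReal.ofReal (200 * d * eps f d i ^ 2))⁻¹ := by
          rw [← ENNReal.ofReal_inv_of_pos hM, ← ENNReal.ofReal_mul']
          · congr 1
            simp only [hg]
            rw [Real.sq_sqrt (by positivity), Real.sq_sqrt (by positivity)]
            push_cast
            field_simp
            ring
          · positivity
      _ = ∫⁻ x in Ico (g i) (g (i + 1)),
            ENNReal.ofReal (2 * x) * (ENNReal.ofReal (200 * d * eps f d i ^ 2))⁻¹ := by
          rw [lintegral_mul_const _ (by fun_prop),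
            lintegral_two_mul_Ico (Real.sqrt_nonneg _) (hgm (Nat.le_succ i))]
      _ ≤ ∫⁻ x in Ico (g i) (g (i + 1)), G x := by
          refine setLIntegral_mono' measurableSet_Ico fun x hx => ?_
          rw [← div_eq_mul_inv]
          exact ENNReal.div_le_div_left
            (iSup_iInf_slope_le hd hf h0 h1 hdiff hi'.1 hi'.2 hεi hx.2.le) _
  have hunion : (⋃ i ∈ Finset.Icc 1 (numEpochs d), Ico (g i) (g (i + 1))) ⊆
      Icc (√(1 / d : ℝ)) (1 / 2) := by
    intro x hx
    simp only [mem_iUnion, exists_prop] at hx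
    obtain ⟨i, hi, hx1, hx2⟩ := hx
    have hi' := Finset.mem_Icc.1 hi
    refine ⟨le_trans (Real.sqrt_le_sqrt ?_) hx1, hx2.le.trans ?_⟩
    · have : (1 : ℝ) ≤ i := by exact_mod_cast hi'.1
      gcongr
    · have h2 := numEpochs_lt (d := d)
      -- The last cell ends at `√((m + 1)/d)`, which is at most `1/2` for `d ≥ 9`.
      have h3 : 4 * (i + 1) ≤ d := by omega
      have h4 : (4 : ℝ) * ((i + 1 : ℕ) : ℝ) ≤ d := by exact_mod_cast h3
      rw [Real.sqrt_le_left (by norm_num), div_le_iff₀ hd0]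
      linarith
  have hsum : ∑ i ∈ Finset.Icc 1 (numEpochs d),
      ENNReal.ofReal (1 / (200 * d ^ 2 * eps f d i ^ 2)) ≤ burnInIntegral f d (1 / 10) 50 := by
    calc _ ≤ ∑ i ∈ Finset.Icc 1 (numEpochs d), ∫⁻ x in Ico (g i) (g (i + 1)), G x :=
          Finset.sum_le_sum hpiece
      _ = ∫⁻ x in ⋃ i ∈ Finset.Icc 1 (numEpochs d), Ico (g i) (g (i + 1)), G x := by
          rw [lintegral_biUnion_finset _ fun i _ => measurableSet_Ico]
          intro i _ j _ hij
          exact hgm.pairwise_disjoint_on_Ico_succ hij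
      _ ≤ burnInIntegral f d (1 / 10) 50 := lintegral_mono_set hunion
  have hscale : ENNReal.ofReal (∑ i ∈ Finset.Icc 1 (numEpochs d), 1 / eps f d i ^ 2) =
      ENNReal.ofReal 200 * (d : ENNReal) ^ 2 * ∑ i ∈ Finset.Icc 1 (numEpochs d),
        ENNReal.ofReal (1 / (200 * d ^ 2 * eps f d i ^ 2)) := by
    rw [← ENNReal.ofReal_sum_of_nonneg fun i _ => by positivity, ← ENNReal.ofReal_natCast,
      ← ENNReal.ofReal_pow hd0.le, ← ENNReal.ofReal_mul (by norm_num),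
      ← ENNReal.ofReal_mul (by positivity), Finset.mul_sum]
    congr 1
    refine Finset.sum_congr rfl fun i hi => ?_
    have := hε i hi
    field_simp
  rw [hscale]
  gcongr

end Integral

theorem queryConst_pos {c : ℝ} (hc : 0 < c) (hc1 : c ≤ 1) : 0 < queryConst c := by
  have : 0 ≤ Real.log (1 / c) := Real.log_nonneg (by rwa [one_le_div hc])
  unfold queryConst
  positivity

end RidgeBandit

/-- The tests of the algorithm are run at error probability `δ/L` with `L = 2m log(2m/δ)/c`, where
`c` is an absolute constant: any one that is small enough. The constants `κ₁, κ₂` are absolute, and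
`C` depends on nothing but `c`. -/
theorem theorem3p1 :
    ∃ c₀ κ₁ κ₂ : ℝ, 0 < c₀ ∧ 0 < κ₁ ∧ κ₁ < κ₂ ∧ ∀ c : ℝ, 0 < c → c ≤ c₀ →
      ∃ C : ℝ, 0 < C ∧
        ∀ (d : ℕ) (f : ℝ → ℝ) (δ : ℝ) (θ : RidgeBandit.Vec d) (center : ℕ → ℝ),
          9 ≤ d → MonotoneOn f (Set.Icc (-1) 1) → f 0 = 0 → f 1 = 1 →
          0 < δ → δ < 1 / 2 → ‖θ‖ = 1 →
          (∀ i ∈ Finset.Icc 1 (RidgeBandit.numEpochs d), 0 < RidgeBandit.eps f d i) →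
          (∀ i ∈ Finset.Icc 101 (RidgeBandit.numEpochs d),
            RidgeBandit.IsCenter f d (RidgeBandit.xPre d i) (center i)) →
          RidgeBandit.seedLaw d {ω | ¬ ∃ (a : RidgeBandit.Vec d) (T : ℕ),
            RidgeBandit.Outputs f c δ center (RidgeBandit.oracle f θ) ω a T ∧
            ‖a‖ ≤ 1 ∧
            1 / 2 ≤ inner ℝ θ a ∧
            (T : ℝ) ≤ C * Real.log (d / δ) ^ 2 *
              ∑ i ∈ Finset.Icc 1 (RidgeBandit.numEpochs d), 1 / RidgeBandit.eps f d i ^ 2 ∧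
            (DifferentiableOn ℝ f (Set.Ioo 0 1) →
              (T : ENNReal) ≤ ENNReal.ofReal (C * Real.log (d / δ) ^ 2) * (d : ENNReal) ^ 2 *
                RidgeBandit.burnInIntegral f d κ₁ κ₂)}
            ≤ ENNReal.ofReal δ := by
  have hp := RidgeBandit.dirProb_pos
  refine ⟨RidgeBandit.dirProb / (1 + RidgeBandit.dirProb), 1 / 10, 50, by positivity, by norm_num,
    by norm_num, fun c hc hcp => ?_⟩
  have hc1 : c ≤ 1 := hcp.trans (by rw [div_le_one (by linarith)]; linarith)
  have hC := RidgeBandit.queryConst_pos hc hc1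
  -- Only the integral bound needs the factor `200`; a single `C` serves both bounds.
  refine ⟨200 * RidgeBandit.queryConst c, by positivity, ?_⟩
  intro d f δ θ center hd hf h0 h1 hδ hδ2 hθ hε hcenter
  refine le_trans (measure_mono fun ω hω => ?_)
    (RidgeBandit.search_failure_le hc hcp hd hf h0 h1 hδ hδ2 hθ hε hcenter)
  rintro ⟨a, T, hout, ha, hia, hT⟩
  refine hω ⟨a, T, hout, ha, hia, hT.trans ?_, fun hdiff => ?_⟩
  · have hS : 0 ≤ ∑ i ∈ Finset.Icc 1 (RidgeBandit.numEpochs d), 1 / RidgeBandit.eps f d i ^ 2 :=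
      Finset.sum_nonneg fun i _ => by positivity
    gcongr
    linarith
  · have hsum := RidgeBandit.sum_eps_le_burnInIntegral hd hf h0 h1 hdiff hε
    calc (T : ENNReal) = ENNReal.ofReal T := (ENNReal.ofReal_natCast T).symm
      _ ≤ ENNReal.ofReal (RidgeBandit.queryConst c * Real.log (d / δ) ^ 2) *
          ENNReal.ofReal (∑ i ∈ Finset.Icc 1 (RidgeBandit.numEpochs d),
            1 / RidgeBandit.eps f d i ^ 2) := by
          rw [← ENNReal.ofReal_mul (by positivity)]
          exact ENNReal.ofReal_le_ofReal hT
      _ ≤ ENNReal.ofReal (RidgeBandit.queryConst c * Real.log (d / δ) ^ 2) *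
          (ENNReal.ofReal 200 * (d : ENNReal) ^ 2 *
            RidgeBandit.burnInIntegral f d (1 / 10) 50) := by gcongr
      _ = ENNReal.ofReal (200 * RidgeBandit.queryConst c * Real.log (d / δ) ^ 2) *
          (d : ENNReal) ^ 2 * RidgeBandit.burnInIntegral f d (1 / 10) 50 := by
          rw [mul_assoc (200 : ℝ), ENNReal.ofReal_mul (by norm_num : (0 : ℝ) ≤ 200)]
          ring
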